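/- **Setting.** Let $N\ge 1$, $\eta,\alpha\in\mathbb C$, $\xi=(\xi_1,\dots,\xi_N)\in\mathbb C^N$. Let $R(\lambda)$ be the trigonometric six-vertex $R$-matrix on $\mathbb C^2\otimes\mathbb C^2$ with diagonal entries $\sinh(\lambda+\eta),\sinh\lambda,\sinh\lambda,\sinh(\lambda+\eta)$ and off-diagonal (exchange) entries $\sinh\eta$. Let $K=\mathrm{diag}(e^{\alpha},e^{-\alpha})$, and let $T(\lambda)=\mathrm{tr}_0\,K_0R_{0N}(\lambda-\xi_N)\cdots R_{01}(\lambda-\xi_1)$ be the transfer matrix on $\mathcal H=(\mathbb C^2)^{\otimes N}$. Put $S_z=\sum_n\sigma_n^z$, $d(\lambda)=\prod_{n}\sinh(\lambda-\xi_n)$, $a(\lambda)=d(\lambda+\eta)$, $\beta(\lambda)=e^{\alpha}a(\lambda)$, $\alpha(\lambda)=\beta(\lambda)\beta(\lambda-\eta)$, $\mathrm{qdet}(\lambda)=a(\lambda)d(\lambda-\eta)\det K$. For an integer $l$, $\Sigma^{(l)}$ is the set of functions $$t_x(\lambda)=\frac{2\cosh\alpha\,\cosh(\eta l/2)}{\cosh(\eta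 N/2)}\,d(\lambda)+\sum_{n=1}^N g_n(\lambda)x_n,\qquad g_n(\lambda)=\frac{\cosh(\eta N/2+\lambda-\xi_n)}{\cosh(\eta N/2)}\prod_{b\ne n}\frac{\sinh(\lambda-\xi_b)}{\sinh(\xi_n-\xi_b)},$$ where $x\in\mathbb C^N$ satisfies $x_n\,t_x(\xi_n-\eta)=a(\xi_n)d(\xi_n-\eta)\det K$ for all $n$ and the sum rule $$\sum_{\epsilon=\pm1}\epsilon\, e^{\epsilon\eta N/2}\cosh\!\big(\tfrac{\eta}{2}l+\epsilon\alpha\big)=\sum_{n=1}^N\frac{x_n}{\prod_{b\neq n}\sinh(\xi_n-\xi_b)} .$$ For an entire function $t$ and $0\le M\le N$, a *$Q$-function of degree $M$ for $t$* is a function $Q(\lambda)=\prod_{n=1}^M\sinh(\lambda-\lambda_n)$ with $\lambda_n\notin\xi_m+i\pi\mathbb Z$ for all $n,m$, such that for all $\lambda$ $$\alpha(\lambda)Q(\lambda-2\eta)-\beta(\lambda)\,t(\lambda-\eta)\,Q(\lambda-\eta)+\mathrm{qdet}(\lambda)\,Q(\lambda)=0 .$$ For a covector $\langle S|$ put $\langle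 h_1,\dots,h_N|=\langle S|\prod_n\big(T(\xi_n)/(e^{\alpha}a(\xi_n))\big)^{h_n}$, $h\in\{0,1\}^N$; when these $2^N$ covectors are a basis of $\mathcal H^*$ they are called a left SoV basis. **Theorem.** Assume that $K\ne xI$ for every $x\in\mathbb C$, that $e^{2j\eta}\ne1$ for $1\le j\le N$, and that $e^{2\alpha}\neq e^{k\eta}$ for $k\in\{-N,2-N,\dots,N-2,N\}$. Then there is a nonzero polynomial $P$ in $N$ variables, depending only on $N,\eta,\alpha$, such that the following holds for all $\xi$ with $$\xi_a\ne\xi_b+r\eta+im\pi\qquad(a\ne b,\ r\in\{-1,0,1\},\ m\in\mathbb Z),$$ every entire function $t$ and every $0\le M\le N$. 1. If $P(e^{\xi_1},\dots,e^{\xi_N})\ne0$ (that is, for generic $\xi$), then $t\in\Sigma^{(N-2M)}$ if and only if there is a $Q$-function $Q_t$ of degree $M$ for $t$ which is unique up to sign among the $Q$-functions for $t$ of all degrees $\le N$. Moreover, $t\in\Sigma^{(N-2M)}$ if and only if there is $|v\rangle\neq0$ with $T(\lambda)|v\rangle=t(\lambda)|v\rangle$ for all $\lambda$ and $S_z|v\rangle=(N-2M)|v\rangle$.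 2. (No genericity of $\xi$.) If $Q_t$ is a $Q$-function of degree $M$ for $t$, then $t\in\Sigma^{(N-2M)}$, every $Q$-function for $t$ of degree $\le N$ is $\pm Q_t$, and for every left SoV basis there is $|t\rangle\ne0$ with $T(\lambda)|t\rangle=t(\lambda)|t\rangle$ for all $\lambda$, $S_z|t\rangle=(N-2M)|t\rangle$, and $$\langle h_1,\dots,h_N|t\rangle=\prod_{n=1}^N Q_t(\xi_n-h_n\eta)\qquad\text{for all }h\in\{0,1\}^N;$$ every other vector $|w\rangle$ with $T(\lambda)|w\rangle=t(\lambda)|w\rangle$ for all $\lambda$ is a multiple of $|t\rangle$. -/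

import Mathlib

namespace XXZ

noncomputable section

open Complex Matrix

/-- Spin configurations of the chain; `0` is "up" (`σᶻ = 1`) and `1` is "down" (`σᶻ = -1`).
The quantum space `⊗ₙ ℂ²` is `Conf N → ℂ`, with the configurations as its standard basis. -/
abbrev Conf (N : ℕ) : Type := Fin N → Fin 2

/-- Operators on the quantum space. -/
abbrev Op (N : ℕ) : Type := Matrix (Conf N) (Conf N) ℂ

/-- Operators on the tensor product of the auxiliary space `ℂ²` and the quantum space. -/
abbrev AuxOp (N : ℕ) : Type := Matrix (Fin 2 × Conf N) (Fin 2 × Conf N) ℂ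

/-- The trigonometric six-vertex `R`-matrix on `ℂ² ⊗ ℂ²`. -/
def Rmat (η u : ℂ) : Matrix (Fin 2 × Fin 2) (Fin 2 × Fin 2) ℂ := fun p q =>
  if p = q then (if p.1 = p.2 then sinh (u + η) else sinh u)
  else if p.1 = q.2 ∧ p.2 = q.1 then sinh η else 0

/-- `R₀ₙ(u)`: the `R`-matrix acting on the auxiliary space and the `n`-th site, and as the
identity on the other sites. -/
def siteR {N : ℕ} (η u : ℂ) (n : Fin N) : AuxOp N := fun p q =>
  if ∀ m, m ≠ n → p.2 m = q.2 m then Rmat η u (p.1, p.2 n) (q.1, q.2 n) else 0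

/-- The diagonal twist matrix `K^{(a=0,α)}`. -/
def twist (α : ℂ) : Matrix (Fin 2) (Fin 2) ℂ := !![exp α, 0; 0, exp (-α)]

/-- `K₀`: the twist acting on the auxiliary space. -/
def auxTwist (N : ℕ) (α : ℂ) : AuxOp N := fun p q =>
  if p.2 = q.2 then twist α p.1 q.1 else 0

/-- The monodromy matrix `M₀(u) = K₀ R₀N(u - ξ_N) ⋯ R₀₁(u - ξ₁)`. -/
def monodromy {N : ℕ} (η α : ℂ) (ξ : Fin N → ℂ) (u : ℂ) : AuxOp N :=
  auxTwist N α * (List.ofFn fun n : Fin N => siteR η (u - ξ n) n).reverse.prod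

/-- The transfer matrix: the trace of the monodromy matrix over the auxiliary space. -/
def transfer {N : ℕ} (η α : ℂ) (ξ : Fin N → ℂ) (u : ℂ) : Op N := fun s s' =>
  ∑ i : Fin 2, monodromy η α ξ u (i, s) (i, s')

/-- The operator `S_z = ∑ₙ σₙᶻ`. -/
def Sz (N : ℕ) : Op N := Matrix.diagonal fun s => ∑ n, if s n = 0 then (1 : ℂ) else -1

/-- `a(u) = ∏ₙ sinh (u - ξₙ + η)`. -/
def aFun {N : ℕ} (η : ℂ) (ξ : Fin N → ℂ) (u : ℂ) : ℂ := ∏ n, sinh (u - ξ n + η)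

/-- `d(u) = ∏ₙ sinh (u - ξₙ)`. -/
def dFun {N : ℕ} (ξ : Fin N → ℂ) (u : ℂ) : ℂ := ∏ n, sinh (u - ξ n)

/-- The quantum determinant `a(u) d(u - η) det K`. -/
def qdet {N : ℕ} (η α : ℂ) (ξ : Fin N → ℂ) (u : ℂ) : ℂ :=
  aFun η ξ u * dFun ξ (u - η) * (twist α).det

/-- The inhomogeneity condition: `ξ_a ≠ ξ_b + r η + i m π` for `a ≠ b`, `r ∈ {-1,0,1}`, `m ∈ ℤ`. -/
def Inhomogeneous {N : ℕ} (η : ℂ) (ξ : Fin N → ℂ) : Prop :=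
  ∀ a b : Fin N, a ≠ b → ∀ r : ℤ, (r = -1 ∨ r = 0 ∨ r = 1) → ∀ m : ℤ,
    ξ a ≠ ξ b + r * η + m * Real.pi * I

/-- The interpolation function
`gₙ(u) = (cosh (ηN/2 + u - ξₙ) / cosh (ηN/2)) ∏_{b ≠ n} sinh (u - ξ_b) / sinh (ξₙ - ξ_b)`. -/
def gFun {N : ℕ} (η : ℂ) (ξ : Fin N → ℂ) (n : Fin N) (u : ℂ) : ℂ :=
  cosh (η * N / 2 + u - ξ n) / cosh (η * N / 2) *
    ∏ b ∈ Finset.univ.erase n, sinh (u - ξ b) / sinh (ξ n - ξ b)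

/-- The trigonometric polynomial with prescribed values `xₙ` at the `ξₙ`, depending also on `l`:
`2 (cosh α cosh (ηl/2) / cosh (ηN/2)) ∏ₙ sinh (u - ξₙ) + ∑ₙ gₙ(u) xₙ`. -/
def interp {N : ℕ} (η α : ℂ) (ξ : Fin N → ℂ) (l : ℤ) (x : Fin N → ℂ) (u : ℂ) : ℂ :=
  2 * (cosh α * cosh (η * l / 2) / cosh (η * N / 2)) * ∏ n, sinh (u - ξ n)
    + ∑ n, gFun η ξ n u * x n

/-- The set `Σ^{(l)}`: all `interp η α ξ l x` with `x` a solution of the `N` quadratic equations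
and of the sum rule that fixes the integer `l`. -/
def SigmaSet {N : ℕ} (η α : ℂ) (ξ : Fin N → ℂ) (l : ℤ) : Set (ℂ → ℂ) :=
  {t | ∃ x : Fin N → ℂ,
    (∀ n, x n * interp η α ξ l x (ξ n - η) =
      aFun η ξ (ξ n) * dFun ξ (ξ n - η) * (twist α).det) ∧
    (exp (η * N / 2) * cosh (η / 2 * l + α) - exp (-(η * N / 2)) * cosh (η / 2 * l - α) =
      ∑ n, x n / ∏ b ∈ Finset.univ.erase n, sinh (ξ n - ξ b)) ∧
    t = interp η α ξ l x}

/-- `v` satisfies `T(u) v = t(u) v` for all `u`. -/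
def IsEigen {N : ℕ} (η α : ℂ) (ξ : Fin N → ℂ) (t : ℂ → ℂ) (v : Conf N → ℂ) : Prop :=
  ∀ u, transfer η α ξ u *ᵥ v = t u • v

/-- The covector `⟨h₁,…,h_N| = ⟨S| ∏ₙ (T(ξₙ) / (e^α a(ξₙ)))^{hₙ}`. -/
def sovCovector {N : ℕ} (η α : ℂ) (ξ : Fin N → ℂ) (S : Conf N → ℂ) (h : Conf N) : Conf N → ℂ :=
  S ᵥ* (List.ofFn fun n : Fin N =>
    ((exp α * aFun η ξ (ξ n))⁻¹ • transfer η α ξ (ξ n)) ^ (h n : ℕ)).prod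

/-- The `2^N` covectors `⟨h|` built on `⟨S|` are a basis of the (`2^N`-dimensional) space of
covectors, i.e. they are linearly independent. -/
def IsSoVBasis {N : ℕ} (η α : ℂ) (ξ : Fin N → ℂ) (S : Conf N → ℂ) : Prop :=
  LinearIndependent ℂ (sovCovector η α ξ S)

/-- `β(u) = e^α a(u)`. -/
def betaFun {N : ℕ} (η α : ℂ) (ξ : Fin N → ℂ) (u : ℂ) : ℂ := exp α * aFun η ξ u

/-- `α(u) = β(u) β(u - η)`. -/
def alphaFun {N : ℕ} (η α : ℂ) (ξ : Fin N → ℂ) (u : ℂ) : ℂ :=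
  betaFun η α ξ u * betaFun η α ξ (u - η)

/-- `Q(u) = ∏_{n ≤ M} sinh (u - λₙ)` with all `λₙ ≠ ξₘ + i r π`, `r ∈ ℤ`. -/
def IsQForm {N : ℕ} (ξ : Fin N → ℂ) (M : ℕ) (Q : ℂ → ℂ) : Prop :=
  ∃ root : Fin M → ℂ, (∀ n m, ∀ r : ℤ, root n ≠ ξ m + r * Real.pi * I) ∧
    ∀ u, Q u = ∏ n, sinh (u - root n)

/-- The quantum spectral curve (second order Baxter) equation. -/
def SpectralCurve {N : ℕ} (η α : ℂ) (ξ : Fin N → ℂ) (t Q : ℂ → ℂ) : Prop :=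
  ∀ u, alphaFun η α ξ u * Q (u - 2 * η) - betaFun η α ξ u * t (u - η) * Q (u - η)
    + qdet η α ξ u * Q u = 0

/-- `Q` is of the admissible form of degree `M` and solves the spectral curve equation with `t`. -/
def IsQSolution {N : ℕ} (η α : ℂ) (ξ : Fin N → ℂ) (t : ℂ → ℂ) (M : ℕ) (Q : ℂ → ℂ) : Prop :=
  IsQForm ξ M Q ∧ SpectralCurve η α ξ t Q

end

end XXZ

/-!
The proof rewrites all functions of the spectral parameter `u` as polynomials in `e^{2u}`, up to a
factor `e^{-du}` (`trig`), and works with the polynomial `P` of `t`.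

**The set `Σ`.** A function `t` lies in `Σ^{(N-2M)}` if and only if `t(u) = e^{-Nu} P(e^{2u})` for a
`P` of degree at most `N` whose two extreme coefficients have the values prescribed by the sector
with `M` down spins, and which satisfies the fusion relation
`t(ξ_n) t(ξ_n - η) = a(ξ_n) d(ξ_n - η)` (`IsSpectral`, `mem_SigmaSet_iff`): `g_n` interpolates, and
the sum rule together with the term in `d` encodes the extreme coefficients.

**The Baxter equation.** Division by `a(u + η)` turns the spectral curve equation into
`t(u) Q(u) = e^α a(u) Q(u - η) + e^{-α} d(u) Q(u + η)` (`spectralCurve_iff`), that is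
`baxter η α ξ M P q = 0` for the polynomial `q` of `Q`. By fusion, the operator applied to any `q`
vanishes at `ξ_n - η` as soon as it vanishes at `ξ_n`, and its lowest coefficient vanishes
identically. Hence a polynomial of degree at most `N` solves the equation if it solves the `N`
linear equations at the points `ξ_n` (`IsSpectral.baxter_eq_zero`), and these have a nonzero
solution among the polynomials of degree at most `N`, a space of dimension `N + 1`. Under the
assumptions on `η` and `α` the extreme coefficients of the equation force the degree to be `M` and
the constant term to be nonzero, so that solutions are unique up to a factor; they also recover
`M` from `P` (`IsSpectral.exists_baxter_eq_zero`, `IsSpectral.C_mul_eq_C_mul`,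
`IsSpectral.sector_unique`).

**Genericity.** Such a solution is a `Q`-function unless it vanishes at some `e^{2ξ_n}`. In that
case it vanishes at `e^{2(ξ_n - η)}` as well, so it depends on `M - 1` parameters only. Its quantum
Wronskian with the solution for reversed spins, which has `N - M` roots, is a nonzero multiple of
`∏ (X - e^{2ξ_n})`; thus the `N` symmetric functions of the `e^{2ξ_n}` are polynomials in
`N - 1` parameters and satisfy an algebraic relation (`exists_generic_polynomial`).

**The spectrum.** Eigenvalues of the transfer matrix belong to `Σ` by its asymptotics and by fusion
(`transfer_mul_transfer`, `IsEigen.exists_isSpectral`). Conversely, an eigenvector is written down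
for every spectral `P`, without genericity of `ξ`: it is a combination of the Bethe vectors
`B(ξ_{j_1}) ⋯ B(ξ_{j_M}) |0⟩`, whose coefficient is a maximal minor of the linear system for the
Baxter equation times an explicit weight (`amplitude`). The eigenvalue equation is Cramer's rule
combined with Lagrange interpolation (`IsSpectral.amplitude_mul`). The vector is nonzero because
these Bethe vectors are joint eigenvectors of the operators `D(ξ_n)`, which separate them, and
because a vanishing of all maximal minors would give a second solution of the Baxter equation
(`bethe_coeff_eq_zero`, `IsSpectral.exists_amplitude_ne_zero`).

**Separated bases.** The components of an eigenvector in a left SoV basis factorize into the numbers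
`t(ξ_n) / (e^α a(ξ_n))`, which the Baxter equation at `ξ_n` identifies with
`Q(ξ_n - η) / Q(ξ_n)`. This gives the formula for the components and shows that the
eigenspace is a line (`IsEigen.sovCovector_dotProduct`, `IsQSolution.exists_isEigen`).
-/

namespace XXZ

open Complex Matrix Polynomial

/-! ### Trigonometric polynomials -/

section

/-- The trigonometric polynomial `e^{-du} p(e^{2u})`. For `natDegree p ≤ d` its exponents are
`-d, 2 - d, …, d`, but no bound on the degree of `p` is imposed here. -/
noncomputable def trig (d : ℕ) (p : ℂ[X]) (u : ℂ) : ℂ := exp (-(d * u)) * p.eval (exp (2 * u))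

lemma trig_mul (d e : ℕ) (p q : ℂ[X]) (u : ℂ) :
    trig d p u * trig e q u = trig (d + e) (p * q) u := by
  have : exp (-((d + e : ℕ) * u)) = exp (-(d * u)) * exp (-(e * u)) := by
    rw [← Complex.exp_add]; push_cast; ring_nf
  simp only [trig, this, eval_mul]; ring

lemma trig_add (d : ℕ) (p q : ℂ[X]) (u : ℂ) : trig d (p + q) u = trig d p u + trig d q u := by
  simp only [trig, eval_add]; ring

lemma trig_sub (d : ℕ) (p q : ℂ[X]) (u : ℂ) : trig d (p - q) u = trig d p u - trig d q u := by
  simp only [trig, eval_sub]; ring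

@[simp] lemma trig_zero (d : ℕ) (u : ℂ) : trig d 0 u = 0 := by simp [trig]

lemma trig_C_mul (d : ℕ) (c : ℂ) (p : ℂ[X]) (u : ℂ) : trig d (C c * p) u = c * trig d p u := by
  simp only [trig, eval_mul, eval_C]; ring

lemma trig_sum (d : ℕ) {ι : Type*} (s : Finset ι) (p : ι → ℂ[X]) (u : ℂ) :
    trig d (∑ i ∈ s, p i) u = ∑ i ∈ s, trig d (p i) u := by
  simp only [trig, eval_finsetSum, Finset.mul_sum]

lemma trig_shift (d : ℕ) (p : ℂ[X]) (u c : ℂ) :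
    trig d p (u + c) = exp (-(d * c)) * trig d (p.comp (C (exp (2 * c)) * X)) u := by
  simp only [trig, eval_comp, eval_mul, eval_C, eval_X, ← mul_assoc, ← Complex.exp_add]
  ring_nf

/-- Raising the frequency bound by two multiplies the polynomial by `X`. -/
lemma trig_add_two (d : ℕ) (p : ℂ[X]) (u : ℂ) : trig (d + 2) (X * p) u = trig d p u := by
  simp only [trig, eval_mul, eval_X, ← mul_assoc, ← Complex.exp_add]
  push_cast; ring_nf

lemma trig_prod {ι : Type*} (s : Finset ι) (p : ι → ℂ[X]) (u : ℂ) :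
    trig s.card (∏ i ∈ s, p i) u = ∏ i ∈ s, trig 1 (p i) u := by
  classical
  induction s using Finset.induction_on with
  | empty => simp [trig]
  | insert a s ha ih =>
    rw [Finset.prod_insert ha, Finset.prod_insert ha, Finset.card_insert_of_notMem ha, ← ih,
      add_comm, trig_mul]

/-- The polynomial `(e^{-c}/2)(X - e^{2c})` of `sinh (u - c)`. -/
noncomputable def sinhPoly (c : ℂ) : ℂ[X] := C (exp (-c) / 2) * (X - C (exp (2 * c)))

lemma trig_sinhPoly (c u : ℂ) : trig 1 (sinhPoly c) u = sinh (u - c) := by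
  simp only [trig, sinhPoly, eval_mul, eval_sub, eval_C, eval_X, Complex.sinh]
  have h1 : exp (u - c) = exp (-(1 * u)) * exp (-c) * exp (2 * u) := by
    rw [← Complex.exp_add, ← Complex.exp_add]; ring_nf
  have h2 : exp (-(u - c)) = exp (-(1 * u)) * exp (-c) * exp (2 * c) := by
    rw [← Complex.exp_add, ← Complex.exp_add]; ring_nf
  rw [h1, h2]; push_cast; ring

lemma natDegree_sinhPoly (c : ℂ) : (sinhPoly c).natDegree = 1 := by
  rw [sinhPoly, natDegree_C_mul (by simp [Complex.exp_ne_zero]), natDegree_X_sub_C]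

lemma sinhPoly_coeff_one (c : ℂ) : (sinhPoly c).coeff 1 = exp (-c) / 2 := by
  simp [sinhPoly]

lemma sinhPoly_coeff_zero (c : ℂ) : (sinhPoly c).coeff 0 = -(exp c / 2) := by
  have : exp (-c) * exp (2 * c) = exp c := by rw [← Complex.exp_add]; ring_nf
  simp only [sinhPoly, coeff_C_mul, coeff_sub, coeff_X_zero, coeff_C_zero, ← this]; ring

lemma sinhPoly_ne_zero (c : ℂ) : sinhPoly c ≠ 0 := fun h => by
  have := natDegree_sinhPoly c; rw [h] at this; simp at this

lemma sinh_eq_zero_iff_exp (u : ℂ) : sinh u = 0 ↔ exp (2 * u) = 1 := by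
  have h : exp (2 * u) = exp u * exp u := by rw [← Complex.exp_add]; ring_nf
  have h2 : exp u * exp (-u) = 1 := by rw [← Complex.exp_add]; simp
  have h0 := Complex.exp_ne_zero u
  rw [Complex.sinh, h]
  constructor
  · intro h3
    have : exp u = exp (-u) := by linear_combination 2 * h3
    rwa [← this] at h2
  · intro h3
    have : exp u * (exp u - exp (-u)) = 0 := by linear_combination h3 - h2
    rcases mul_eq_zero.mp this with h | h
    · exact absurd h h0
    · rw [h]; simp

lemma sinh_sub_eq_zero_iff (u c : ℂ) : sinh (u - c) = 0 ↔ exp (2 * u) = exp (2 * c) := by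
  rw [sinh_eq_zero_iff_exp, mul_sub, Complex.exp_sub, div_eq_one_iff_eq (Complex.exp_ne_zero _)]

lemma sinh_eq_zero_iff_int (u : ℂ) : sinh u = 0 ↔ ∃ m : ℤ, u = m * Real.pi * I := by
  rw [sinh_eq_zero_iff_exp, Complex.exp_eq_one_iff]
  refine exists_congr fun m => ⟨fun h => ?_, fun h => ?_⟩
  · linear_combination h / 2
  · rw [h]; ring

/-- A polynomial with more nonzero roots `e^{2x}` than its degree allows is zero. -/
lemma eq_zero_of_trig_roots {p : ℂ[X]} {d e : ℕ} (hp : p.natDegree ≤ d) {ι : Type*}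
    (s : Finset ι) (x : ι → ℂ) (hx : Set.InjOn (fun i => exp (2 * x i)) s)
    (hr : ∀ i ∈ s, trig e p (x i) = 0) (hs : d < s.card) : p = 0 := by
  classical
  by_contra h0
  have hsub : s.image (fun i => exp (2 * x i)) ⊆ p.roots.toFinset := by
    intro z hz
    obtain ⟨i, hi, rfl⟩ := Finset.mem_image.mp hz
    rw [Multiset.mem_toFinset, mem_roots h0]
    have := hr i hi
    rw [trig, mul_eq_zero] at this
    exact this.resolve_left (Complex.exp_ne_zero _)
  have h1 := Finset.card_le_card hsub
  rw [Finset.card_image_of_injOn hx] at h1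
  have h2 := Multiset.toFinset_card_le p.roots
  have h3 := p.card_roots'
  omega

/-- As `eq_zero_of_trig_roots`, with the vanishing of the constant coefficient as one more root. -/
lemma eq_zero_of_trig_roots_of_coeff_zero {p : ℂ[X]} {d e : ℕ} (hp : p.natDegree ≤ d)
    (h0 : p.coeff 0 = 0) {ι : Type*}
    (s : Finset ι) (x : ι → ℂ) (hx : Set.InjOn (fun i => exp (2 * x i)) s)
    (hr : ∀ i ∈ s, trig e p (x i) = 0) (hs : d ≤ s.card) (hd : 1 ≤ d) : p = 0 := by
  obtain ⟨q, rfl⟩ := X_dvd_iff.mpr h0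
  by_cases hq : q = 0
  · simp [hq]
  have hdeg : q.natDegree ≤ d - 1 := by
    rw [natDegree_X_mul hq] at hp; omega
  have := eq_zero_of_trig_roots (e := e) hdeg s x hx (fun i hi => by
    have := hr i hi
    simp only [trig, eval_mul, eval_X, mul_eq_zero, Complex.exp_ne_zero, false_or] at this
    simp [trig, this]) (by omega)
  simp [this]

lemma trig_injective {d : ℕ} {p q : ℂ[X]} (h : ∀ u, trig d p u = trig d q u) : p = q := by
  refine Polynomial.eq_of_infinite_eval_eq p q (Set.Infinite.mono (s := {z : ℂ | z ≠ 0}) ?_ ?_)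
  · intro z (hz : z ≠ 0)
    have := h (log z / 2)
    simp only [trig, mul_eq_mul_left_iff, Complex.exp_ne_zero, or_false] at this
    rwa [mul_div_cancel₀ _ two_ne_zero, Complex.exp_log hz] at this
  · exact (Set.finite_singleton (0 : ℂ)).infinite_compl

lemma continuous_trig (d : ℕ) (p : ℂ[X]) : Continuous (trig d p) := by
  unfold trig
  exact (by fun_prop : Continuous fun u : ℂ => exp (-(d * u))).mul
    (p.continuous.comp (by fun_prop : Continuous fun u : ℂ => exp (2 * u)))

/-- The zeros of a nonzero trigonometric polynomial have dense complement. -/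
lemma dense_trig_ne_zero (d : ℕ) {p : ℂ[X]} (hp : p ≠ 0) : Dense {u | trig d p u ≠ 0} := by
  have hc : {u | trig d p u ≠ 0}ᶜ.Countable := by
    have : {u | trig d p u ≠ 0}ᶜ ⊆ ⋃ z ∈ (p.roots.toFinset : Set ℂ), {u | exp (2 * u) = z} := by
      intro u hu
      simp only [Set.mem_compl_iff, Set.mem_ofPred_eq, not_not, trig, mul_eq_zero,
        Complex.exp_ne_zero, false_or] at hu
      simp only [Set.mem_iUnion, Set.mem_ofPred_eq, exists_prop, exists_eq_right']
      simpa [hp] using hu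
    refine Set.Countable.mono this (Set.Countable.biUnion (Finset.countable_toSet _) ?_)
    intro z _
    by_cases hz : ∃ u₀, exp (2 * u₀) = z
    · obtain ⟨u₀, rfl⟩ := hz
      refine Set.Countable.mono (s₂ := Set.range fun n : ℤ => u₀ + n * (Real.pi * I)) ?_
        (Set.countable_range _)
      intro u hu
      obtain ⟨n, hn⟩ := Complex.exp_eq_exp_iff_exists_int.mp hu
      exact ⟨n, by linear_combination -hn / 2⟩
    · convert Set.countable_empty
      ext u; simp only [Set.mem_ofPred_eq, Set.mem_empty_iff_false, iff_false]
      exact fun h => hz ⟨u, h⟩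
  simpa using hc.dense_compl ℝ

/-- Two continuous functions that agree off the zeros of a trigonometric polynomial are equal. -/
lemma eq_of_mul_trig_eq {d : ℕ} {p : ℂ[X]} (hp : p ≠ 0) {f g : ℂ → ℂ} (hf : Continuous f)
    (hg : Continuous g) (h : ∀ u, trig d p u ≠ 0 → f u = g u) : f = g :=
  Continuous.ext_on (dense_trig_ne_zero d hp) hf hg fun u hu => h u hu

end

/-! ### The Baxter operator on polynomials -/

section

variable {N : ℕ}

/-- The polynomial of `d(u)`. -/
noncomputable def dPoly (ξ : Fin N → ℂ) : ℂ[X] := ∏ n, sinhPoly (ξ n)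

lemma trig_dPoly (ξ : Fin N → ℂ) (u : ℂ) : trig N (dPoly ξ) u = dFun ξ u := by
  have := trig_prod Finset.univ (fun n => sinhPoly (ξ n)) u
  rw [Finset.card_univ, Fintype.card_fin] at this
  simp only [dPoly, this, trig_sinhPoly, dFun]

lemma aFun_eq_dFun (η : ℂ) (ξ : Fin N → ℂ) (u : ℂ) : aFun η ξ u = dFun ξ (u + η) := by
  unfold aFun dFun
  exact Finset.prod_congr rfl fun n _ => by ring_nf

lemma aFun_eq_trig (η : ℂ) (ξ : Fin N → ℂ) (u : ℂ) :
    aFun η ξ u = exp (-(N * η)) * trig N ((dPoly ξ).comp (C (exp (2 * η)) * X)) u := by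
  rw [aFun_eq_dFun, ← trig_dPoly, trig_shift]

lemma natDegree_dPoly (ξ : Fin N → ℂ) : (dPoly ξ).natDegree = N := by
  rw [dPoly, natDegree_prod _ _ fun n _ => sinhPoly_ne_zero (ξ n)]
  simp [natDegree_sinhPoly]

lemma dPoly_ne_zero (ξ : Fin N → ℂ) : dPoly ξ ≠ 0 :=
  Finset.prod_ne_zero_iff.mpr fun n _ => sinhPoly_ne_zero (ξ n)

/-- The leading coefficient of `d(u)`. -/
noncomputable def dLead (ξ : Fin N → ℂ) : ℂ := ∏ n, (exp (-ξ n) / 2)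

/-- The lowest coefficient of `d(u)`. -/
noncomputable def dTrail (ξ : Fin N → ℂ) : ℂ := ∏ n, (-(exp (ξ n) / 2))

lemma dLead_ne_zero (ξ : Fin N → ℂ) : dLead ξ ≠ 0 :=
  Finset.prod_ne_zero_iff.mpr fun n _ => by simp [Complex.exp_ne_zero]

lemma dTrail_ne_zero (ξ : Fin N → ℂ) : dTrail ξ ≠ 0 :=
  Finset.prod_ne_zero_iff.mpr fun n _ => by simp [Complex.exp_ne_zero]

lemma dPoly_coeff_top (ξ : Fin N → ℂ) : (dPoly ξ).coeff N = dLead ξ := by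
  have := coeff_prod_of_natDegree_le Finset.univ (fun n => sinhPoly (ξ n)) 1
    fun n _ => (natDegree_sinhPoly (ξ n)).le
  simpa [dPoly, dLead, sinhPoly_coeff_one] using this

lemma dPoly_coeff_zero (ξ : Fin N → ℂ) : (dPoly ξ).coeff 0 = dTrail ξ := by
  simp [dPoly, dTrail, coeff_zero_prod, sinhPoly_coeff_zero]

lemma dFun_self (ξ : Fin N → ℂ) (n : Fin N) : dFun ξ (ξ n) = 0 :=
  Finset.prod_eq_zero (Finset.mem_univ n) (by simp)

lemma aFun_self_sub (η : ℂ) (ξ : Fin N → ℂ) (n : Fin N) : aFun η ξ (ξ n - η) = 0 := by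
  rw [aFun_eq_dFun, sub_add_cancel, dFun_self]

/-- The operator `f ↦ t f - e^α a f(· - η) - e^{-α} d f(· + η)` in terms of polynomials, where
`t(u) = e^{-Nu} P(e^{2u})` and `f(u) = e^{-μu} q(e^{2u})`. -/
noncomputable def baxter (η α : ℂ) (ξ : Fin N → ℂ) (μ : ℂ) (P : ℂ[X]) : ℂ[X] →ₗ[ℂ] ℂ[X] where
  toFun q := P * q
    - C (exp (α + (μ - N) * η)) *
      ((dPoly ξ).comp (C (exp (2 * η)) * X) * q.comp (C (exp (-(2 * η))) * X))
    - C (exp (-α - μ * η)) * (dPoly ξ * q.comp (C (exp (2 * η)) * X))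
  map_add' p q := by simp only [add_comp]; ring
  map_smul' c p := by simp only [smul_eq_C_mul, mul_comp, C_comp, RingHom.id_apply]; ring

lemma baxter_apply (η α : ℂ) (ξ : Fin N → ℂ) (μ : ℂ) (P q : ℂ[X]) :
    baxter η α ξ μ P q = P * q
    - C (exp (α + (μ - N) * η)) *
      ((dPoly ξ).comp (C (exp (2 * η)) * X) * q.comp (C (exp (-(2 * η))) * X))
    - C (exp (-α - μ * η)) * (dPoly ξ * q.comp (C (exp (2 * η)) * X)) := rfl

lemma trig_baxter (η α : ℂ) (ξ : Fin N → ℂ) (M : ℕ) (P q : ℂ[X]) (u : ℂ) :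
    trig (N + M) (baxter η α ξ M P q) u = trig N P u * trig M q u
      - exp α * aFun η ξ u * trig M q (u - η) - exp (-α) * dFun ξ u * trig M q (u + η) := by
  have e1 : exp (α + ((M : ℂ) - N) * η) = exp α * exp (-(N * η)) * exp (-(M * -η)) := by
    rw [← Complex.exp_add, ← Complex.exp_add]; ring_nf
  have e2 : exp (-α - (M : ℂ) * η) = exp (-α) * exp (-(M * η)) := by
    rw [← Complex.exp_add]; ring_nf
  rw [baxter_apply, trig_sub, trig_sub, trig_C_mul, trig_C_mul, ← trig_mul, ← trig_mul,
    ← trig_mul, sub_eq_add_neg u η, trig_shift M q u, trig_shift M q u, aFun_eq_trig, trig_dPoly,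
    e1, e2, mul_neg]
  ring_nf

/-- A factor `X ^ k` of `q` shifts the exponent `μ` by `2 k`. -/
lemma baxter_X_pow_mul (η α : ℂ) (ξ : Fin N → ℂ) (μ : ℂ) (P q : ℂ[X]) (k : ℕ) :
    baxter η α ξ μ P (X ^ k * q) = X ^ k * baxter η α ξ (μ - 2 * k) P q := by
  have e1 : exp (α + (μ - 2 * k - N) * η) = exp (α + (μ - N) * η) * exp (-(2 * η)) ^ k := by
    rw [← Complex.exp_nat_mul, ← Complex.exp_add]; ring_nf
  have e2 : exp (-α - (μ - 2 * k) * η) = exp (-α - μ * η) * exp (2 * η) ^ k := by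
    rw [← Complex.exp_nat_mul, ← Complex.exp_add]; ring_nf
  simp only [baxter_apply, mul_comp, pow_comp, X_comp, e1, e2, C_mul, C_pow, mul_pow]
  ring

lemma natDegree_comp_C_mul_X_le (q : ℂ[X]) (c : ℂ) :
    (q.comp (C c * X)).natDegree ≤ q.natDegree := by
  refine natDegree_comp_le.trans ?_
  calc q.natDegree * (C c * X).natDegree ≤ q.natDegree * 1 :=
        Nat.mul_le_mul_left _ ((natDegree_C_mul_le c X).trans natDegree_X_le)
    _ = q.natDegree := mul_one _

lemma natDegree_baxter_le (η α : ℂ) (ξ : Fin N → ℂ) (μ : ℂ) {P q : ℂ[X]} {k : ℕ}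
    (hP : P.natDegree ≤ N) (hq : q.natDegree ≤ k) :
    (baxter η α ξ μ P q).natDegree ≤ N + k := by
  have hd := natDegree_dPoly ξ
  rw [baxter_apply]
  refine (natDegree_sub_le_of_le (natDegree_sub_le_of_le (natDegree_mul_le_of_le hP hq)
    ((natDegree_C_mul_le _ _).trans (natDegree_mul_le_of_le
      ((natDegree_comp_C_mul_X_le _ _).trans hd.le)
      ((natDegree_comp_C_mul_X_le _ _).trans hq))))
    ((natDegree_C_mul_le _ _).trans (natDegree_mul_le_of_le hd.le
      ((natDegree_comp_C_mul_X_le _ _).trans hq)))).trans ?_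
  simp

lemma baxter_coeff_top (η α : ℂ) (ξ : Fin N → ℂ) (μ : ℂ) {P q : ℂ[X]} {k : ℕ}
    (hP : P.natDegree ≤ N) (hq : q.natDegree ≤ k) :
    (baxter η α ξ μ P q).coeff (N + k) =
      (P.coeff N - dLead ξ * (exp (α + (N + μ - 2 * k) * η) + exp (-α - (μ - 2 * k) * η)))
        * q.coeff k := by
  have hd := (natDegree_dPoly ξ).le
  have h1 : ∀ c, (q.comp (C c * X)).natDegree ≤ k := fun c =>
    (natDegree_comp_C_mul_X_le _ _).trans hq
  rw [baxter_apply, coeff_sub, coeff_sub, coeff_C_mul, coeff_C_mul,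
    coeff_mul_add_eq_of_natDegree_le hP hq,
    coeff_mul_add_eq_of_natDegree_le ((natDegree_comp_C_mul_X_le _ _).trans hd) (h1 _),
    coeff_mul_add_eq_of_natDegree_le hd (h1 _), comp_C_mul_X_coeff, comp_C_mul_X_coeff,
    comp_C_mul_X_coeff, dPoly_coeff_top]
  have e1 : exp (α + (N + μ - 2 * k) * η) =
      exp (α + (μ - N) * η) * exp (2 * η) ^ N * exp (-(2 * η)) ^ k := by
    rw [← Complex.exp_nat_mul, ← Complex.exp_nat_mul, ← Complex.exp_add, ← Complex.exp_add]
    ring_nf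
  have e2 : exp (-α - (μ - 2 * k) * η) = exp (-α - μ * η) * exp (2 * η) ^ k := by
    rw [← Complex.exp_nat_mul, ← Complex.exp_add]; ring_nf
  rw [e1, e2]; ring

lemma baxter_coeff_zero (η α : ℂ) (ξ : Fin N → ℂ) (μ : ℂ) (P q : ℂ[X]) :
    (baxter η α ξ μ P q).coeff 0 =
      (P.coeff 0 - dTrail ξ * (exp (α + (μ - N) * η) + exp (-α - μ * η))) * q.coeff 0 := by
  rw [baxter_apply, coeff_sub, coeff_sub, coeff_C_mul, coeff_C_mul, mul_coeff_zero,
    mul_coeff_zero, mul_coeff_zero, comp_C_mul_X_coeff, comp_C_mul_X_coeff, comp_C_mul_X_coeff,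
    dPoly_coeff_zero]
  ring

/-! ### Inhomogeneities -/

lemma Inhomogeneous.sinh_sub_ne_zero {η : ℂ} {ξ : Fin N → ℂ} (h : Inhomogeneous η ξ)
    {a b : Fin N} (hab : a ≠ b) : sinh (ξ a - ξ b) ≠ 0 := fun h0 => by
  obtain ⟨m, hm⟩ := (sinh_eq_zero_iff_int _).mp h0
  exact h a b hab 0 (by simp) m (by push_cast; linear_combination hm)

lemma Inhomogeneous.sinh_sub_add_ne_zero {η : ℂ} {ξ : Fin N → ℂ} (h : Inhomogeneous η ξ)
    {a b : Fin N} (hab : a ≠ b) : sinh (ξ a - ξ b + η) ≠ 0 := fun h0 => by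
  obtain ⟨m, hm⟩ := (sinh_eq_zero_iff_int _).mp h0
  exact h a b hab (-1) (by simp) m (by push_cast; linear_combination hm)

lemma Inhomogeneous.sinh_sub_sub_ne_zero {η : ℂ} {ξ : Fin N → ℂ} (h : Inhomogeneous η ξ)
    {a b : Fin N} (hab : a ≠ b) : sinh (ξ a - ξ b - η) ≠ 0 := fun h0 => by
  obtain ⟨m, hm⟩ := (sinh_eq_zero_iff_int _).mp h0
  exact h a b hab 1 (by simp) m (by push_cast; linear_combination hm)

lemma aFun_self_ne_zero {η : ℂ} {ξ : Fin N → ℂ} (h : Inhomogeneous η ξ) (hs : sinh η ≠ 0)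
    (n : Fin N) : aFun η ξ (ξ n) ≠ 0 := by
  refine Finset.prod_ne_zero_iff.mpr fun b _ => ?_
  rcases eq_or_ne n b with rfl | hb
  · simpa using hs
  · exact h.sinh_sub_add_ne_zero hb

lemma dFun_self_sub_ne_zero {η : ℂ} {ξ : Fin N → ℂ} (h : Inhomogeneous η ξ) (hs : sinh η ≠ 0)
    (n : Fin N) : dFun ξ (ξ n - η) ≠ 0 := by
  refine Finset.prod_ne_zero_iff.mpr fun b _ => ?_
  rcases eq_or_ne n b with rfl | hb
  · simpa using hs
  · rw [sub_right_comm]; exact h.sinh_sub_sub_ne_zero hb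

/-- The `2N` points `ξ_n` and `ξ_n - η`. -/
def node (η : ℂ) (ξ : Fin N → ℂ) : Fin N ⊕ Fin N → ℂ := Sum.elim ξ fun n => ξ n - η

lemma node_injective {η : ℂ} {ξ : Fin N → ℂ} (h : Inhomogeneous η ξ) (hs : sinh η ≠ 0) :
    Function.Injective fun i => exp (2 * node η ξ i) := by
  have key : ∀ i j, i ≠ j → sinh (node η ξ i - node η ξ j) ≠ 0 := by
    rintro (a | a) (b | b) hab <;> simp only [node, Sum.elim_inl, Sum.elim_inr]
    · exact h.sinh_sub_ne_zero fun e => hab (by rw [e])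
    · rcases eq_or_ne a b with rfl | hb
      · simpa using hs
      · rw [show ξ a - (ξ b - η) = ξ a - ξ b + η by ring]
        exact h.sinh_sub_add_ne_zero hb
    · rcases eq_or_ne a b with rfl | hb
      · simpa using hs
      · rw [show ξ a - η - ξ b = ξ a - ξ b - η by ring]
        exact h.sinh_sub_sub_ne_zero hb
    · rw [sub_sub_sub_cancel_right]
      exact h.sinh_sub_ne_zero fun e => hab (by rw [e])
  intro i j hij
  by_contra hne
  exact key i j hne ((sinh_sub_eq_zero_iff _ _).mpr hij)

lemma exp_node_injective {η : ℂ} {ξ : Fin N → ℂ} (h : Inhomogeneous η ξ) :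
    Function.Injective fun n => exp (2 * ξ n) := by
  intro a b hab
  by_contra hne
  exact h.sinh_sub_ne_zero hne ((sinh_sub_eq_zero_iff _ _).mpr hab)

/-! ### Spectral polynomials and the solutions of the Baxter equation -/

/-- `P` is the polynomial of a function `t` in `Σ^{(N-2M)}`: the two extreme coefficients have
the values that they have for the transfer matrix on the sector with `M` down spins, and
`t(ξ_n) t(ξ_n - η) = a(ξ_n) d(ξ_n - η)`. -/
structure IsSpectral (η α : ℂ) (ξ : Fin N → ℂ) (M : ℕ) (P : ℂ[X]) : Prop where
  natDegree_le : P.natDegree ≤ N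
  coeff_top : P.coeff N = dLead ξ * (exp (α + (N - M) * η) + exp (-α + M * η))
  coeff_zero : P.coeff 0 = dTrail ξ * (exp (α - (N - M) * η) + exp (-α - M * η))
  fusion : ∀ n, trig N P (ξ n) * trig N P (ξ n - η) = aFun η ξ (ξ n) * dFun ξ (ξ n - η)

/-- Spin reversal. -/
lemma IsSpectral.dual {η α : ℂ} {ξ : Fin N → ℂ} {M : ℕ} {P : ℂ[X]} (hM : M ≤ N)
    (h : IsSpectral η α ξ M P) : IsSpectral η (-α) ξ (N - M) P := by
  refine ⟨h.natDegree_le, ?_, ?_, h.fusion⟩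
  · rw [h.coeff_top, Nat.cast_sub hM]; ring_nf
  · rw [h.coeff_zero, Nat.cast_sub hM]; ring_nf

section

variable {η α : ℂ} {ξ : Fin N → ℂ} {M : ℕ} {P : ℂ[X]}

lemma IsSpectral.baxter_coeff_zero (h : IsSpectral η α ξ M P) (q : ℂ[X]) :
    (baxter η α ξ M P q).coeff 0 = 0 := by
  rw [XXZ.baxter_coeff_zero, h.coeff_zero]; ring_nf

lemma IsSpectral.baxter_coeff_top (h : IsSpectral η α ξ M P) {q : ℂ[X]} (hq : q.natDegree ≤ M) :
    (baxter η α ξ M P q).coeff (N + M) = 0 := by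
  rw [XXZ.baxter_coeff_top _ _ _ _ h.natDegree_le hq, h.coeff_top]; ring_nf

/-- The value of `L f` at `ξ_n`, where `L` is the Baxter operator. -/
lemma trig_baxter_self (q : ℂ[X]) (n : Fin N) :
    trig (N + M) (baxter η α ξ M P q) (ξ n) =
      trig N P (ξ n) * trig M q (ξ n) - exp α * aFun η ξ (ξ n) * trig M q (ξ n - η) := by
  rw [trig_baxter, dFun_self]; ring

/-- By the fusion relation, the values of `L f` at `ξ_n` and at `ξ_n - η` are proportional. -/
lemma IsSpectral.trig_baxter_self_sub (h : IsSpectral η α ξ M P) (hξ : Inhomogeneous η ξ)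
    (hs : sinh η ≠ 0) (q : ℂ[X]) (n : Fin N)
    (hn : trig (N + M) (baxter η α ξ M P q) (ξ n) = 0) :
    trig (N + M) (baxter η α ξ M P q) (ξ n - η) = 0 := by
  have h1 : exp α * exp (-α) = 1 := by rw [← Complex.exp_add]; simp
  have h2 : exp α * aFun η ξ (ξ n) ≠ 0 :=
    mul_ne_zero (Complex.exp_ne_zero _) (aFun_self_ne_zero hξ hs n)
  rw [trig_baxter_self] at hn
  rw [trig_baxter, aFun_self_sub, sub_add_cancel]
  refine (mul_eq_zero.mp ?_).resolve_left h2
  linear_combination (-trig N P (ξ n - η)) * hn + trig M q (ξ n) * h.fusion n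
    - aFun η ξ (ξ n) * dFun ξ (ξ n - η) * trig M q (ξ n) * h1

/-- The `N` equations at the points `ξ_n` imply the Baxter equation: by fusion the left-hand side
has `2N` roots, and its constant coefficient vanishes, while its degree is at most `2N`. -/
lemma IsSpectral.baxter_eq_zero (h : IsSpectral η α ξ M P) (hξ : Inhomogeneous η ξ)
    (hs : sinh η ≠ 0) (hN : 1 ≤ N) {q : ℂ[X]} (hq : q.natDegree ≤ N)
    (hn : ∀ n, trig (N + M) (baxter η α ξ M P q) (ξ n) = 0) : baxter η α ξ M P q = 0 := by
  refine eq_zero_of_trig_roots_of_coeff_zero (e := N + M)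
    (natDegree_baxter_le _ _ _ _ h.natDegree_le hq) (h.baxter_coeff_zero q) Finset.univ
    (node η ξ) (node_injective hξ hs).injOn ?_ (by simp) (by omega)
  rintro (n | n) _
  · exact hn n
  · exact h.trig_baxter_self_sub hξ hs q n (hn n)

lemma exp_two_mul_int_ne_one (hη : ∀ j : ℕ, 1 ≤ j → j ≤ N → exp (2 * j * η) ≠ 1) {j : ℕ}
    {k : ℕ} (hj : j ≤ N) (hk : k ≤ N) (h : exp ((2 * j : ℂ) * η) = exp ((2 * k : ℂ) * η)) :
    j = k := by
  wlog hjk : j ≤ k generalizing j k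
  · exact (this hk hj h.symm (by omega)).symm
  by_contra hne
  refine hη (k - j) (by omega) (by omega) ?_
  rw [Nat.cast_sub hjk, show 2 * ((k : ℂ) - j) * η = 2 * k * η - 2 * j * η by ring,
    Complex.exp_sub, h, div_self (Complex.exp_ne_zero _)]

/-- The leading coefficient of the Baxter equation determines the degree of a solution. -/
lemma IsSpectral.natDegree_eq (h : IsSpectral η α ξ M P)
    (hη : ∀ j : ℕ, 1 ≤ j → j ≤ N → exp (2 * j * η) ≠ 1)
    (hα : ∀ j : ℕ, j ≤ N → exp (2 * α) ≠ exp (((N : ℂ) - 2 * j) * η)) (hM : M ≤ N)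
    {q : ℂ[X]} (hq : q.natDegree ≤ N) (hq0 : q ≠ 0) (hb : baxter η α ξ M P q = 0) :
    q.natDegree = M := by
  set i := q.natDegree
  have h1 := XXZ.baxter_coeff_top η α ξ M h.natDegree_le (le_refl i)
  rw [hb, Polynomial.coeff_zero, h.coeff_top, ← mul_sub, eq_comm, mul_eq_zero, mul_eq_zero] at h1
  have h2 := (h1.resolve_right (leadingCoeff_ne_zero.mpr hq0)).resolve_left (dLead_ne_zero ξ)
  have e1 : exp (α + ((N : ℂ) - M) * η) =
      exp (2 * α) * exp ((2 * i) * η) * exp (-α + (N - M - 2 * i) * η) := by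
    rw [← Complex.exp_add, ← Complex.exp_add]; ring_nf
  have e2 : exp (-α + (M : ℂ) * η) =
      exp (2 * M * η) * exp ((2 * i - N) * η) * exp (-α + (N - M - 2 * i) * η) := by
    rw [← Complex.exp_add, ← Complex.exp_add]; ring_nf
  have e3 : exp (α + ((N : ℂ) + M - 2 * i) * η) =
      exp (2 * α) * exp (2 * M * η) * exp (-α + (N - M - 2 * i) * η) := by
    rw [← Complex.exp_add, ← Complex.exp_add]; ring_nf
  have e4 : exp (-α - ((M : ℂ) - 2 * i) * η) =
      exp (2 * i * η) * exp ((2 * i - N) * η) * exp (-α + (N - M - 2 * i) * η) := by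
    rw [← Complex.exp_add, ← Complex.exp_add]; ring_nf
  rw [e1, e2, e3, e4] at h2
  -- the condition on the leading coefficients factorizes
  have h3 : (exp (2 * i * η) - exp (2 * M * η)) * (exp (2 * α) - exp ((2 * i - N) * η)) = 0 := by
    refine (mul_eq_zero.mp ?_).resolve_right (Complex.exp_ne_zero (-α + (N - M - 2 * i) * η))
    linear_combination h2
  rcases mul_eq_zero.mp h3 with h4 | h4
  · exact exp_two_mul_int_ne_one hη hq hM (sub_eq_zero.mp h4)
  · refine absurd (sub_eq_zero.mp h4) ?_
    have := hα (N - i) (by omega)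
    rw [Nat.cast_sub hq] at this
    convert this using 3; ring

/-- The lowest coefficient of the Baxter equation shows that a solution does not vanish at `0`. -/
lemma IsSpectral.coeff_zero_ne_zero (h : IsSpectral η α ξ M P)
    (hη : ∀ j : ℕ, 1 ≤ j → j ≤ N → exp (2 * j * η) ≠ 1)
    (hα : ∀ j : ℕ, j ≤ N → exp (2 * α) ≠ exp (((N : ℂ) - 2 * j) * η)) (hM : M ≤ N)
    {q : ℂ[X]} (hq : q.natDegree ≤ M) (hq0 : q ≠ 0) (hb : baxter η α ξ M P q = 0) :
    q.coeff 0 ≠ 0 := by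
  obtain ⟨r, hr⟩ := X_pow_dvd_iff.mpr (fun d hd => coeff_eq_zero_of_lt_natTrailingDegree hd :
    ∀ d < q.natTrailingDegree, q.coeff d = 0)
  set i := q.natTrailingDegree with hi
  have hiM : i ≤ M := (natTrailingDegree_le_natDegree q).trans hq
  have hr0 : r.coeff 0 ≠ 0 := by
    have h0 : q.coeff i ≠ 0 := trailingCoeff_nonzero_iff_nonzero.mpr hq0
    rw [hr] at h0
    simpa using (coeff_X_pow_mul r i 0 ▸ (by simpa using h0) : r.coeff 0 ≠ 0)
  rw [hr, baxter_X_pow_mul, mul_eq_zero, or_iff_right (pow_ne_zero _ X_ne_zero)] at hb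
  have h1 := XXZ.baxter_coeff_zero η α ξ ((M : ℂ) - 2 * i) P r
  rw [hb, Polynomial.coeff_zero, h.coeff_zero, ← mul_sub, eq_comm, mul_eq_zero, mul_eq_zero] at h1
  have h2 := (h1.resolve_right hr0).resolve_left (dTrail_ne_zero ξ)
  have e1 : exp (α - ((N : ℂ) - M) * η) =
      exp (2 * α) * exp ((2 * i) * η) * exp (-α + (M - N - 2 * i) * η) := by
    rw [← Complex.exp_add, ← Complex.exp_add]; ring_nf
  have e2 : exp (-α - (M : ℂ) * η) =
      exp ((N - 2 * M + 2 * i) * η) * exp (-α + (M - N - 2 * i) * η) := by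
    rw [← Complex.exp_add]; ring_nf
  have e3 : exp (α + ((M : ℂ) - 2 * i - N) * η) =
      exp (2 * α) * exp (-α + (M - N - 2 * i) * η) := by
    rw [← Complex.exp_add]; ring_nf
  have e4 : exp (-α - ((M : ℂ) - 2 * i) * η) =
      exp (2 * i * η) * exp ((N - 2 * M + 2 * i) * η) * exp (-α + (M - N - 2 * i) * η) := by
    rw [← Complex.exp_add, ← Complex.exp_add]; ring_nf
  rw [e1, e2, e3, e4] at h2
  -- the condition on the lowest coefficients factorizes
  have h3 : (exp (2 * i * η) - 1) * (exp (2 * α) - exp ((N - 2 * M + 2 * i) * η)) = 0 := by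
    refine (mul_eq_zero.mp ?_).resolve_right (Complex.exp_ne_zero (-α + (M - N - 2 * i) * η))
    linear_combination h2
  rcases mul_eq_zero.mp h3 with h4 | h4
  · have hi0 : i = 0 := exp_two_mul_int_ne_one hη (hiM.trans hM) (Nat.zero_le N)
      (by simpa using sub_eq_zero.mp h4)
    rw [hr, hi0]; simpa using hr0
  · refine absurd (sub_eq_zero.mp h4) ?_
    have := hα (M - i) (by omega)
    rw [Nat.cast_sub hiM] at this
    convert this using 3; ring

/-- The `N` equations at the points `ξ_n` have a nonzero solution among the polynomials of degree
at most `N`, and by `IsSpectral.baxter_eq_zero` it solves the Baxter equation. -/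
lemma IsSpectral.exists_baxter_eq_zero (h : IsSpectral η α ξ M P) (hξ : Inhomogeneous η ξ)
    (hN : 1 ≤ N) (hs : sinh η ≠ 0)
    (hη : ∀ j : ℕ, 1 ≤ j → j ≤ N → exp (2 * j * η) ≠ 1)
    (hα : ∀ j : ℕ, j ≤ N → exp (2 * α) ≠ exp (((N : ℂ) - 2 * j) * η)) (hM : M ≤ N) :
    ∃ q : ℂ[X], q.Monic ∧ q.natDegree = M ∧ q.coeff 0 ≠ 0 ∧ baxter η α ξ M P q = 0 := by
  let F : ℂ[X] →ₗ[ℂ] (Fin N → ℂ) :=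
    { toFun := fun q n => trig (N + M) (baxter η α ξ M P q) (ξ n)
      map_add' := fun p q => by ext n; simp [trig_add]
      map_smul' := fun c p => by
        ext n
        rw [map_smul, smul_eq_C_mul, trig_C_mul]; rfl }
  have hker : LinearMap.ker (F.domRestrict (degreeLT ℂ (N + 1))) ≠ ⊥ := by
    have : Module.Finite ℂ (degreeLT ℂ (N + 1)) :=
      Module.Finite.equiv (degreeLTEquiv ℂ (N + 1)).symm
    refine LinearMap.ker_ne_bot_of_finrank_lt ?_
    rw [(degreeLTEquiv ℂ (N + 1)).finrank_eq]
    simp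
  obtain ⟨⟨q, hqd⟩, hqk, hq0⟩ := (Submodule.ne_bot_iff _).mp hker
  have hq0' : q ≠ 0 := fun e => hq0 (by simp [e])
  have hdeg : q.natDegree ≤ N := by
    have := mem_degreeLT.mp hqd
    have := natDegree_lt_iff_degree_lt hq0' |>.mpr this
    omega
  have hb := h.baxter_eq_zero hξ hs hN hdeg fun n => congrFun (LinearMap.mem_ker.mp hqk) n
  have hdM := h.natDegree_eq hη hα hM hdeg hq0' hb
  have hl := leadingCoeff_ne_zero.mpr hq0'
  refine ⟨C q.leadingCoeff⁻¹ * q, ?_, ?_, ?_, ?_⟩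
  · rw [Monic, leadingCoeff_mul, leadingCoeff_C, inv_mul_cancel₀ hl]
  · rw [natDegree_C_mul (inv_ne_zero hl), hdM]
  · rw [coeff_C_mul]
    exact mul_ne_zero (inv_ne_zero hl) (h.coeff_zero_ne_zero hη hα hM hdM.le hq0' hb)
  · rw [← smul_eq_C_mul, map_smul, hb, smul_zero]

/-- Two solutions of degree at most `M` are proportional, since the degree of a nonzero solution
is exactly `M`. -/
lemma IsSpectral.C_mul_eq_C_mul (h : IsSpectral η α ξ M P)
    (hη : ∀ j : ℕ, 1 ≤ j → j ≤ N → exp (2 * j * η) ≠ 1)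
    (hα : ∀ j : ℕ, j ≤ N → exp (2 * α) ≠ exp (((N : ℂ) - 2 * j) * η)) (hM : M ≤ N)
    {p q : ℂ[X]} (hp : p.natDegree ≤ M) (hq : q.natDegree ≤ M)
    (hbp : baxter η α ξ M P p = 0) (hbq : baxter η α ξ M P q = 0) :
    C (q.coeff M) * p = C (p.coeff M) * q := by
  rw [← sub_eq_zero]
  by_contra hne
  have hdeg : (C (q.coeff M) * p - C (p.coeff M) * q).natDegree ≤ M :=
    natDegree_sub_le_of_le ((natDegree_C_mul_le _ _).trans hp)
      ((natDegree_C_mul_le _ _).trans hq) |>.trans (by simp)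
  have hb : baxter η α ξ M P (C (q.coeff M) * p - C (p.coeff M) * q) = 0 := by
    rw [map_sub, ← smul_eq_C_mul, ← smul_eq_C_mul, map_smul, map_smul, hbp, hbq]; simp
  have hM' := h.natDegree_eq hη hα hM (hdeg.trans hM) hne hb
  refine leadingCoeff_ne_zero.mpr hne ?_
  rw [leadingCoeff, hM', coeff_sub, coeff_C_mul, coeff_C_mul, mul_comm, sub_self]

end

end

/-! ### The set `Σ` in terms of spectral polynomials -/

section

/-- The polynomial `(e^{-c}/2)(X + e^{2c})` of `cosh (u - c)`. -/
noncomputable def coshPoly (c : ℂ) : ℂ[X] := C (exp (-c) / 2) * (X + C (exp (2 * c)))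

lemma trig_coshPoly (c u : ℂ) : trig 1 (coshPoly c) u = cosh (u - c) := by
  simp only [trig, coshPoly, eval_mul, eval_add, eval_C, eval_X, Complex.cosh]
  have h1 : exp (u - c) = exp (-(1 * u)) * exp (-c) * exp (2 * u) := by
    rw [← Complex.exp_add, ← Complex.exp_add]; ring_nf
  have h2 : exp (-(u - c)) = exp (-(1 * u)) * exp (-c) * exp (2 * c) := by
    rw [← Complex.exp_add, ← Complex.exp_add]; ring_nf
  rw [h1, h2]; push_cast; ring

lemma natDegree_coshPoly_le (c : ℂ) : (coshPoly c).natDegree ≤ 1 :=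
  (natDegree_C_mul_le _ _).trans (natDegree_X_add_C _).le

lemma coshPoly_coeff_one (c : ℂ) : (coshPoly c).coeff 1 = exp (-c) / 2 := by
  simp [coshPoly]

lemma coshPoly_coeff_zero (c : ℂ) : (coshPoly c).coeff 0 = exp c / 2 := by
  have : exp (-c) * exp (2 * c) = exp c := by rw [← Complex.exp_add]; ring_nf
  simp only [coshPoly, coeff_C_mul, coeff_add, coeff_X_zero, coeff_C_zero, ← this]; ring

variable {N : ℕ}

/-- The polynomial of `∏_{b ≠ n} sinh (u - ξ_b)`. -/
noncomputable def dErasePoly (ξ : Fin N → ℂ) (n : Fin N) : ℂ[X] :=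
  ∏ b ∈ Finset.univ.erase n, sinhPoly (ξ b)

lemma card_erase_univ (n : Fin N) : (Finset.univ.erase n).card = N - 1 := by
  simp [Finset.card_erase_of_mem]

lemma trig_dErasePoly (ξ : Fin N → ℂ) (n : Fin N) (u : ℂ) :
    trig (N - 1) (dErasePoly ξ n) u = ∏ b ∈ Finset.univ.erase n, sinh (u - ξ b) := by
  rw [← card_erase_univ n, dErasePoly, trig_prod]
  simp only [trig_sinhPoly]

lemma natDegree_dErasePoly_le (ξ : Fin N → ℂ) (n : Fin N) :
    (dErasePoly ξ n).natDegree ≤ N - 1 := by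
  refine (natDegree_prod_le _ _).trans ?_
  simp [natDegree_sinhPoly]

lemma dErasePoly_coeff_top (ξ : Fin N → ℂ) (n : Fin N) :
    exp (-ξ n) / 2 * (dErasePoly ξ n).coeff (N - 1) = dLead ξ := by
  have := coeff_prod_of_natDegree_le (Finset.univ.erase n) (fun n => sinhPoly (ξ n)) 1
    fun n _ => (natDegree_sinhPoly (ξ n)).le
  rw [card_erase_univ, mul_one] at this
  simp only [dErasePoly, this, sinhPoly_coeff_one]
  exact Finset.mul_prod_erase _ (fun n => exp (-ξ n) / 2) (Finset.mem_univ n)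

lemma dErasePoly_coeff_zero (ξ : Fin N → ℂ) (n : Fin N) :
    exp (ξ n) / 2 * (dErasePoly ξ n).coeff 0 = -dTrail ξ := by
  simp only [dErasePoly, coeff_zero_prod, sinhPoly_coeff_zero]
  rw [dTrail, ← Finset.mul_prod_erase _ _ (Finset.mem_univ n)]; ring

lemma natDegree_cosh_mul_dErasePoly_le (ξ : Fin N → ℂ) (n : Fin N) (c : ℂ) :
    (coshPoly c * dErasePoly ξ n).natDegree ≤ N := by
  refine (natDegree_mul_le_of_le (natDegree_coshPoly_le c)
    (natDegree_dErasePoly_le ξ n)).trans ?_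
  have := n.pos; omega

lemma cosh_mul_dErasePoly_coeff_top (ξ : Fin N → ℂ) (n : Fin N) (c : ℂ) :
    (coshPoly (ξ n - c) * dErasePoly ξ n).coeff N = exp c * dLead ξ := by
  have hN : N = 1 + (N - 1) := by have := n.pos; omega
  have e : exp (-(ξ n - c)) = exp c * exp (-ξ n) := by rw [← Complex.exp_add]; ring_nf
  have h := coeff_mul_add_eq_of_natDegree_le (natDegree_coshPoly_le (ξ n - c))
    (natDegree_dErasePoly_le ξ n)
  rw [← hN] at h
  rw [h, coshPoly_coeff_one, e, ← dErasePoly_coeff_top ξ n]; ring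

lemma cosh_mul_dErasePoly_coeff_zero (ξ : Fin N → ℂ) (n : Fin N) (c : ℂ) :
    (coshPoly (ξ n - c) * dErasePoly ξ n).coeff 0 = -(exp (-c) * dTrail ξ) := by
  have e : exp (ξ n - c) = exp (-c) * exp (ξ n) := by rw [← Complex.exp_add]; ring_nf
  rw [mul_coeff_zero, coshPoly_coeff_zero, e, ← neg_eq_iff_eq_neg.mpr (dErasePoly_coeff_zero ξ n)]
  ring

/-- The polynomial of `interp`. -/
noncomputable def interpPoly (η α : ℂ) (ξ : Fin N → ℂ) (l : ℤ) (x : Fin N → ℂ) : ℂ[X] :=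
  C (2 * (cosh α * cosh (η * l / 2) / cosh (η * N / 2))) * dPoly ξ
    + ∑ n, C (x n / cosh (η * N / 2) / ∏ b ∈ Finset.univ.erase n, sinh (ξ n - ξ b)) *
      (coshPoly (ξ n - η * N / 2) * dErasePoly ξ n)

lemma trig_interpPoly (η α : ℂ) (ξ : Fin N → ℂ) (l : ℤ) (x : Fin N → ℂ) (u : ℂ) :
    trig N (interpPoly η α ξ l x) u = interp η α ξ l x u := by
  rw [interpPoly, interp, trig_add, trig_C_mul, trig_dPoly, trig_sum, dFun]
  congr 1
  refine Finset.sum_congr rfl fun n _ => ?_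
  have hN : N = 1 + (N - 1) := by have := n.pos; omega
  have h := trig_mul 1 (N - 1) (coshPoly (ξ n - η * N / 2)) (dErasePoly ξ n) u
  rw [← hN, trig_coshPoly, trig_dErasePoly] at h
  rw [trig_C_mul, ← h, gFun, Finset.prod_div_distrib,
    show u - (ξ n - η * N / 2) = η * N / 2 + u - ξ n by ring]
  ring

lemma natDegree_interpPoly_le (η α : ℂ) (ξ : Fin N → ℂ) (l : ℤ) (x : Fin N → ℂ) :
    (interpPoly η α ξ l x).natDegree ≤ N := by
  refine natDegree_add_le_of_degree_le ((natDegree_C_mul_le _ _).trans (natDegree_dPoly ξ).le) ?_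
  exact natDegree_sum_le_of_forall_le _ _ fun n _ => (natDegree_C_mul_le _ _).trans
    (natDegree_cosh_mul_dErasePoly_le ξ n _)

lemma interpPoly_coeff_top (η α : ℂ) (ξ : Fin N → ℂ) (l : ℤ) (x : Fin N → ℂ) :
    (interpPoly η α ξ l x).coeff N =
      dLead ξ * ((2 * cosh α * cosh (η * l / 2) + exp (η * N / 2) *
        ∑ n, x n / ∏ b ∈ Finset.univ.erase n, sinh (ξ n - ξ b)) / cosh (η * N / 2)) := by
  simp only [interpPoly, coeff_add, coeff_C_mul, finsetSum_coeff, dPoly_coeff_top,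
    cosh_mul_dErasePoly_coeff_top]
  rw [add_div, mul_add, Finset.mul_sum, Finset.sum_div, Finset.mul_sum]
  congr 1
  · ring
  · exact Finset.sum_congr rfl fun n _ => by ring

lemma interpPoly_coeff_zero (η α : ℂ) (ξ : Fin N → ℂ) (l : ℤ) (x : Fin N → ℂ) :
    (interpPoly η α ξ l x).coeff 0 =
      dTrail ξ * ((2 * cosh α * cosh (η * l / 2) - exp (-(η * N / 2)) *
        ∑ n, x n / ∏ b ∈ Finset.univ.erase n, sinh (ξ n - ξ b)) / cosh (η * N / 2)) := by
  simp only [interpPoly, coeff_add, coeff_C_mul, finsetSum_coeff, dPoly_coeff_zero,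
    cosh_mul_dErasePoly_coeff_zero]
  rw [sub_div, mul_sub, Finset.mul_sum, Finset.sum_div, Finset.mul_sum, sub_eq_add_neg,
    ← Finset.sum_neg_distrib]
  congr 1
  · ring
  · exact Finset.sum_congr rfl fun n _ => by ring

lemma interp_self {η α : ℂ} {ξ : Fin N → ℂ} (hξ : Inhomogeneous η ξ)
    (hc : cosh (η * N / 2) ≠ 0) (l : ℤ) (x : Fin N → ℂ) (n : Fin N) :
    interp η α ξ l x (ξ n) = x n := by
  have h0 : ∏ m, sinh (ξ n - ξ m) = 0 := Finset.prod_eq_zero (Finset.mem_univ n) (by simp)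
  rw [interp, h0, mul_zero, zero_add, Finset.sum_eq_single n]
  · rw [gFun, show η * N / 2 + ξ n - ξ n = η * N / 2 by ring, div_self hc, one_mul,
      Finset.prod_congr rfl fun b hb => div_self
        (hξ.sinh_sub_ne_zero (Finset.ne_of_mem_erase hb).symm)]
    simp
  · intro m _ hm
    rw [gFun, Finset.prod_eq_zero (Finset.mem_erase.mpr ⟨hm.symm, Finset.mem_univ n⟩) (by simp)]
    simp
  · simp

/-- The prescribed extreme coefficients in terms of the quantities of the sum rule. -/
lemma exp_half_identities (η α : ℂ) (N M : ℕ) :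
    exp (α + (N - M) * η) + exp (-α + M * η) =
        2 * exp (η * N / 2) * cosh (η / 2 * ((N : ℤ) - 2 * M : ℤ) + α) ∧
    exp (α - (N - M) * η) + exp (-α - M * η) =
        2 * exp (-(η * N / 2)) * cosh (η / 2 * ((N : ℤ) - 2 * M : ℤ) - α) ∧
    2 * cosh α * cosh (η * ((N : ℤ) - 2 * M : ℤ) / 2) =
      cosh (η / 2 * ((N : ℤ) - 2 * M : ℤ) + α) + cosh (η / 2 * ((N : ℤ) - 2 * M : ℤ) - α) := by
  push_cast
  refine ⟨?_, ?_, ?_⟩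
  · simp only [Complex.cosh]
    rw [mul_div_assoc', mul_add, add_div, mul_assoc, mul_assoc, ← Complex.exp_add,
      ← Complex.exp_add]
    ring_nf
  · simp only [Complex.cosh]
    rw [mul_div_assoc', mul_add, add_div, mul_assoc, mul_assoc, ← Complex.exp_add,
      ← Complex.exp_add]
    ring_nf
  · rw [Complex.cosh_add, Complex.cosh_sub]; ring_nf

lemma twist_det (α : ℂ) : (twist α).det = 1 := by
  rw [twist, det_fin_two_of, ← Complex.exp_add]; simp

/-- The values `x_n = t(ξ_n)` and the extreme coefficients determine each other: a trigonometric
polynomial with the values `x_n` is the interpolating one plus a multiple `c d`, and the two extreme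
coefficients are right for `c = 0` if and only if the sum rule holds. -/
theorem mem_SigmaSet_iff {η α : ℂ} {ξ : Fin N → ℂ} (hξ : Inhomogeneous η ξ)
    (hc : cosh (η * N / 2) ≠ 0) (M : ℕ) (t : ℂ → ℂ) :
    t ∈ SigmaSet η α ξ ((N : ℤ) - 2 * M) ↔
      ∃ P, IsSpectral η α ξ M P ∧ ∀ u, t u = trig N P u := by
  obtain ⟨e1, e2, e3⟩ := exp_half_identities η α N M
  have ec : 2 * cosh (η * N / 2) = exp (η * N / 2) + exp (-(η * N / 2)) := by
    rw [Complex.cosh]; ring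
  have ee : exp (η * N / 2) * exp (-(η * N / 2)) = 1 := by rw [← Complex.exp_add]; simp
  set l : ℤ := (N : ℤ) - 2 * M
  set A := cosh (η / 2 * l + α)
  set B := cosh (η / 2 * l - α)
  set E := exp (η * N / 2)
  set F := exp (-(η * N / 2))
  set K := cosh (η * N / 2)
  constructor
  · rintro ⟨x, hx, hsum, rfl⟩
    refine ⟨interpPoly η α ξ l x, ⟨natDegree_interpPoly_le _ _ _ _ _, ?_, ?_, ?_⟩,
      fun u => (trig_interpPoly _ _ _ _ _ _).symm⟩
    · rw [interpPoly_coeff_top, ← hsum, e1, e3]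
      congr 1
      rw [div_eq_iff hc]
      linear_combination -E * A * ec - (A + B) * ee
    · rw [interpPoly_coeff_zero, ← hsum, e2, e3]
      congr 1
      rw [div_eq_iff hc]
      linear_combination -F * B * ec - (A + B) * ee
    · intro n
      rw [trig_interpPoly, trig_interpPoly, interp_self hξ hc, hx n, twist_det, mul_one]
  · rintro ⟨P, hP, ht⟩
    set x : Fin N → ℂ := fun n => trig N P (ξ n)
    -- the difference with the interpolating function is a multiple of `d`
    set D := P - interpPoly η α ξ l x with hD
    have hDdeg : D.natDegree ≤ N :=
      (natDegree_sub_le_of_le hP.natDegree_le (natDegree_interpPoly_le _ _ _ _ _)).trans (by simp)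
    have hDroot : ∀ n, trig N D (ξ n) = 0 := fun n => by
      rw [hD, trig_sub, trig_interpPoly, interp_self hξ hc, sub_self]
    set c := D.coeff N / dLead ξ
    have hc' : D = C c * dPoly ξ := by
      rw [← sub_eq_zero]
      set R := D - C c * dPoly ξ with hR
      have hRdeg : R.natDegree ≤ N := (natDegree_sub_le_of_le hDdeg
        ((natDegree_C_mul_le _ _).trans (natDegree_dPoly ξ).le)).trans (by simp)
      have hRtop : R.coeff N = 0 := by
        rw [hR, coeff_sub, coeff_C_mul, dPoly_coeff_top, div_mul_cancel₀ _ (dLead_ne_zero ξ),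
          sub_self]
      by_contra hR0
      have hlt : R.natDegree < N := lt_of_le_of_ne hRdeg fun e => by
        rw [← e] at hRtop; exact leadingCoeff_ne_zero.mpr hR0 hRtop
      refine hR0 (eq_zero_of_trig_roots (e := N) le_rfl Finset.univ ξ
        (exp_node_injective hξ).injOn (fun n _ => ?_) (by simpa using hlt))
      rw [hR, trig_sub, trig_C_mul, trig_dPoly, dFun_self, hDroot]; simp
    have h1 := congrArg (fun p => p.coeff N) hc'
    have h2 := congrArg (fun p => p.coeff 0) hc'
    simp only [hD, coeff_sub, coeff_C_mul, interpPoly_coeff_top, interpPoly_coeff_zero,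
      hP.coeff_top, hP.coeff_zero, dPoly_coeff_top, dPoly_coeff_zero, e1, e2, e3] at h1 h2
    set S := ∑ n, x n / ∏ b ∈ Finset.univ.erase n, sinh (ξ n - ξ b)
    have h1' : 2 * E * A * K - (A + B + E * S) = c * K := by
      have := mul_left_cancel₀ (dLead_ne_zero ξ) ((by linear_combination h1 :
        dLead ξ * (2 * E * A - (A + B + E * S) / K) = dLead ξ * c))
      rw [← this, sub_mul, div_mul_cancel₀ _ hc]
    have h2' : 2 * F * B * K - (A + B - F * S) = c * K := by
      have := mul_left_cancel₀ (dTrail_ne_zero ξ) ((by linear_combination h2 :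
        dTrail ξ * (2 * F * B - (A + B - F * S) / K) = dTrail ξ * c))
      rw [← this, sub_mul, div_mul_cancel₀ _ hc]
    -- the difference of the two conditions is the sum rule, and then `c = 0`
    have hsum : E * A - F * B = S := by
      refine mul_left_cancel₀ (mul_ne_zero two_ne_zero hc) ?_
      linear_combination h1' - h2' - S * ec
    have hc0 : c = 0 := by
      refine (mul_eq_zero.mp ?_).resolve_right hc
      linear_combination -h1' + E * A * ec + (A + B) * ee + E * hsum
    rw [hc0, C_0, zero_mul, sub_eq_zero] at hc'
    have htx : t = interp η α ξ l x := by
      ext u; rw [ht, hc', trig_interpPoly]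
    refine ⟨x, fun n => ?_, hsum, htx⟩
    rw [twist_det, mul_one, ← hP.fusion n, ← htx, ht]

end

/-! ### From a `Q`-function to a spectral polynomial -/

section

variable {N : ℕ} {η α : ℂ} {ξ : Fin N → ℂ} {M : ℕ}

/-- Division of the spectral curve equation by `a(u + η)`. -/
lemma spectralCurve_iff {t Q : ℂ → ℂ} (ht : Continuous t) (hQ : Continuous Q) :
    SpectralCurve η α ξ t Q ↔ ∀ u, t u * Q u =
      exp α * aFun η ξ u * Q (u - η) + exp (-α) * dFun ξ u * Q (u + η) := by
  have h1 : exp α * exp (-α) = 1 := by rw [← Complex.exp_add]; simp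
  have key : ∀ u, alphaFun η α ξ (u + η) * Q (u + η - 2 * η)
      - betaFun η α ξ (u + η) * t (u + η - η) * Q (u + η - η) + qdet η α ξ (u + η) * Q (u + η)
      = -(exp α * aFun η ξ (u + η)) * (t u * Q u -
        (exp α * aFun η ξ u * Q (u - η) + exp (-α) * dFun ξ u * Q (u + η))) := by
    intro u
    simp only [alphaFun, betaFun, qdet, twist_det, add_sub_cancel_right]
    rw [show u + η - 2 * η = u - η by ring]
    linear_combination -(aFun η ξ (u + η) * dFun ξ u * Q (u + η)) * h1
  have hd : Continuous (dFun ξ) := by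
    have : dFun ξ = trig N (dPoly ξ) := by ext u; rw [trig_dPoly]
    rw [this]; exact continuous_trig _ _
  constructor
  · intro h u
    have hc : (fun v => t (v - 2 * η) * Q (v - 2 * η)) = fun v =>
        exp α * dFun ξ (v - η) * Q (v - 3 * η) + exp (-α) * dFun ξ (v - 2 * η) * Q (v - η) := by
      refine eq_of_mul_trig_eq (d := N) (dPoly_ne_zero ξ) (by fun_prop) (by fun_prop) fun v hv => ?_
      have h2 := key (v - 2 * η)
      rw [h (v - 2 * η + η), eq_comm, mul_eq_zero, aFun_eq_dFun, aFun_eq_dFun] at h2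
      have h3 := h2.resolve_left (neg_ne_zero.mpr (mul_ne_zero (Complex.exp_ne_zero _) (by
        rwa [trig_dPoly, show v = v - 2 * η + η + η by ring] at hv)))
      rw [show v - 2 * η + η = v - η by ring, show v - 2 * η - η = v - 3 * η by ring] at h3
      exact sub_eq_zero.mp h3
    have h4 := congrFun hc (u + 2 * η)
    simp only [add_sub_cancel_right] at h4
    rw [h4, aFun_eq_dFun, show u + 2 * η - η = u + η by ring,
      show u + 2 * η - 3 * η = u - η by ring]
  · intro h u
    have h2 := key (u - η)
    rw [h (u - η), sub_self, mul_zero, sub_add_cancel] at h2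
    exact h2

lemma exists_trig_of_sinh_mul {g : ℂ → ℂ} (hg : Continuous g) {c : ℂ} {d : ℕ} {R : ℂ[X]}
    (hR : R.natDegree ≤ d + 1) (h : ∀ u, sinh (u - c) * g u = trig (d + 1) R u) :
    ∃ R' : ℂ[X], R'.natDegree ≤ d ∧ g = trig d R' := by
  have h0 := h c
  rw [sub_self, Complex.sinh_zero, zero_mul, eq_comm, trig, mul_eq_zero,
    or_iff_right (Complex.exp_ne_zero _)] at h0
  obtain ⟨S, rfl⟩ := dvd_iff_isRoot.mpr h0
  have e : exp c * exp (-c) = 1 := by rw [← Complex.exp_add]; simp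
  have e' : (X - C (exp (2 * c))) * S = sinhPoly c * (C (2 * exp c) * S) := by
    have : C (exp (-c) / 2) * C (2 * exp c) = (1 : ℂ[X]) := by
      rw [← C_mul, show exp (-c) / 2 * (2 * exp c) = exp c * exp (-c) by ring, e, C_1]
    rw [sinhPoly]; linear_combination (-(X - C (exp (2 * c))) * S) * this
  refine ⟨C (2 * exp c) * S, ?_, ?_⟩
  · refine (natDegree_C_mul_le _ _).trans ?_
    rcases eq_or_ne S 0 with rfl | hS
    · simp
    · rw [natDegree_mul (X_sub_C_ne_zero _) hS, natDegree_X_sub_C] at hR; omega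
  · refine eq_of_mul_trig_eq (d := 1) (sinhPoly_ne_zero c) hg (continuous_trig _ _) fun u hu => ?_
    refine mul_left_cancel₀ hu ?_
    rw [trig_mul, ← e', add_comm 1 d, ← h u, trig_sinhPoly]

/-- An entire quotient of trigonometric polynomials is a trigonometric polynomial. -/
lemma exists_trig_of_prod_sinh_mul {d M : ℕ} (r : Fin M → ℂ) {g : ℂ → ℂ} (hg : Continuous g)
    {R : ℂ[X]} (hR : R.natDegree ≤ d + M)
    (h : ∀ u, (∏ i, sinh (u - r i)) * g u = trig (d + M) R u) :
    ∃ R' : ℂ[X], R'.natDegree ≤ d ∧ g = trig d R' := by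
  induction M generalizing R with
  | zero => exact ⟨R, hR, by ext u; simpa using h u⟩
  | succ M ih =>
    obtain ⟨R', hR', h'⟩ := exists_trig_of_sinh_mul (c := r 0) (d := d + M)
      (g := fun u => (∏ i : Fin M, sinh (u - r i.succ)) * g u)
      (by fun_prop) hR fun u => by
        rw [← mul_assoc, ← Fin.prod_univ_succ (fun i => sinh (u - r i)), h u]; rfl
    exact ih (fun i => r i.succ) hR' fun u => congrFun h' u

/-- The fusion relation is the product of the Baxter equations at `ξ_n` and `ξ_n - η`, where one of
the two terms on the right-hand side vanishes. -/
lemma isSpectral_of_baxter_eq_zero (hξ : Inhomogeneous η ξ) (hs : sinh η ≠ 0)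
    {P q : ℂ[X]} (hP : P.natDegree ≤ N) (hq : q.natDegree ≤ M) (hqM : q.coeff M ≠ 0)
    (hq0 : q.coeff 0 ≠ 0) (hqξ : ∀ n, trig M q (ξ n) ≠ 0) (hb : baxter η α ξ M P q = 0) :
    IsSpectral η α ξ M P := by
  have h1 := baxter_coeff_top η α ξ M hP hq
  have h2 := baxter_coeff_zero η α ξ M P q
  have e : exp α * exp (-α) = 1 := by rw [← Complex.exp_add]; simp
  rw [hb, coeff_zero, eq_comm, mul_eq_zero] at h1 h2
  refine ⟨hP, ?_, ?_, fun n => ?_⟩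
  · rw [sub_eq_zero.mp (h1.resolve_right hqM)]; ring_nf
  · rw [sub_eq_zero.mp (h2.resolve_right hq0)]; ring_nf
  · have h3 := trig_baxter η α ξ M P q (ξ n)
    have h4 := trig_baxter η α ξ M P q (ξ n - η)
    rw [hb, dFun_self, trig_zero] at h3
    rw [hb, aFun_self_sub, trig_zero, sub_add_cancel] at h4
    have hd := dFun_self_sub_ne_zero hξ hs n
    have h5 : trig M q (ξ n - η) ≠ 0 := fun h0 => by
      rw [h0] at h4
      have : exp (-α) * dFun ξ (ξ n - η) * trig M q (ξ n) = 0 := by linear_combination h4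
      exact mul_ne_zero (mul_ne_zero (Complex.exp_ne_zero _) hd) (hqξ n) this
    refine mul_right_cancel₀ (mul_ne_zero (hqξ n) h5) ?_
    linear_combination -(trig N P (ξ n - η) * trig M q (ξ n - η)) * h3
      - exp α * aFun η ξ (ξ n) * trig M q (ξ n - η) * h4
      + aFun η ξ (ξ n) * dFun ξ (ξ n - η) * trig M q (ξ n) * trig M q (ξ n - η) * e

/-- The polynomial data behind a solution of the spectral curve equation. -/
lemma IsQSolution.exists_isSpectral (hξ : Inhomogeneous η ξ) (hs : sinh η ≠ 0) {t Q : ℂ → ℂ}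
    (ht : Continuous t) (hQ : IsQSolution η α ξ t M Q) :
    ∃ (r : Fin M → ℂ) (P : ℂ[X]), (∀ u, Q u = trig M (dPoly r) u) ∧ (∀ u, t u = trig N P u) ∧
      (∀ n, Q (ξ n) ≠ 0) ∧ baxter η α ξ M P (dPoly r) = 0 ∧ IsSpectral η α ξ M P := by
  obtain ⟨⟨r, hr, hQr⟩, hcurve⟩ := hQ
  have hQt : ∀ u, Q u = trig M (dPoly r) u := fun u => by rw [hQr, trig_dPoly, dFun]
  have hQt' : Q = trig M (dPoly r) := funext hQt
  have hQξ : ∀ n, Q (ξ n) ≠ 0 := fun n => by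
    rw [hQr]
    refine Finset.prod_ne_zero_iff.mpr fun i _ h0 => ?_
    obtain ⟨m, hm⟩ := (sinh_eq_zero_iff_int _).mp h0
    exact hr i n (-m) (by push_cast; linear_combination -hm)
  have hTQ := (spectralCurve_iff ht (hQt' ▸ continuous_trig _ _)).mp hcurve
  have hdeg := (natDegree_dPoly r).le
  obtain ⟨P, hP, htP⟩ := exists_trig_of_prod_sinh_mul (d := N) r ht
    (R := -baxter η α ξ M 0 (dPoly r))
    (by rw [natDegree_neg]; exact natDegree_baxter_le _ _ _ _ (by simp) hdeg) fun u => by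
      have := trig_baxter η α ξ M 0 (dPoly r) u
      rw [← zero_sub, trig_sub, this, ← hQr, mul_comm, hTQ]
      rw [trig_zero, trig_zero, ← hQt, ← hQt, ← hQt]; ring
  have hb : baxter η α ξ M P (dPoly r) = 0 := by
    refine trig_injective (d := N + M) fun u => ?_
    rw [trig_baxter, ← hQt, ← hQt, ← hQt, ← htP, hTQ, trig_zero]; ring
  refine ⟨r, P, hQt, congrFun htP, hQξ, hb, ?_⟩
  exact isSpectral_of_baxter_eq_zero hξ hs hP hdeg
    (by rw [dPoly_coeff_top]; exact dLead_ne_zero r)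
    (by rw [dPoly_coeff_zero]; exact dTrail_ne_zero r) (fun n => hQt (ξ n) ▸ hQξ n) hb

/-- The extreme coefficients of a spectral polynomial determine the number of down spins. -/
lemma IsSpectral.sector_unique {P : ℂ[X]} {M M' : ℕ} (h : IsSpectral η α ξ M P)
    (h' : IsSpectral η α ξ M' P) (hK : exp (2 * α) ≠ 1)
    (hη : ∀ j : ℕ, 1 ≤ j → j ≤ N → exp (2 * j * η) ≠ 1) (hM : M ≤ N) (hM' : M' ≤ N) :
    M = M' := by
  have h1 := mul_left_cancel₀ (dLead_ne_zero ξ) (h.coeff_top.symm.trans h'.coeff_top)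
  have h2 := mul_left_cancel₀ (dTrail_ne_zero ξ) (h.coeff_zero.symm.trans h'.coeff_zero)
  have f : ∀ x y : ℂ, exp (x + y) = exp x * exp y := Complex.exp_add
  set Y := exp (M * η) with hY
  set Y' := exp (M' * η) with hY'
  set E := exp (N * η) with hE
  set a := exp α with ha
  have hY0 : Y ≠ 0 := Complex.exp_ne_zero _
  have hY0' : Y' ≠ 0 := Complex.exp_ne_zero _
  have hE0 : E ≠ 0 := Complex.exp_ne_zero _
  have ha0 : a ≠ 0 := Complex.exp_ne_zero _
  have g1 : ∀ m : ℕ, exp (α + (N - m) * η) = a * E / exp (m * η) := fun m => by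
    rw [← Complex.exp_add, ← Complex.exp_sub]; ring_nf
  have g2 : ∀ m : ℕ, exp (-α + m * η) = exp (m * η) / a := fun m => by
    rw [← Complex.exp_sub]; ring_nf
  have g3 : ∀ m : ℕ, exp (α - (N - m) * η) = a * exp (m * η) / E := fun m => by
    rw [← Complex.exp_add, ← Complex.exp_sub]; ring_nf
  have g4 : ∀ m : ℕ, exp (-α - m * η) = 1 / (a * exp (m * η)) := fun m => by
    rw [← Complex.exp_add, one_div, ← Complex.exp_neg]; ring_nf
  rw [g1, g1, g2, g2, ← hY, ← hY'] at h1
  rw [g3, g3, g4, g4, ← hY, ← hY'] at h2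
  field_simp at h1 h2
  have sq : ∀ m : ℕ, exp (2 * m * η) = exp (m * η) ^ 2 := fun m => by
    rw [← Complex.exp_nat_mul]; push_cast; ring_nf
  -- if `Y ≠ Y'`, the two equations give `a ^ 2 * E = Y * Y'` and `a ^ 2 * (Y * Y') = E`
  by_cases hYY : Y = Y'
  · refine exp_two_mul_int_ne_one hη hM hM' ?_
    rw [sq, sq, ← hY, ← hY', hYY]
  · have h3 : a ^ 2 * E = Y * Y' := by
      refine mul_left_cancel₀ (sub_ne_zero.mpr hYY) ?_
      linear_combination -h1
    have h4 : a ^ 2 * (Y * Y') = E := by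
      refine mul_left_cancel₀ (sub_ne_zero.mpr hYY) ?_
      linear_combination h2
    have h5 : (Y * Y') ^ 2 = E ^ 2 := by
      linear_combination E * h4 - (Y * Y') * h3
    have h6 : M = N - M' := by
      refine exp_two_mul_int_ne_one hη hM (Nat.sub_le _ _) ?_
      rw [sq, sq, ← hY]
      refine mul_right_cancel₀ (pow_ne_zero 2 hY0') ?_
      rw [← mul_pow, h5, ← mul_pow, hY', hE, ← Complex.exp_add, Nat.cast_sub hM']
      ring_nf
    have h7 : Y * Y' = E := by
      rw [hY, hY', hE, ← Complex.exp_add, h6, Nat.cast_sub hM']; ring_nf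
    refine absurd ?_ hK
    rw [h7] at h3
    rw [two_mul, Complex.exp_add, ← ha]
    refine mul_right_cancel₀ hE0 ?_
    linear_combination h3

/-- `Q`-functions for the same `t` agree up to a sign. -/
lemma IsQSolution.eq_or_eq_neg (hξ : Inhomogeneous η ξ) (hs : sinh η ≠ 0)
    (hK : exp (2 * α) ≠ 1) (hη : ∀ j : ℕ, 1 ≤ j → j ≤ N → exp (2 * j * η) ≠ 1)
    (hα : ∀ j : ℕ, j ≤ N → exp (2 * α) ≠ exp (((N : ℂ) - 2 * j) * η)) {t Q Q' : ℂ → ℂ}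
    (ht : Continuous t) {M' : ℕ} (hM : M ≤ N) (hM' : M' ≤ N) (hQ : IsQSolution η α ξ t M Q)
    (hQ' : IsQSolution η α ξ t M' Q') : Q' = Q ∨ Q' = -Q := by
  obtain ⟨r, P, hr, htP, -, hb, hP⟩ := hQ.exists_isSpectral hξ hs ht
  obtain ⟨r', P', hr', htP', -, hb', hP'⟩ := hQ'.exists_isSpectral hξ hs ht
  obtain rfl : P = P' := trig_injective (d := N) fun u => by rw [← htP, htP']
  obtain rfl := hP.sector_unique hP' hK hη hM hM'
  have h1 := hP.C_mul_eq_C_mul hη hα hM (natDegree_dPoly r').le (natDegree_dPoly r).le hb' hb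
  rw [dPoly_coeff_top, dPoly_coeff_top] at h1
  have h2 := congrArg (fun p => p.coeff 0) h1
  simp only [coeff_C_mul, dPoly_coeff_zero] at h2
  -- the product of the two extreme coefficients does not depend on the roots
  have h3 : ∀ r : Fin M → ℂ, dLead r * dTrail r = (-1 / 4) ^ M := fun r => by
    rw [dLead, dTrail, ← Finset.prod_mul_distrib, Finset.prod_congr rfl
      (g := fun _ => (-1 / 4 : ℂ)) fun n _ => ?_]
    · simp [div_pow]
    · have : exp (-r n) * exp (r n) = 1 := by rw [← Complex.exp_add]; simp
      linear_combination (-1 / 4 : ℂ) * this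
  have h4 : dLead r' ^ 2 = dLead r ^ 2 := by
    refine mul_right_cancel₀ (dTrail_ne_zero r) ?_
    linear_combination -dLead r' * h2 + dLead r * ((h3 r').trans (h3 r).symm)
  have h5 : ∀ u, dLead r * Q' u = dLead r' * Q u := fun u => by
    rw [hr, hr', ← trig_C_mul, ← trig_C_mul, h1]
  rcases sq_eq_sq_iff_eq_or_eq_neg.mp h4 with h6 | h6
  · left; ext u
    exact mul_left_cancel₀ (dLead_ne_zero r) (by rw [h5, h6])
  · right; ext u
    exact mul_left_cancel₀ (dLead_ne_zero r) (by rw [h5, h6, Pi.neg_apply]; ring)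

lemma exists_eq_prod_X_sub_C {q : ℂ[X]} {k : ℕ} (hq : q.Monic) (hk : q.natDegree = k) :
    ∃ z : Fin k → ℂ, q = ∏ i, (X - C (z i)) := by
  obtain ⟨l, hl⟩ : ∃ l : List ℂ, (l : Multiset ℂ) = q.roots := ⟨q.roots.toList, by simp⟩
  have hcard : l.length = k := by
    rw [← hk, ← (splits_iff_card_roots.mp (IsAlgClosed.splits q)), ← hl]; rfl
  subst hcard
  refine ⟨l.get, ?_⟩
  have h := (IsAlgClosed.splits q).eq_prod_roots_of_monic hq
  rw [← hl, Multiset.map_coe, Multiset.prod_coe] at h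
  rw [h, ← List.prod_ofFn]
  congr 1
  apply List.ext_get <;> simp

/-- A solution of the Baxter equation that does not vanish at `0` and at the points `e^{2ξ_n}` is,
up to a factor, a product of hyperbolic sines. -/
lemma exists_isQSolution_of_baxter {t : ℂ → ℂ} {P q : ℂ[X]} (ht : ∀ u, t u = trig N P u)
    (hq : q.Monic) (hqM : q.natDegree = M) (hq0 : q.coeff 0 ≠ 0)
    (hqξ : ∀ n, q.eval (exp (2 * ξ n)) ≠ 0) (hb : baxter η α ξ M P q = 0) :
    ∃ Q, IsQSolution η α ξ t M Q := by
  obtain ⟨z, hprod⟩ := exists_eq_prod_X_sub_C hq hqM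
  have hroot : ∀ i, q.eval (z i) = 0 := fun i => by
    rw [hprod, eval_prod]; exact Finset.prod_eq_zero (Finset.mem_univ i) (by simp)
  have hne : ∀ i, z i ≠ 0 := fun i h0 => hq0 (by
    have := hroot i; rwa [h0, ← coeff_zero_eq_eval_zero] at this)
  set r : Fin M → ℂ := fun i => log (z i) / 2
  have hr : ∀ i, exp (2 * r i) = z i := fun i => by
    rw [mul_div_cancel₀ _ two_ne_zero, Complex.exp_log (hne i)]
  have hd : dPoly r = C (dLead r) * q := by
    rw [hprod, dPoly, dLead, map_prod, ← Finset.prod_mul_distrib]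
    exact Finset.prod_congr rfl fun i _ => by rw [sinhPoly, hr]
  have hb' : baxter η α ξ M P (dPoly r) = 0 := by
    rw [hd, ← smul_eq_C_mul, map_smul, hb, smul_zero]
  refine ⟨trig M (dPoly r), ⟨r, fun i m k h0 => ?_, fun u => by rw [trig_dPoly, dFun]⟩, ?_⟩
  · refine hqξ m ?_
    have : exp (2 * ξ m) = exp (2 * r i) := by
      rw [← sinh_sub_eq_zero_iff, sinh_eq_zero_iff_int]
      exact ⟨-k, by rw [h0]; push_cast; ring⟩
    rw [this, hr, hroot]
  · refine (spectralCurve_iff (by rw [funext ht]; exact continuous_trig _ _)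
      (continuous_trig _ _)).mpr fun u => ?_
    have := trig_baxter η α ξ M P (dPoly r) u
    rw [hb', trig_zero] at this
    rw [ht]; linear_combination -this

end

/-! ### Singular solutions are excluded for generic inhomogeneities -/

section

variable {N : ℕ}

/-- The polynomial of the quantum Wronskian
`e^α p(u) q(u - η) - e^{-α} p(u - η) q(u)`, over an arbitrary algebra of coefficients. The numbers
`A`, `B` stand for `e^{α + Mη}`, `e^{-α + (N - M)η}` and `w` for `e^{-2η}`. -/
noncomputable def wronskian {R : Type*} [CommRing R] (A B w : R) (p q : R[X]) : R[X] :=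
  C A * (p * q.comp (C w * X)) - C B * (p.comp (C w * X) * q)

lemma map_wronskian {R S : Type*} [CommRing R] [CommRing S] (f : R →+* S) (A B w : R)
    (p q : R[X]) : (wronskian A B w p q).map f =
      wronskian (f A) (f B) (f w) (p.map f) (q.map f) := by
  simp [wronskian, Polynomial.map_comp]

/-- The Wronskian of a solution of the Baxter equation and a solution of the equation with
reversed spins is proportional to `d`. -/
lemma wronskian_eq {η α : ℂ} {ξ : Fin N → ℂ} {M : ℕ} {P p q : ℂ[X]} (hM : M ≤ N)
    (hξ : Inhomogeneous η ξ) (hs : sinh η ≠ 0)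
    (hq : q.Monic) (hqM : q.natDegree = M) (hbq : baxter η α ξ M P q = 0)
    (hp : p.Monic) (hpM : p.natDegree = N - M)
    (hbp : baxter η (-α) ξ (N - M : ℕ) P p = 0) :
    wronskian (exp (α + M * η)) (exp (-α + (N - M : ℕ) * η)) (exp (-(2 * η))) p q =
      C (exp (α - M * η) - exp (-α - (N - M : ℕ) * η)) * ∏ n, (X - C (exp (2 * ξ n))) := by
  have hNM : N - M + M = N := Nat.sub_add_cancel hM
  have ht : ∀ u, trig N (wronskian (exp (α + M * η)) (exp (-α + (N - M : ℕ) * η))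
      (exp (-(2 * η))) p q) u = exp α * trig (N - M) p u * trig M q (u - η)
        - exp (-α) * trig (N - M) p (u - η) * trig M q u := by
    intro u
    have e1 : exp (α + M * η) = exp α * exp (-(M * -η)) := by
      rw [← Complex.exp_add]; ring_nf
    have e2 : exp (-α + (N - M : ℕ) * η) = exp (-α) * exp (-((N - M : ℕ) * -η)) := by
      rw [← Complex.exp_add]; ring_nf
    have h1 := trig_mul (N - M) M p (q.comp (C (exp (-(2 * η))) * X)) u
    have h2 := trig_mul (N - M) M (p.comp (C (exp (-(2 * η))) * X)) q u
    rw [hNM] at h1 h2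
    rw [wronskian, trig_sub, trig_C_mul, trig_C_mul, ← h1, ← h2, sub_eq_add_neg u η, trig_shift,
      trig_shift, e1, e2, mul_neg]
    ring_nf
  -- the two Baxter equations at `ξ_n` express both shifted values through the same factor
  have hroot : ∀ n, trig N (wronskian (exp (α + M * η)) (exp (-α + (N - M : ℕ) * η))
      (exp (-(2 * η))) p q) (ξ n) = 0 := by
    intro n
    have h1 := trig_baxter_self (η := η) (α := α) (ξ := ξ) (M := M) (P := P) q n
    have h2 := trig_baxter_self (η := η) (α := -α) (ξ := ξ) (M := N - M) (P := P) p n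
    rw [hbq, trig_zero] at h1
    rw [hbp, trig_zero] at h2
    rw [ht]
    refine (mul_eq_zero.mp ?_).resolve_left (aFun_self_ne_zero hξ hs n)
    linear_combination trig (N - M) p (ξ n) * h1 - trig M q (ξ n) * h2
  have hc : ∀ (f : ℂ[X]) (c : ℂ), (f.comp (C c * X)).natDegree ≤ f.natDegree :=
    natDegree_comp_C_mul_X_le
  set K := exp (α - M * η) - exp (-α - (N - M : ℕ) * η)
  have hprod : (∏ n, (X - C (exp (2 * ξ n)))).natDegree = N := by
    rw [natDegree_prod_of_monic _ _ fun n _ => monic_X_sub_C _]; simp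
  have hmon : (∏ n, (X - C (exp (2 * ξ n)))).coeff N = 1 := by
    have := monic_prod_of_monic Finset.univ (fun n => X - C (exp (2 * ξ n)))
      fun n _ => monic_X_sub_C _
    rwa [Monic, leadingCoeff, hprod] at this
  set W := wronskian (exp (α + M * η)) (exp (-α + (N - M : ℕ) * η)) (exp (-(2 * η))) p q with hW
  have hWdeg : W.natDegree ≤ N := by
    refine (natDegree_sub_le_of_le
      ((natDegree_C_mul_le _ _).trans (natDegree_mul_le_of_le hpM.le ((hc _ _).trans hqM.le)))
      ((natDegree_C_mul_le _ _).trans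
        (natDegree_mul_le_of_le ((hc _ _).trans hpM.le) hqM.le))).trans ?_
    simp [hNM]
  have hWtop : W.coeff N = K := by
    have h1 := coeff_mul_add_eq_of_natDegree_le hpM.le
      ((hc q (exp (-(2 * η)))).trans hqM.le)
    have h2 := coeff_mul_add_eq_of_natDegree_le ((hc p (exp (-(2 * η)))).trans hpM.le) hqM.le
    have hp1 : p.coeff (N - M) = 1 := by rw [← hpM]; exact hp
    have hq1 : q.coeff M = 1 := by rw [← hqM]; exact hq
    rw [hNM, comp_C_mul_X_coeff, hp1, hq1, one_mul, ← Complex.exp_nat_mul] at h1 h2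
    rw [hW, wronskian, coeff_sub, coeff_C_mul, coeff_C_mul, h1, h2, one_mul, mul_one,
      ← Complex.exp_add, ← Complex.exp_add]
    congr 2 <;> ring
  rw [← sub_eq_zero]
  set D := W - C K * ∏ n, (X - C (exp (2 * ξ n))) with hD
  have hDdeg : D.natDegree ≤ N := (natDegree_sub_le_of_le hWdeg
    ((natDegree_C_mul_le _ _).trans hprod.le)).trans (by simp)
  have hDtop : D.coeff N = 0 := by
    rw [hD, coeff_sub, coeff_C_mul, hmon, hWtop, mul_one, sub_self]
  by_contra hD0
  have hlt : D.natDegree < N := lt_of_le_of_ne hDdeg fun e => by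
    rw [← e] at hDtop; exact leadingCoeff_ne_zero.mpr hD0 hDtop
  refine hD0 (eq_zero_of_trig_roots (e := N) le_rfl Finset.univ ξ
    (exp_node_injective hξ).injOn (fun n _ => ?_) (by simpa using hlt))
  have hz : trig N (∏ n, (X - C (exp (2 * ξ n)))) (ξ n) = 0 := by
    rw [trig, eval_prod, Finset.prod_eq_zero (Finset.mem_univ n) (by simp), mul_zero]
  rw [hD, trig_sub, trig_C_mul, hroot, hz]; simp

/-- The parameters of a singular solution with `M` roots: the roots of the dual solution, the
`M - 2` roots outside of the pair `z, e^{-2η} z`, and `z` itself. -/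
abbrev SingIndex (N M : ℕ) : Type := (Fin (N - M) ⊕ Fin (M - 2)) ⊕ Unit

/-- A polynomial `(X - z)(X - w z) ∏ (X - z_j)` whose coefficients depend on parameters. -/
noncomputable def singPoly {R : Type*} [CommRing R] {M : ℕ} (w z : R) (y : Fin (M - 2) → R) :
    R[X] :=
  (X - C z) * (X - C (w * z)) * ∏ j, (X - C (y j))

lemma exists_algebraic_relation {A : Type*} [CommRing A] [Algebra ℂ A] {n : ℕ}
    (f : Fin n → A) (h : ¬AlgebraicIndependent ℂ f) :
    ∃ R : MvPolynomial (Fin n) ℂ, R ≠ 0 ∧ MvPolynomial.aeval f R = 0 := by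
  rw [algebraicIndependent_iff] at h
  push Not at h
  obtain ⟨R, h1, h2⟩ := h
  exact ⟨R, h2, h1⟩

lemma eval_aeval_eq {τ A : Type*} [CommRing A] [Algebra ℂ A] (φ : A →ₐ[ℂ] ℂ)
    (g : τ → A) (q : MvPolynomial τ ℂ) :
    φ (MvPolynomial.aeval g q) = MvPolynomial.eval (fun n => φ (g n)) q := by
  induction q using MvPolynomial.induction_on with
  | C a => simp
  | add p q hp hq => simp [hp, hq]
  | mul_X p n hp => simp [hp]

/-- For `M` roots, the inhomogeneities with a singular solution lie on a hypersurface: by the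
Wronskian relation the elementary symmetric functions of the `N` numbers `-e^{2ξ_n}` are
polynomials in `N - 1` parameters, hence algebraically dependent. -/
lemma exists_polynomial_of_singular (η α : ℂ) {M : ℕ} (h2 : 2 ≤ M) (hM : M ≤ N)
    (hK : exp (α - M * η) - exp (-α - (N - M : ℕ) * η) ≠ 0) :
    ∃ R : MvPolynomial (Fin N) ℂ, R ≠ 0 ∧ ∀ (ξ : Fin N → ℂ) (z : ℂ) (y : Fin (M - 2) → ℂ)
      (x : Fin (N - M) → ℂ),
      wronskian (exp (α + M * η)) (exp (-α + (N - M : ℕ) * η)) (exp (-(2 * η)))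
        (∏ i, (X - C (x i))) (singPoly (exp (-(2 * η))) z y) =
      C (exp (α - M * η) - exp (-α - (N - M : ℕ) * η)) * ∏ n, (X - C (exp (2 * ξ n))) →
      MvPolynomial.eval (fun n => exp (ξ n)) R = 0 := by
  set K := exp (α - M * η) - exp (-α - (N - M : ℕ) * η)
  set A := exp (α + M * η)
  set B := exp (-α + (N - M : ℕ) * η)
  set w := exp (-(2 * η))
  let W : (MvPolynomial (SingIndex N M) ℂ)[X] := wronskian (MvPolynomial.C A) (MvPolynomial.C B)
    (MvPolynomial.C w) (∏ i, (X - C (MvPolynomial.X (Sum.inl (Sum.inl i)))))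
    (singPoly (MvPolynomial.C w) (MvPolynomial.X (Sum.inr ()))
      fun j => MvPolynomial.X (Sum.inl (Sum.inr j)))
  let f : Fin N → MvPolynomial (SingIndex N M) ℂ := fun i =>
    MvPolynomial.C K⁻¹ * W.coeff (N - (i + 1))
  -- there are `(N - M) + (M - 2) + 1 = N - 1` parameters
  have hf : ¬AlgebraicIndependent ℂ f := fun h => by
    have h1 := h.lift_cardinalMk_le_trdeg
    rw [MvPolynomial.trdeg_of_isDomain] at h1
    simp only [Cardinal.mk_fintype, Fintype.card_fin, Fintype.card_sum, Fintype.card_unit,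
      Cardinal.lift_natCast, Nat.cast_le] at h1
    omega
  obtain ⟨R, hR, hR0⟩ := exists_algebraic_relation f hf
  let e : Fin N → MvPolynomial (Fin N) ℂ := fun i => MvPolynomial.esymm (Fin N) ℂ (i + 1)
  have heR : MvPolynomial.aeval e R ≠ 0 := fun h0 => by
    have := MvPolynomial.esymmAlgHom_injective (σ := Fin N) (n := N) (R := ℂ) (by simp)
    refine hR (this (Subtype.ext ?_))
    rw [map_zero, MvPolynomial.esymmAlgHom_apply]
    exact h0
  -- `-(e^{ξ_n})^2 = -e^{2ξ_n}`
  refine ⟨MvPolynomial.aeval (fun n => -(MvPolynomial.X n) ^ 2) (MvPolynomial.aeval e R), ?_, ?_⟩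
  · obtain ⟨v, hv⟩ : ∃ v, MvPolynomial.eval v (MvPolynomial.aeval e R) ≠ 0 := by
      by_contra! h
      exact heR (MvPolynomial.funext fun v => by rw [h v, map_zero])
    have hsq : ∀ n, ∃ s : ℂ, -s ^ 2 = v n := fun n => by
      obtain ⟨s, hs⟩ := IsAlgClosed.exists_pow_nat_eq (-v n) two_pos
      exact ⟨s, by rw [hs, neg_neg]⟩
    choose s hs using hsq
    intro h0
    have := congrArg (MvPolynomial.eval s) h0
    rw [map_zero, ← MvPolynomial.coe_aeval_eq_eval, RingHom.coe_coe, eval_aeval_eq] at this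
    refine hv (Eq.trans ?_ this)
    simp [hs]
  · intro ξ z y x hw
    let φ : MvPolynomial (SingIndex N M) ℂ →ₐ[ℂ] ℂ :=
      MvPolynomial.aeval (Sum.elim (Sum.elim x y) fun _ => z)
    have hmap : W.map φ.toRingHom = C K * ∏ n, (X - C (exp (2 * ξ n))) := by
      rw [← hw, map_wronskian]
      simp [φ, singPoly, Polynomial.map_prod]
    have hφ : ∀ i, φ (f i) = MvPolynomial.eval (fun n => -exp (2 * ξ n)) (e i) := by
      intro i
      have h1 := congrArg (fun p => p.coeff (N - (i + 1))) hmap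
      simp only [coeff_map, coeff_C_mul] at h1
      have h3 := Finset.univ.prod_X_add_C_coeff (fun n => -exp (2 * ξ n))
        (k := N - (i + 1)) (by simp)
      simp only [map_neg, ← sub_eq_add_neg] at h3
      have h4 : (Finset.univ : Finset (Fin N)).card - (N - (i + 1)) = i + 1 := by
        rw [Finset.card_univ, Fintype.card_fin]; omega
      have h5 : φ (W.coeff (N - (i + 1))) = φ.toRingHom (W.coeff (N - (i + 1))) := rfl
      rw [h4] at h3
      rw [map_mul, h5, h1, h3, MvPolynomial.algHom_C, ← mul_assoc]
      simp [e, MvPolynomial.esymm, hK]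
    have h1 := congrArg φ hR0
    rw [map_zero, eval_aeval_eq, funext hφ] at h1
    rw [← MvPolynomial.coe_aeval_eq_eval, RingHom.coe_coe, eval_aeval_eq]
    have h6 : (fun n => MvPolynomial.aeval (fun n => exp (ξ n))
        (-(MvPolynomial.X n : MvPolynomial (Fin N) ℂ) ^ 2)) = fun n => -exp (2 * ξ n) := by
      ext n; simp [← Complex.exp_nat_mul]
    rw [h6, ← MvPolynomial.coe_aeval_eq_eval, RingHom.coe_coe, eval_aeval_eq]
    exact h1

/-- For generic inhomogeneities, the solutions of the Baxter equation do not vanish at any of the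
points `ξ_n`. -/
lemma exists_generic_polynomial (hN : 1 ≤ N) {η α : ℂ} (hs : sinh η ≠ 0)
    (hη : ∀ j : ℕ, 1 ≤ j → j ≤ N → exp (2 * j * η) ≠ 1)
    (hα : ∀ j : ℕ, j ≤ N → exp (2 * α) ≠ exp (((N : ℂ) - 2 * j) * η)) :
    ∃ R : MvPolynomial (Fin N) ℂ, R ≠ 0 ∧ ∀ ξ : Fin N → ℂ, Inhomogeneous η ξ →
      MvPolynomial.eval (fun n => exp (ξ n)) R ≠ 0 → ∀ M ≤ N, ∀ P q : ℂ[X],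
      IsSpectral η α ξ M P → q.Monic → q.natDegree = M → baxter η α ξ M P q = 0 →
      ∀ n, q.eval (exp (2 * ξ n)) ≠ 0 := by
  have hKM : ∀ M ≤ N, exp (α - M * η) - exp (-α - (N - M : ℕ) * η) ≠ 0 := by
    intro M hM h0
    refine hα (N - M) (Nat.sub_le _ _) ?_
    have e1 : exp (2 * α) = exp (α - M * η) * exp (α + M * η) := by
      rw [← Complex.exp_add]; ring_nf
    rw [e1, sub_eq_zero.mp h0, ← Complex.exp_add, Nat.cast_sub hM]; ring_nf
  have hα' : ∀ j : ℕ, j ≤ N → exp (2 * -α) ≠ exp (((N : ℂ) - 2 * j) * η) := by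
    intro j hj h0
    refine hα (N - j) (Nat.sub_le _ _) ?_
    rw [mul_neg, Complex.exp_neg, inv_eq_iff_eq_inv, ← Complex.exp_neg] at h0
    rw [h0, Nat.cast_sub hj]; ring_nf
  have hex : ∀ M, ∃ R : MvPolynomial (Fin N) ℂ, R ≠ 0 ∧ (M ≤ N → 2 ≤ M →
      ∀ (ξ : Fin N → ℂ) (z : ℂ) (y : Fin (M - 2) → ℂ) (x : Fin (N - M) → ℂ),
      wronskian (exp (α + M * η)) (exp (-α + (N - M : ℕ) * η)) (exp (-(2 * η)))
        (∏ i, (X - C (x i))) (singPoly (exp (-(2 * η))) z y) =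
      C (exp (α - M * η) - exp (-α - (N - M : ℕ) * η)) * ∏ n, (X - C (exp (2 * ξ n))) →
      MvPolynomial.eval (fun n => exp (ξ n)) R = 0) := by
    intro M
    by_cases h : M ≤ N ∧ 2 ≤ M
    · obtain ⟨R, h1, h2⟩ := exists_polynomial_of_singular η α h.2 h.1 (hKM M h.1)
      exact ⟨R, h1, fun _ _ => h2⟩
    · exact ⟨1, one_ne_zero, fun h1 h2 => absurd ⟨h1, h2⟩ h⟩
  choose R hR0 hR using hex
  refine ⟨∏ M ∈ Finset.range (N + 1), R M, Finset.prod_ne_zero_iff.mpr fun M _ => hR0 M, ?_⟩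
  intro ξ hξ hgen M hM P q hP hq hqM hb n h0
  rw [map_prod, Finset.prod_ne_zero_iff] at hgen
  -- the Baxter equation at `ξ_n` makes `q` vanish at the shifted point as well
  have h1 : q.eval (exp (-(2 * η)) * exp (2 * ξ n)) = 0 := by
    have h2 := trig_baxter_self (η := η) (α := α) (ξ := ξ) (M := M) (P := P) q n
    have h3 : trig M q (ξ n) = 0 := by rw [trig, h0, mul_zero]
    rw [hb, trig_zero, h3, mul_zero, zero_sub, eq_comm, neg_eq_zero, mul_eq_zero,
      or_iff_right (mul_ne_zero (Complex.exp_ne_zero _) (aFun_self_ne_zero hξ hs n)), trig,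
      mul_eq_zero, or_iff_right (Complex.exp_ne_zero _)] at h2
    rw [← h2, ← Complex.exp_add]; ring_nf
  have hne : exp (-(2 * η)) * exp (2 * ξ n) ≠ exp (2 * ξ n) := fun h => by
    rw [← Complex.exp_add, show -(2 * η) + 2 * ξ n = 2 * (ξ n - η) by ring,
      ← sinh_sub_eq_zero_iff] at h
    simp [hs] at h
  obtain ⟨r, rfl⟩ := dvd_iff_isRoot.mpr h0
  rw [eval_mul, mul_eq_zero, eval_sub, eval_X, eval_C, or_iff_right (sub_ne_zero.mpr hne)] at h1
  obtain ⟨s, rfl⟩ := dvd_iff_isRoot.mpr h1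
  have hs1 : s.Monic := by
    have := (monic_X_sub_C (exp (2 * ξ n))).of_mul_monic_left hq
    exact (monic_X_sub_C _).of_mul_monic_left this
  have hdeg : s.natDegree = M - 2 ∧ 2 ≤ M := by
    rw [(monic_X_sub_C _).natDegree_mul ((monic_X_sub_C _).mul hs1),
      (monic_X_sub_C _).natDegree_mul hs1, natDegree_X_sub_C, natDegree_X_sub_C] at hqM
    omega
  obtain ⟨y, rfl⟩ := exists_eq_prod_X_sub_C hs1 hdeg.1
  obtain ⟨p, hp, hpM, -, hbp⟩ :=
    (hP.dual hM).exists_baxter_eq_zero hξ hN hs hη hα' (Nat.sub_le _ _)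
  obtain ⟨x, rfl⟩ := exists_eq_prod_X_sub_C hp hpM
  -- the dual solution gives the parameters `x`, and the Wronskian relation applies
  refine hgen M (Finset.mem_range.mpr (by omega)) (hR M hM hdeg.2 ξ (exp (2 * ξ n)) y x ?_)
  rw [singPoly, mul_assoc]
  exact wronskian_eq hM hξ hs hq hqM hb hp hpM hbp

end

/-! ### Operators acting on one site -/

section

variable {N : ℕ}

/-- The operator that acts as the `2 × 2` matrix `X` on the `n`-th site. -/
def siteOp (n : Fin N) (X : Matrix (Fin 2) (Fin 2) ℂ) : Op N := fun s s' =>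
  if ∀ m, m ≠ n → s m = s' m then X (s n) (s' n) else 0

lemma agree_iff_update (n : Fin N) (s r : Conf N) (k : Fin 2) :
    r = Function.update s n k ↔ k = r n ∧ ∀ m, m ≠ n → s m = r m := by
  constructor
  · rintro rfl
    exact ⟨by simp, fun m hm => by simp [hm]⟩
  · rintro ⟨rfl, h⟩
    ext m
    rcases eq_or_ne m n with rfl | hm
    · simp
    · simp [hm, h m hm]

lemma siteOp_mul_apply (n : Fin N) (X : Matrix (Fin 2) (Fin 2) ℂ) (A : Op N) (s s' : Conf N) :
    (siteOp n X * A) s s' = ∑ k, X (s n) k * A (Function.update s n k) s' := by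
  have h1 : ∀ k, X (s n) k * A (Function.update s n k) s' =
      ∑ r, if r = Function.update s n k then X (s n) k * A r s' else 0 := fun k => by simp
  simp_rw [h1, Matrix.mul_apply]
  rw [Finset.sum_comm]
  refine Finset.sum_congr rfl fun r _ => ?_
  simp_rw [agree_iff_update, siteOp]
  rw [Finset.sum_eq_single (r n) (fun k _ hk => if_neg fun h => hk h.1) (by simp)]
  split_ifs with h1 h2 h2
  exacts [rfl, absurd ⟨rfl, h1⟩ h2, absurd h2.2 h1, zero_mul _]

lemma siteOp_mulVec_apply (n : Fin N) (X : Matrix (Fin 2) (Fin 2) ℂ) (v : Conf N → ℂ)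
    (s : Conf N) : (siteOp n X *ᵥ v) s = ∑ k, X (s n) k * v (Function.update s n k) := by
  have := siteOp_mul_apply n X (Matrix.of fun s _ => v s) s s
  simpa [Matrix.mul_apply, Matrix.mulVec, dotProduct] using this

lemma siteOp_mul (n : Fin N) (X Y : Matrix (Fin 2) (Fin 2) ℂ) :
    siteOp n X * siteOp n Y = siteOp n (X * Y) := by
  ext s s'
  rw [siteOp_mul_apply]
  have h : ∀ k, (∀ m, m ≠ n → Function.update s n k m = s' m) ↔ ∀ m, m ≠ n → s m = s' m :=
    fun k => forall₂_congr fun m hm => by rw [Function.update_of_ne hm]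
  simp only [siteOp, h, Function.update_self, Matrix.mul_apply]
  split_ifs <;> simp

/-- The embedding of the `2 × 2` matrices as the operators on the `n`-th site. -/
def siteHom (n : Fin N) : Matrix (Fin 2) (Fin 2) ℂ →ₐ[ℂ] Op N :=
  AlgHom.ofLinearMap
    { toFun := siteOp n
      map_add' := fun X Y => by ext s s'; simp only [siteOp, Matrix.add_apply]; split_ifs <;> simp
      map_smul' := fun c X => by
        ext s s'; simp only [siteOp, Matrix.smul_apply, RingHom.id_apply]; split_ifs <;> simp }
    (by
      ext s s'
      simp only [LinearMap.coe_mk, AddHom.coe_mk, siteOp, Matrix.one_apply]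
      by_cases h : s = s'
      · subst h; simp
      · have : ¬((∀ m, m ≠ n → s m = s' m) ∧ s n = s' n) := fun ⟨h1, h2⟩ => h (funext fun m => by
          rcases eq_or_ne m n with rfl | hm
          exacts [h2, h1 m hm])
        rw [if_neg h]
        split_ifs with h1 h2
        exacts [absurd ⟨h1, h2⟩ this, rfl, rfl])
    fun X Y => (siteOp_mul n X Y).symm

lemma siteHom_apply (n : Fin N) (X : Matrix (Fin 2) (Fin 2) ℂ) : siteHom n X = siteOp n X := rfl

lemma siteOp_mul_of_ne {n m : Fin N} (h : n ≠ m) (X Y : Matrix (Fin 2) (Fin 2) ℂ)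
    (s s' : Conf N) : (siteOp n X * siteOp m Y) s s' =
      if ∀ k, k ≠ n → k ≠ m → s k = s' k then X (s n) (s' n) * Y (s m) (s' m) else 0 := by
  rw [siteOp_mul_apply]
  have hk : ∀ k, (∀ j, j ≠ m → Function.update s n k j = s' j) ↔
      k = s' n ∧ ∀ k, k ≠ n → k ≠ m → s k = s' k := by
    intro k
    constructor
    · intro h1
      refine ⟨by simpa using h1 n h, fun j hj hjm => ?_⟩
      simpa [hj] using h1 j hjm
    · rintro ⟨rfl, h1⟩ j hj
      rcases eq_or_ne j n with rfl | hjn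
      · simp
      · simp [hjn, h1 j hjn hj]
  simp only [siteOp, hk, Function.update_of_ne h.symm]
  rw [Finset.sum_eq_single (s' n) (fun k _ hk => by rw [if_neg fun h => hk h.1, mul_zero])
    (by simp)]
  split_ifs with h1 h2 h2
  exacts [rfl, absurd h1.2 h2, absurd ⟨rfl, h2⟩ h1, mul_zero _]

lemma siteOp_commute {n m : Fin N} (h : n ≠ m) (X Y : Matrix (Fin 2) (Fin 2) ℂ) :
    Commute (siteOp n X) (siteOp m Y) := by
  ext s s'
  rw [siteOp_mul_of_ne h, siteOp_mul_of_ne h.symm, mul_comm]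
  have : (∀ k, k ≠ n → k ≠ m → s k = s' k) ↔ ∀ k, k ≠ m → k ≠ n → s k = s' k :=
    forall_congr' fun k => ⟨fun h a b => h b a, fun h a b => h b a⟩
  simp only [this]

/-! ### Monodromy matrices as block matrices -/

/-- The entries of the `R`-matrix with respect to the auxiliary space, as `2 × 2` matrices. -/
noncomputable def lax (η u : ℂ) : Matrix (Fin 2) (Fin 2) (Matrix (Fin 2) (Fin 2) ℂ) := fun i j =>
  Matrix.of fun a b => Rmat η u (i, a) (j, b)

lemma lax_zero_zero (η u : ℂ) : lax η u 0 0 = !![sinh (u + η), 0; 0, sinh u] := by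
  ext a b; fin_cases a <;> fin_cases b <;> simp [lax, Rmat]

lemma lax_zero_one (η u : ℂ) : lax η u 0 1 = !![0, 0; sinh η, 0] := by
  ext a b; fin_cases a <;> fin_cases b <;> simp [lax, Rmat]

lemma lax_one_zero (η u : ℂ) : lax η u 1 0 = !![0, sinh η; 0, 0] := by
  ext a b; fin_cases a <;> fin_cases b <;> simp [lax, Rmat]

lemma lax_one_one (η u : ℂ) : lax η u 1 1 = !![sinh u, 0; 0, sinh (u + η)] := by
  ext a b; fin_cases a <;> fin_cases b <;> simp [lax, Rmat]

/-- The Lax operator of the `n`-th site. -/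
noncomputable def siteLax (η u : ℂ) (n : Fin N) : Matrix (Fin 2) (Fin 2) (Op N) :=
  (lax η u).map (siteHom n)

/-- The product of the Lax operators of a list of sites. -/
noncomputable def monoList (η : ℂ) (ξ : Fin N → ℂ) (l : List (Fin N)) (u : ℂ) :
    Matrix (Fin 2) (Fin 2) (Op N) :=
  (l.map fun n => siteLax η (u - ξ n) n).prod

lemma monoList_cons (η : ℂ) (ξ : Fin N → ℂ) (n : Fin N) (l : List (Fin N)) (u : ℂ) :
    monoList η ξ (n :: l) u = siteLax η (u - ξ n) n * monoList η ξ l u := by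
  simp [monoList]

/-- The monodromy matrix without its twist: its entries are the operators `A`, `B`, `C`, `D`. -/
noncomputable def mono (η : ℂ) (ξ : Fin N → ℂ) (u : ℂ) : Matrix (Fin 2) (Fin 2) (Op N) :=
  monoList η ξ (List.finRange N).reverse u

/-- The transfer matrix is `e^α A(u) + e^{-α} D(u)`. -/
lemma transfer_eq (η α : ℂ) (ξ : Fin N → ℂ) (u : ℂ) :
    transfer η α ξ u = exp α • mono η ξ u 0 0 + exp (-α) • mono η ξ u 1 1 := by
  have h1 : (Matrix.compRingEquiv (Fin 2) (Conf N) ℂ).symm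
      ((List.ofFn fun n : Fin N => siteR η (u - ξ n) n).reverse.prod) = mono η ξ u := by
    rw [map_list_prod, mono, monoList, List.map_reverse, List.map_ofFn, List.map_reverse,
      List.ofFn_eq_map]
    rfl
  have h2 : ∀ i s j s', (List.ofFn fun n : Fin N => siteR η (u - ξ n) n).reverse.prod
      (i, s) (j, s') = mono η ξ u i j s s' := fun i s j s' => by rw [← h1]; rfl
  ext s s'
  rw [transfer, Fin.sum_univ_two, monodromy]
  simp only [Matrix.mul_apply, Fintype.sum_prod_type, auxTwist, ite_mul, zero_mul,
    Finset.sum_ite_eq, Finset.mem_univ, if_true, Fin.sum_univ_two, h2]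
  simp [twist]

lemma commute_monoList (η : ℂ) (ξ : Fin N → ℂ) {n : Fin N} {l : List (Fin N)} (hn : n ∉ l)
    (X : Matrix (Fin 2) (Fin 2) ℂ) (u : ℂ) (i j : Fin 2) :
    Commute (siteHom n X) (monoList η ξ l u i j) := by
  induction l generalizing i j with
  | nil =>
    simp only [monoList, List.map_nil, List.prod_nil, Matrix.one_apply]
    split_ifs
    exacts [Commute.one_right _, Commute.zero_right _]
  | cons m l ih =>
    rw [List.mem_cons, not_or] at hn
    rw [monoList_cons, Matrix.mul_apply]
    exact Commute.sum_right _ _ _ fun k _ => (siteOp_commute hn.1 _ _).mul_right (ih hn.2 _ _)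

/-- Two sums over intermediate auxiliary states, when the entries of `A` and `L'` commute. -/
lemma mul_apply_mul_mul_apply {R : Type*} [Ring R] {L A L' B : Matrix (Fin 2) (Fin 2) R}
    (h : ∀ i j k l, Commute (A i j) (L' k l)) (i j k l : Fin 2) :
    (L * A) i j * (L' * B) k l =
      ∑ m, ∑ p, (L i m * L' k p) * (A m j * B p l) := by
  rw [Matrix.mul_apply, Matrix.mul_apply, Finset.sum_mul_sum]
  refine Finset.sum_congr rfl fun m _ => Finset.sum_congr rfl fun p _ => ?_
  rw [mul_assoc, ← mul_assoc (A m j), (h m j k p).eq]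
  noncomm_ring

/-! ### Exchange relations -/

/-- `A ⊗ 1` on the tensor square of the auxiliary space. -/
def aux₁ {R : Type*} [Zero R] (A : Matrix (Fin 2) (Fin 2) R) :
    Matrix (Fin 2 × Fin 2) (Fin 2 × Fin 2) R := fun p q => if p.2 = q.2 then A p.1 q.1 else 0

/-- `1 ⊗ A` on the tensor square of the auxiliary space. -/
def aux₂ {R : Type*} [Zero R] (A : Matrix (Fin 2) (Fin 2) R) :
    Matrix (Fin 2 × Fin 2) (Fin 2 × Fin 2) R := fun p q => if p.1 = q.1 then A p.2 q.2 else 0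

lemma aux₁_mul {R : Type*} [Ring R] (A B : Matrix (Fin 2) (Fin 2) R) :
    aux₁ (A * B) = aux₁ A * aux₁ B := by
  ext ⟨a, b⟩ ⟨c, d⟩
  fin_cases b <;> fin_cases d <;>
    simp [aux₁, Matrix.mul_apply, Fintype.sum_prod_type, Fin.sum_univ_two]

lemma aux₂_mul {R : Type*} [Ring R] (A B : Matrix (Fin 2) (Fin 2) R) :
    aux₂ (A * B) = aux₂ A * aux₂ B := by
  ext ⟨a, b⟩ ⟨c, d⟩
  fin_cases a <;> fin_cases c <;>
    simp [aux₂, Matrix.mul_apply, Fintype.sum_prod_type, Fin.sum_univ_two]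

lemma aux₁_mul_aux₂_apply {R : Type*} [Ring R] (A B : Matrix (Fin 2) (Fin 2) R)
    (p q : Fin 2 × Fin 2) : (aux₁ A * aux₂ B) p q = A p.1 q.1 * B p.2 q.2 := by
  obtain ⟨a, b⟩ := p
  obtain ⟨c, d⟩ := q
  fin_cases b <;> fin_cases c <;>
    simp [aux₁, aux₂, Matrix.mul_apply, Fintype.sum_prod_type]

lemma aux₂_mul_aux₁_apply {R : Type*} [Ring R] (A B : Matrix (Fin 2) (Fin 2) R)
    (p q : Fin 2 × Fin 2) : (aux₂ B * aux₁ A) p q = B p.2 q.2 * A p.1 q.1 := by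
  obtain ⟨a, b⟩ := p
  obtain ⟨c, d⟩ := q
  fin_cases a <;> fin_cases d <;>
    simp [aux₁, aux₂, Matrix.mul_apply, Fintype.sum_prod_type]

/-- The relation `R(x) A₁ B₂ = B₂ A₁ R(x)`. -/
def RTT {R : Type*} [Ring R] [Algebra ℂ R] (η x : ℂ) (A B : Matrix (Fin 2) (Fin 2) R) : Prop :=
  (Rmat η x).map (algebraMap ℂ R) * (aux₁ A * aux₂ B) =
    (aux₂ B * aux₁ A) * (Rmat η x).map (algebraMap ℂ R)

/-- Comultiplication: the exchange relation passes to products of matrices whose entries commute. -/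
lemma RTT.mul {R : Type*} [Ring R] [Algebra ℂ R] {η x : ℂ} {L A L' B : Matrix (Fin 2) (Fin 2) R}
    (hL : RTT η x L L') (hA : RTT η x A B) (h : ∀ i j k l, Commute (A i j) (L' k l))
    (h' : ∀ i j k l, Commute (B i j) (L k l)) : RTT η x (L * A) (L' * B) := by
  unfold RTT at *
  have e1 : aux₁ A * aux₂ L' = aux₂ L' * aux₁ A := by
    ext p q; rw [aux₁_mul_aux₂_apply, aux₂_mul_aux₁_apply, (h _ _ _ _).eq]
  have e2 : aux₂ B * aux₁ L = aux₁ L * aux₂ B := by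
    ext p q; rw [aux₁_mul_aux₂_apply, aux₂_mul_aux₁_apply, (h' _ _ _ _).eq]
  rw [aux₁_mul, aux₂_mul]
  calc _ = ((Rmat η x).map (algebraMap ℂ R) * (aux₁ L * aux₂ L')) * (aux₁ A * aux₂ B) := by
        simp only [Matrix.mul_assoc]; rw [← Matrix.mul_assoc (aux₁ A), e1, Matrix.mul_assoc]
    _ = _ := by
        rw [hL, Matrix.mul_assoc, hA]
        simp only [Matrix.mul_assoc]
        rw [← Matrix.mul_assoc (aux₁ L), ← e2, Matrix.mul_assoc]

lemma RTT.map {R S : Type*} [Ring R] [Algebra ℂ R] [Ring S] [Algebra ℂ S] (f : R →ₐ[ℂ] S)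
    {η x : ℂ} {A B : Matrix (Fin 2) (Fin 2) R} (h : RTT η x A B) :
    RTT η x (A.map f) (B.map f) := by
  have h1 := congrArg (fun X => X.map f) h
  have e1 : aux₁ (A.map f) = (aux₁ A).map f := by
    ext p q; simp only [aux₁, Matrix.map_apply]; split_ifs <;> simp
  have e2 : aux₂ (B.map f) = (aux₂ B).map f := by
    ext p q; simp only [aux₂, Matrix.map_apply]; split_ifs <;> simp
  have e3 : (Rmat η x).map (algebraMap ℂ S) = ((Rmat η x).map (algebraMap ℂ R)).map f := by
    ext p q; simp
  simp only [Matrix.map_mul] at h1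
  rw [RTT, e1, e2, e3]; exact h1

/-- The addition theorem behind the Yang-Baxter relation. -/
lemma sinh_add_mul_sinh_add (x y z : ℂ) :
    sinh (x + z) * sinh (y + z) = sinh (x + y + z) * sinh z + sinh x * sinh y := by
  simp only [Complex.sinh_add, Complex.cosh_add]
  linear_combination (sinh x * sinh y) * Complex.cosh_sq z

lemma RTT_lax (η u v : ℂ) : RTT η (u - v) (lax η u) (lax η v) := by
  have h1 : sinh (u - v + η) * sinh u = sinh (u - v) * sinh (u + η) + sinh η * sinh v := by
    have := sinh_add_mul_sinh_add η v (u - v)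
    rw [show η + (u - v) = u - v + η by ring, show v + (u - v) = u by ring,
      show η + v + (u - v) = u + η by ring] at this
    linear_combination this
  have h3 : sinh u * sinh (v + η) = sinh (u + η) * sinh v + sinh (u - v) * sinh η := by
    have := sinh_add_mul_sinh_add (u - v) η v
    rw [show u - v + v = u by ring, show u - v + η + v = u + η by ring, add_comm η v] at this
    exact this
  have h2 : sinh (u - v + η) * sinh (v + η) =
      sinh η * sinh (u + η) + sinh (u - v) * sinh v := by
    have := sinh_add_mul_sinh_add (u - v) v η
    rw [show u - v + v = u by ring] at this
    linear_combination this
  unfold RTT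
  ext ⟨i, j⟩ ⟨k, l⟩ a b
  rw [Matrix.mul_apply, Matrix.mul_apply]
  simp only [aux₁_mul_aux₂_apply, aux₂_mul_aux₁_apply, Fintype.sum_prod_type, Fin.sum_univ_two,
    Matrix.map_apply, Algebra.algebraMap_eq_smul_one, smul_mul_assoc, mul_smul_comm, one_mul,
    mul_one]
  fin_cases i <;> fin_cases j <;> fin_cases k <;> fin_cases l <;>
    simp only [Fin.zero_eta, Fin.mk_one, lax_zero_zero, lax_zero_one, lax_one_zero, lax_one_one,
      Fin.isValue] <;>
    fin_cases a <;> fin_cases b <;>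
    simp [Rmat] <;>
    first
    | (left; ring)
    | linear_combination sinh η * h1
    | linear_combination sinh η * h2
    | linear_combination -sinh η * h1
    | linear_combination -sinh η * h2
    | linear_combination sinh η * h3
    | linear_combination -sinh η * h3

end

/-! ### Exchange relations of the monodromy matrix -/

section

variable {N : ℕ}

lemma RTT_one {R : Type*} [Ring R] [Algebra ℂ R] (η x : ℂ) :
    RTT η x (1 : Matrix (Fin 2) (Fin 2) R) 1 := by
  have h1 : aux₁ (1 : Matrix (Fin 2) (Fin 2) R) = 1 := by
    ext ⟨a, b⟩ ⟨c, d⟩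
    fin_cases b <;> fin_cases d <;> simp [aux₁, Matrix.one_apply]
  have h2 : aux₂ (1 : Matrix (Fin 2) (Fin 2) R) = 1 := by
    ext ⟨a, b⟩ ⟨c, d⟩
    fin_cases a <;> fin_cases c <;> simp [aux₂, Matrix.one_apply]
  rw [RTT, h1, h2, mul_one, mul_one, one_mul]

/-- Entries of Lax operators commute with the monodromy matrix of the other sites. -/
lemma commute_siteLax_monoList (η : ℂ) (ξ : Fin N → ℂ) {n : Fin N} {l : List (Fin N)} (hn : n ∉ l)
    (u v : ℂ) (i j k m : Fin 2) :
    Commute (monoList η ξ l u i j) (siteLax η v n k m) :=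
  (commute_monoList η ξ hn (lax η v k m) u i j).symm

lemma RTT_monoList (η : ℂ) (ξ : Fin N → ℂ) {l : List (Fin N)} (hl : l.Nodup) (u v : ℂ) :
    RTT η (u - v) (monoList η ξ l u) (monoList η ξ l v) := by
  induction l with
  | nil => exact RTT_one η _
  | cons n l ih =>
    rw [List.nodup_cons] at hl
    rw [monoList_cons, monoList_cons]
    refine RTT.mul ?_ (ih hl.2) (commute_siteLax_monoList η ξ hl.1 _ _)
      (commute_siteLax_monoList η ξ hl.1 _ _)
    have := (RTT_lax η (u - ξ n) (v - ξ n)).map (siteHom n)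
    rwa [sub_sub_sub_cancel_right] at this

lemma nodup_sites : ((List.finRange N).reverse).Nodup :=
  List.nodup_reverse.2 (List.nodup_finRange N)

section Exchange

variable {R : Type*} [Ring R] [Algebra ℂ R] {η x : ℂ} {X Y : Matrix (Fin 2) (Fin 2) R}

lemma RTT.apply (h : RTT η x X Y) (i j k l : Fin 2) :
    ∑ m, ∑ p, Rmat η x (i, j) (m, p) • (X m k * Y p l) =
      ∑ m, ∑ p, Rmat η x (m, p) (k, l) • (Y j p * X i m) := by
  have := congrFun (congrFun h (i, j)) (k, l)
  rw [Matrix.mul_apply, Matrix.mul_apply, Fintype.sum_prod_type, Fintype.sum_prod_type] at this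
  simpa only [aux₁_mul_aux₂_apply, aux₂_mul_aux₁_apply, Matrix.map_apply,
    Algebra.algebraMap_eq_smul_one, smul_mul_assoc, mul_smul_comm, one_mul, mul_one] using this

lemma RTT.BB (h : RTT η x X Y) : sinh (x + η) • (X 0 1 * Y 0 1) =
    sinh (x + η) • (Y 0 1 * X 0 1) := by
  simpa [Fin.sum_univ_two, Rmat] using h.apply 0 0 1 1

lemma RTT.BA (h : RTT η x X Y) : sinh (x + η) • (X 0 1 * Y 0 0) =
    sinh η • (Y 0 1 * X 0 0) + sinh x • (Y 0 0 * X 0 1) := by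
  simpa [Fin.sum_univ_two, Rmat] using h.apply 0 0 1 0

lemma RTT.DB (h : RTT η x X Y) : sinh η • (X 0 1 * Y 1 1) + sinh x • (X 1 1 * Y 0 1) =
    sinh (x + η) • (Y 0 1 * X 1 1) := by
  simpa [Fin.sum_univ_two, Rmat] using h.apply 1 0 1 1

end Exchange

section Monodromy

variable (η : ℂ) (ξ : Fin N → ℂ) (u v : ℂ)

lemma mono_B_mul_B (h : sinh (u - v + η) ≠ 0) :
    mono η ξ u 0 1 * mono η ξ v 0 1 = mono η ξ v 0 1 * mono η ξ u 0 1 :=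
  smul_right_injective _ h (RTT_monoList η ξ nodup_sites u v).BB

lemma mono_A_mul_B : sinh (u - v) • (mono η ξ u 0 0 * mono η ξ v 0 1) =
    sinh (u - v - η) • (mono η ξ v 0 1 * mono η ξ u 0 0) +
      sinh η • (mono η ξ u 0 1 * mono η ξ v 0 0) := by
  have h : _ • (mono η ξ v 0 1 * mono η ξ u 0 0) = _ • (mono η ξ u 0 1 * mono η ξ v 0 0) +
      _ • (mono η ξ u 0 0 * mono η ξ v 0 1) := (RTT_monoList η ξ nodup_sites v u).BA
  rw [show v - u + η = -(u - v - η) by ring, ← neg_sub u v, Complex.sinh_neg, Complex.sinh_neg,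
    neg_smul, neg_smul] at h
  rw [neg_eq_iff_eq_neg] at h
  rw [h]
  abel

lemma mono_D_mul_B : sinh (u - v) • (mono η ξ u 1 1 * mono η ξ v 0 1) =
    sinh (u - v + η) • (mono η ξ v 0 1 * mono η ξ u 1 1) -
      sinh η • (mono η ξ u 0 1 * mono η ξ v 1 1) :=
  eq_sub_of_add_eq' (RTT_monoList η ξ nodup_sites u v).DB

end Monodromy

/-! ### Quantum determinant and fusion -/

/-- The antisymmetric `2 × 2` matrix. -/
def eps : Matrix (Fin 2) (Fin 2) ℂ := !![0, 1; -1, 0]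

section Fusion

variable {R : Type*} [Ring R] [Algebra ℂ R]

/-- The column form of the statement that `X` and `Y` have quantum determinant `q`. -/
def ColDet (q : ℂ) (X Y : Matrix (Fin 2) (Fin 2) R) : Prop :=
  ∀ i k, X i 0 * Y k 1 - X i 1 * Y k 0 = (q * eps i k) • (1 : R)

/-- The row form of the statement that `X` and `Y` have quantum determinant `q`. -/
def RowDet (q : ℂ) (X Y : Matrix (Fin 2) (Fin 2) R) : Prop :=
  ∀ j l, X 0 j * Y 1 l - X 1 j * Y 0 l = (q * eps j l) • (1 : R)

/-- Products of entries of `X` and `Y` are antisymmetric in the row indices. -/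
def Antisymm (X Y : Matrix (Fin 2) (Fin 2) R) : Prop :=
  ∀ i j k l, X i j * Y k l = -(X k j * Y i l)

variable {q r : ℂ} {L A L' B : Matrix (Fin 2) (Fin 2) R}

lemma eq_zero_of_eq_neg {x : R} (hx : x = -x) : x = 0 := by
  have : (2 : ℂ) • x = 0 := by rw [two_smul]; nth_rw 2 [hx]; exact add_neg_cancel x
  exact (smul_eq_zero_iff_right two_ne_zero).1 this

lemma ColDet.mul (hL : ColDet q L L') (hA : ColDet r A B)
    (h : ∀ i j k l, Commute (A i j) (L' k l)) : ColDet (q * r) (L * A) (L' * B) := by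
  intro i k
  rw [mul_apply_mul_mul_apply h, mul_apply_mul_mul_apply h, ← Finset.sum_sub_distrib]
  simp_rw [← Finset.sum_sub_distrib, ← mul_sub, hA _ _]
  simp only [Fin.sum_univ_two, eps, Matrix.of_apply, Matrix.cons_val', Matrix.cons_val_zero,
    Matrix.cons_val_one, Matrix.cons_val_fin_one]
  have := hL i k
  simp only [mul_zero, zero_smul, mul_one, mul_neg, neg_smul, mul_smul_comm, zero_add, add_zero]
  rw [← sub_eq_add_neg, ← smul_sub, this, smul_smul, mul_left_comm, mul_assoc]
  fin_cases i <;> fin_cases k <;> rfl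

lemma RowDet.mul (hL : RowDet q L L') (hA : RowDet r A B)
    (h : ∀ i j k l, Commute (A i j) (L' k l)) : RowDet (q * r) (L * A) (L' * B) := by
  intro j l
  rw [mul_apply_mul_mul_apply h, mul_apply_mul_mul_apply h, ← Finset.sum_sub_distrib]
  simp_rw [← Finset.sum_sub_distrib, ← sub_mul, hL _ _]
  have := hA j l
  simp only [Fin.sum_univ_two, eps, Matrix.of_apply, Matrix.cons_val', Matrix.cons_val_zero,
    Matrix.cons_val_one, Matrix.cons_val_fin_one] at this ⊢
  simp only [mul_zero, zero_smul, mul_one, mul_neg, neg_smul, smul_mul_assoc, zero_add, add_zero,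
    one_mul, zero_mul, neg_mul]
  rw [← sub_eq_add_neg, ← smul_sub, this, smul_smul, mul_assoc]

lemma Antisymm.mul_right (hA : Antisymm A B) (hL : ColDet q L L')
    (h : ∀ i j k l, Commute (A i j) (L' k l)) : Antisymm (L * A) (L' * B) := by
  have key : ∀ i j k l, (L * A) i j * (L' * B) k l = (q * eps i k) • (A 0 j * B 1 l) := by
    intro i j k l
    rw [mul_apply_mul_mul_apply h]
    simp only [Fin.sum_univ_two]
    rw [eq_zero_of_eq_neg (hA 0 j 0 l), eq_zero_of_eq_neg (hA 1 j 1 l), hA 1 j 0 l, mul_zero,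
      mul_zero, zero_add, add_zero, mul_neg, ← sub_eq_add_neg, ← sub_mul, hL i k,
      smul_mul_assoc, one_mul]
  intro i j k l
  rw [key, key, ← neg_smul]
  congr 1
  fin_cases i <;> fin_cases k <;> simp [eps]

lemma colDet_one : ColDet 1 (1 : Matrix (Fin 2) (Fin 2) R) 1 := by
  intro i k
  fin_cases i <;> fin_cases k <;> simp [eps, Matrix.one_apply]

lemma rowDet_one : RowDet 1 (1 : Matrix (Fin 2) (Fin 2) R) 1 := by
  intro i k
  fin_cases i <;> fin_cases k <;> simp [eps, Matrix.one_apply]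

lemma ColDet.map {S : Type*} [Ring S] [Algebra ℂ S] (f : R →ₐ[ℂ] S) (h : ColDet q A B) :
    ColDet q (A.map f) (B.map f) := fun i k => by
  simpa using congrArg f (h i k)

lemma RowDet.map {S : Type*} [Ring S] [Algebra ℂ S] (f : R →ₐ[ℂ] S) (h : RowDet q A B) :
    RowDet q (A.map f) (B.map f) := fun i k => by
  simpa using congrArg f (h i k)

lemma Antisymm.map {S : Type*} [Ring S] [Algebra ℂ S] (f : R →ₐ[ℂ] S) (h : Antisymm A B) :
    Antisymm (A.map f) (B.map f) := fun i j k l => by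
  simpa using congrArg f (h i j k l)

end Fusion

lemma Antisymm.mul_left {R : Type*} [Ring R] {L A L' B : Matrix (Fin 2) (Fin 2) R}
    (hL : Antisymm L L') (h : ∀ i j k l, Commute (A i j) (L' k l)) :
    Antisymm (L * A) (L' * B) := by
  intro i j k l
  rw [mul_apply_mul_mul_apply h, mul_apply_mul_mul_apply h, ← Finset.sum_neg_distrib]
  simp_rw [← Finset.sum_neg_distrib]
  exact Finset.sum_congr rfl fun m _ => Finset.sum_congr rfl fun p _ => by
    rw [hL i m k p, neg_mul]

lemma sinh_mul_self_sub (η u : ℂ) :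
    sinh u * sinh u - sinh η * sinh η = sinh (u + η) * sinh (u - η) := by
  have := sinh_add_mul_sinh_add η η (u - η)
  rw [add_sub_cancel, show η + η + (u - η) = u + η by ring] at this
  linear_combination this

lemma colDet_lax (η u : ℂ) :
    ColDet (sinh (u + η) * sinh (u - η)) (lax η u) (lax η (u - η)) := by
  intro i k
  fin_cases i <;> fin_cases k <;> ext a b <;> fin_cases a <;> fin_cases b <;>
    simp [eps, lax_zero_zero, lax_zero_one, lax_one_zero, lax_one_one] <;>
    first
    | ring1
    | linear_combination sinh_mul_self_sub η u
    | linear_combination -sinh_mul_self_sub η u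

lemma rowDet_lax (η u : ℂ) :
    RowDet (sinh (u + η) * sinh (u - η)) (lax η (u - η)) (lax η u) := by
  intro i k
  fin_cases i <;> fin_cases k <;> ext a b <;> fin_cases a <;> fin_cases b <;>
    simp [eps, lax_zero_zero, lax_zero_one, lax_one_zero, lax_one_one] <;>
    first
    | ring1
    | linear_combination sinh_mul_self_sub η u
    | linear_combination -sinh_mul_self_sub η u

lemma antisymm_lax (η : ℂ) : Antisymm (lax η 0) (lax η (0 - η)) := by
  intro i j k l
  fin_cases i <;> fin_cases j <;> fin_cases k <;> fin_cases l <;> ext a b <;>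
    fin_cases a <;> fin_cases b <;>
    simp [lax_zero_zero, lax_zero_one, lax_one_zero, lax_one_one]

section Monodromy

variable (η : ℂ) (ξ : Fin N → ℂ)

lemma colDet_monoList {l : List (Fin N)} (hl : l.Nodup) (u : ℂ) :
    ColDet (l.map fun n => sinh (u - ξ n + η) * sinh (u - ξ n - η)).prod
      (monoList η ξ l u) (monoList η ξ l (u - η)) := by
  induction l with
  | nil => exact colDet_one
  | cons n l ih =>
    rw [List.nodup_cons] at hl
    rw [monoList_cons, monoList_cons, List.map_cons, List.prod_cons]
    refine ColDet.mul ?_ (ih hl.2) (commute_siteLax_monoList η ξ hl.1 _ _)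
    rw [sub_right_comm u η]
    exact (colDet_lax η (u - ξ n)).map (siteHom n)

lemma rowDet_monoList {l : List (Fin N)} (hl : l.Nodup) (u : ℂ) :
    RowDet (l.map fun n => sinh (u - ξ n + η) * sinh (u - ξ n - η)).prod
      (monoList η ξ l (u - η)) (monoList η ξ l u) := by
  induction l with
  | nil => exact rowDet_one
  | cons n l ih =>
    rw [List.nodup_cons] at hl
    rw [monoList_cons, monoList_cons, List.map_cons, List.prod_cons]
    refine RowDet.mul ?_ (ih hl.2) (commute_siteLax_monoList η ξ hl.1 _ _)
    rw [sub_right_comm u η]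
    exact (rowDet_lax η (u - ξ n)).map (siteHom n)

/-- At `ξ_n` the Lax operators of the `n`-th site are antisymmetric, and the quantum determinants of
the other sites carry the antisymmetry through the product. -/
lemma antisymm_monoList {l : List (Fin N)} (hl : l.Nodup) {n : Fin N} (hn : n ∈ l) :
    Antisymm (monoList η ξ l (ξ n)) (monoList η ξ l (ξ n - η)) := by
  induction l with
  | nil => simp at hn
  | cons m l ih =>
    rw [List.nodup_cons] at hl
    rw [monoList_cons, monoList_cons]
    rcases eq_or_ne n m with rfl | hnm
    · refine Antisymm.mul_left ?_ (commute_siteLax_monoList η ξ hl.1 _ _)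
      rw [sub_right_comm, sub_self]
      exact (antisymm_lax η).map (siteHom n)
    · refine Antisymm.mul_right (q := sinh (ξ n - ξ m + η) * sinh (ξ n - ξ m - η))
        (ih hl.2 (List.mem_of_ne_of_mem hnm hn)) ?_ (commute_siteLax_monoList η ξ hl.1 _ _)
      rw [sub_right_comm (ξ n) η]
      exact (colDet_lax η (ξ n - ξ m)).map (siteHom m)

lemma prod_sites (u : ℂ) : (((List.finRange N).reverse).map
    fun n => sinh (u - ξ n + η) * sinh (u - ξ n - η)).prod = aFun η ξ u * dFun ξ (u - η) := by
  rw [List.map_reverse, List.prod_reverse, ← List.ofFn_eq_map, List.prod_ofFn, aFun, dFun,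
    ← Finset.prod_mul_distrib]
  simp only [sub_right_comm u η]

/-- The quantum determinant identity for the rows. -/
lemma mono_A_mul_D_sub_C_mul_B (u : ℂ) :
    mono η ξ (u - η) 0 0 * mono η ξ u 1 1 - mono η ξ (u - η) 1 0 * mono η ξ u 0 1 =
      (aFun η ξ u * dFun ξ (u - η)) • (1 : Op N) := by
  have hq := rowDet_monoList η ξ nodup_sites u 0 1
  rw [prod_sites] at hq
  simpa [eps, mono] using hq

lemma mono_B_mul_B_self (n : Fin N) : mono η ξ (ξ n) 0 1 * mono η ξ (ξ n - η) 0 1 = 0 := by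
  have := antisymm_monoList η ξ nodup_sites (n := n) (by simp) 0 1 0 1
  exact eq_zero_of_eq_neg this

/-- Fusion at `ξ_n`: by the antisymmetry, the product of transfer matrices reduces to the quantum
determinant. -/
lemma transfer_mul_transfer (α : ℂ) (n : Fin N) :
    transfer η α ξ (ξ n) * transfer η α ξ (ξ n - η) =
      (aFun η ξ (ξ n) * dFun ξ (ξ n - η)) • (1 : Op N) := by
  have h := antisymm_monoList η ξ nodup_sites (n := n) (by simp)
  have hA := eq_zero_of_eq_neg (h 0 0 0 0)
  have hD := eq_zero_of_eq_neg (h 1 1 1 1)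
  have hC := h 1 1 0 0
  have hq := colDet_monoList η ξ nodup_sites (ξ n) 0 1
  rw [prod_sites] at hq
  simp only [eps, Matrix.of_apply, Matrix.cons_val', Matrix.cons_val_zero,
    Matrix.cons_val_one, Matrix.cons_val_fin_one, mul_one] at hq
  rw [← hq, transfer_eq, transfer_eq]
  simp only [mono, add_mul, mul_add, smul_mul_assoc, mul_smul_comm, hA, hD, hC, smul_zero, smul_neg,
    zero_add, add_zero, smul_smul, ← Complex.exp_add]
  simp [sub_eq_add_neg, add_comm]

end Monodromy

end

/-! ### Conservation of the number of down spins -/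

section

variable {N : ℕ}

/-- The number of down spins of a configuration. -/
def downs (s : Conf N) : ℕ := ∑ n, (s n : ℕ)

lemma downs_update (s : Conf N) (n : Fin N) (k : Fin 2) :
    downs (Function.update s n k) + (s n : ℕ) = downs s + k := by
  have h1 := Finset.add_sum_erase Finset.univ (fun m => (s m : ℕ)) (Finset.mem_univ n)
  have h2 := Finset.add_sum_erase Finset.univ (fun m => (Function.update s n k m : ℕ))
    (Finset.mem_univ n)
  have h3 : ∑ m ∈ Finset.univ.erase n, (Function.update s n k m : ℕ) =
      ∑ m ∈ Finset.univ.erase n, (s m : ℕ) :=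
    Finset.sum_congr rfl fun m hm => by rw [Function.update_of_ne (Finset.ne_of_mem_erase hm)]
  simp only [Function.update_self] at h2
  unfold downs
  omega

lemma downs_of_siteLax_ne_zero {η u : ℂ} {n : Fin N} {i j : Fin 2} {s s' : Conf N}
    (h : siteLax η u n i j s s' ≠ 0) : (i : ℕ) + downs s = j + downs s' := by
  have h' : siteOp n (lax η u i j) s s' ≠ 0 := h
  unfold siteOp at h'
  split_ifs at h' with hs
  · have h1 := (agree_iff_update n s s' (s' n)).2 ⟨rfl, hs⟩
    have h2 := downs_update s n (s' n)
    rw [← h1] at h2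
    have h3 : (i : ℕ) + (s n : ℕ) = j + (s' n : ℕ) := by
      generalize s n = a at h'
      generalize s' n = b at h'
      clear h h1 h2 hs
      revert h'
      fin_cases i <;> fin_cases j <;> fin_cases a <;> fin_cases b <;>
        simp [lax_zero_zero, lax_zero_one, lax_one_zero, lax_one_one]
    omega
  · exact absurd rfl h'

lemma downs_of_monoList_ne_zero {η : ℂ} {ξ : Fin N → ℂ} {l : List (Fin N)} {u : ℂ} {i j : Fin 2}
    {s s' : Conf N} (h : monoList η ξ l u i j s s' ≠ 0) :
    (i : ℕ) + downs s = j + downs s' := by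
  induction l generalizing i s with
  | nil =>
    simp only [monoList, List.map_nil, List.prod_nil, Matrix.one_apply] at h
    split_ifs at h with hij
    · subst hij
      rw [Matrix.one_apply] at h
      split_ifs at h with hs
      · rw [hs]
      · exact absurd rfl h
    · exact absurd rfl h
  | cons n l ih =>
    rw [monoList_cons, Matrix.mul_apply, Matrix.sum_apply] at h
    obtain ⟨k, -, hk⟩ := Finset.exists_ne_zero_of_sum_ne_zero h
    rw [Matrix.mul_apply] at hk
    obtain ⟨r, -, hr⟩ := Finset.exists_ne_zero_of_sum_ne_zero hk
    rw [downs_of_siteLax_ne_zero (left_ne_zero_of_mul hr), ih (right_ne_zero_of_mul hr)]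

lemma sum_spin (s : Conf N) : ∑ n, (if s n = 0 then (1 : ℂ) else -1) = N - 2 * downs s := by
  have : ∀ k : Fin 2, (if k = 0 then (1 : ℂ) else -1) = 1 - 2 * ((k : ℕ) : ℂ) := by
    intro k; fin_cases k <;> norm_num
  simp only [this, Finset.sum_sub_distrib, ← Finset.mul_sum, downs]
  simp

lemma Sz_mulVec_eq_iff (M : ℕ) (v : Conf N → ℂ) :
    Sz N *ᵥ v = ((N : ℂ) - 2 * M) • v ↔ ∀ s, v s ≠ 0 → downs s = M := by
  rw [funext_iff]
  refine forall_congr' fun s => ?_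
  rw [Sz, Matrix.mulVec_diagonal, sum_spin, Pi.smul_apply, smul_eq_mul]
  constructor
  · intro h hv
    have := mul_right_cancel₀ hv h
    have h2 : ((downs s : ℕ) : ℂ) = M := by linear_combination -this / 2
    exact_mod_cast h2
  · intro h
    by_cases hv : v s = 0
    · simp [hv]
    · rw [h hv]

/-! ### The reference state -/

/-- The reference state: all spins up. -/
def vac (N : ℕ) : Conf N → ℂ := Pi.single 0 1

lemma siteOp_mulVec_vac (n : Fin N) (X : Matrix (Fin 2) (Fin 2) ℂ) (h : X 1 0 = 0) :
    siteOp n X *ᵥ vac N = X 0 0 • vac N := by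
  ext s
  rw [siteOp_mulVec_apply]
  simp only [vac, Pi.single_apply, Pi.smul_apply, smul_eq_mul, mul_ite, mul_one, mul_zero,
    Fin.sum_univ_two]
  have h1 : Function.update s n 1 ≠ 0 := fun h => by simpa using congrFun h n
  rw [if_neg h1, add_zero]
  by_cases hs : s = 0
  · subst hs
    rw [if_pos (by ext m; by_cases hm : m = n <;> simp [Function.update, hm]), if_pos rfl]
    rfl
  · rw [if_neg hs]
    split_ifs with h2
    · have : s n = 1 := by
        by_contra h3
        have h4 : s n = 0 := by omega
        exact hs (by rw [← h2, ← h4, Function.update_eq_self])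
      rw [this, h]
    · rfl

section Vacuum

variable (η : ℂ) (ξ : Fin N → ℂ) (u : ℂ)

lemma monoList_mulVec_vac {l : List (Fin N)} (hl : l.Nodup) :
    monoList η ξ l u 0 0 *ᵥ vac N = (l.map fun n => sinh (u - ξ n + η)).prod • vac N ∧
    monoList η ξ l u 1 1 *ᵥ vac N = (l.map fun n => sinh (u - ξ n)).prod • vac N ∧
    monoList η ξ l u 1 0 *ᵥ vac N = 0 := by
  induction l with
  | nil => simp [monoList]
  | cons n l ih =>
    rw [List.nodup_cons] at hl
    obtain ⟨hA, hD, hC⟩ := ih hl.2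
    have hL : ∀ i j, lax η (u - ξ n) i j 1 0 = 0 → siteLax η (u - ξ n) n i j *ᵥ vac N =
        lax η (u - ξ n) i j 0 0 • vac N := fun i j => siteOp_mulVec_vac n _
    simp only [monoList_cons, Matrix.mul_apply, Fin.sum_univ_two, Matrix.add_mulVec]
    refine ⟨?_, ?_, ?_⟩
    · rw [← Matrix.mulVec_mulVec, ← Matrix.mulVec_mulVec, hA, hC, Matrix.mulVec_zero, add_zero,
        Matrix.mulVec_smul, hL 0 0 (by simp [lax_zero_zero]), smul_smul, List.map_cons,
        List.prod_cons, mul_comm]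
      simp [lax_zero_zero]
    · rw [← (commute_siteLax_monoList η ξ hl.1 u (u - ξ n) 0 1 1 0).eq, ← Matrix.mulVec_mulVec,
        ← Matrix.mulVec_mulVec, hL 1 0 (by simp [lax_one_zero]), hD, Matrix.mulVec_smul,
        Matrix.mulVec_smul, hL 1 1 (by simp [lax_one_one]), smul_smul, List.map_cons,
        List.prod_cons, mul_comm]
      simp [lax_one_one, lax_one_zero]
    · rw [← (commute_siteLax_monoList η ξ hl.1 u (u - ξ n) 0 0 1 0).eq, ← Matrix.mulVec_mulVec,
        ← Matrix.mulVec_mulVec, hL 1 0 (by simp [lax_one_zero]), hC]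
      simp [lax_one_zero]

lemma mono_A_mulVec_vac : mono η ξ u 0 0 *ᵥ vac N = aFun η ξ u • vac N := by
  rw [mono, (monoList_mulVec_vac η ξ u nodup_sites).1, List.map_reverse, List.prod_reverse,
    ← List.ofFn_eq_map, List.prod_ofFn, aFun]

lemma mono_D_mulVec_vac : mono η ξ u 1 1 *ᵥ vac N = dFun ξ u • vac N := by
  rw [mono, (monoList_mulVec_vac η ξ u nodup_sites).2.1, List.map_reverse, List.prod_reverse,
    ← List.ofFn_eq_map, List.prod_ofFn, dFun]

end Vacuum

/-! ### The monodromy matrix as a trigonometric polynomial -/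

/-- After conjugation with `exp (u σᶻ / 2)` in the auxiliary space, the entries of `F` are
trigonometric polynomials of degree `d`, with leading coefficients `X` and trailing
coefficients `Y`. -/
def GaugedTrig (d : ℕ) (F : ℂ → Matrix (Fin 2) (Fin 2) (Op N))
    (X Y : Matrix (Fin 2) (Fin 2) (Op N)) : Prop :=
  ∃ p : Fin 2 → Fin 2 → Conf N → Conf N → ℂ[X],
    (∀ i j s s', (p i j s s').natDegree ≤ d) ∧
    (∀ u (i j : Fin 2) s s', exp ((((j : ℕ) : ℂ) - ((i : ℕ) : ℂ)) * u) * F u i j s s' =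
      trig d (p i j s s') u) ∧
    (∀ i j s s', (p i j s s').coeff d = X i j s s') ∧
    ∀ i j s s', (p i j s s').coeff 0 = Y i j s s'

lemma GaugedTrig.mul {d e : ℕ} {F G : ℂ → Matrix (Fin 2) (Fin 2) (Op N)}
    {X Y X' Y' : Matrix (Fin 2) (Fin 2) (Op N)} (hF : GaugedTrig d F X Y)
    (hG : GaugedTrig e G X' Y') : GaugedTrig (d + e) (fun u => F u * G u) (X * X') (Y * Y') := by
  obtain ⟨p, hpd, hp, hpX, hpY⟩ := hF
  obtain ⟨q, hqd, hq, hqX, hqY⟩ := hG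
  refine ⟨fun i j s s' => ∑ k, ∑ r, p i k s r * q k j r s', fun i j s s' => ?_,
    fun u i j s s' => ?_, fun i j s s' => ?_, fun i j s s' => ?_⟩
  · exact natDegree_sum_le_of_forall_le _ _ fun k _ => natDegree_sum_le_of_forall_le _ _
      fun r _ => natDegree_mul_le_of_le (hpd _ _ _ _) (hqd _ _ _ _)
  · simp only [trig_sum, ← trig_mul, ← hp, ← hq, Matrix.mul_apply, Matrix.sum_apply, Finset.mul_sum]
    refine Finset.sum_congr rfl fun k _ => Finset.sum_congr rfl fun r _ => ?_
    rw [show (((j : ℕ) : ℂ) - ((i : ℕ) : ℂ)) * u = (((k : ℕ) : ℂ) - ((i : ℕ) : ℂ)) * u +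
      (((j : ℕ) : ℂ) - ((k : ℕ) : ℂ)) * u by ring, Complex.exp_add]
    ring
  · simp only [finsetSum_coeff, coeff_mul_add_eq_of_natDegree_le (hpd _ _ _ _) (hqd _ _ _ _), hpX,
      hqX, Matrix.mul_apply, Matrix.sum_apply]
  · simp only [finsetSum_coeff, mul_coeff_zero, hpY, hqY, Matrix.mul_apply, Matrix.sum_apply]

/-- The leading coefficients of the gauged Lax operator at `u - c`. -/
noncomputable def laxLead (η c : ℂ) : Matrix (Fin 2) (Fin 2) (Matrix (Fin 2) (Fin 2) ℂ) :=
  !![!![exp (-c) / 2 * exp η, 0; 0, exp (-c) / 2], !![0, 0; sinh η, 0];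
    0, !![exp (-c) / 2, 0; 0, exp (-c) / 2 * exp η]]

/-- The trailing coefficients of the gauged Lax operator at `u - c`. -/
noncomputable def laxTrail (η c : ℂ) : Matrix (Fin 2) (Fin 2) (Matrix (Fin 2) (Fin 2) ℂ) :=
  !![!![-(exp c / 2) * exp (-η), 0; 0, -(exp c / 2)], 0;
    !![0, sinh η; 0, 0], !![-(exp c / 2), 0; 0, -(exp c / 2) * exp (-η)]]

lemma exp_mul_lax (η c u : ℂ) (i j a b : Fin 2) :
    exp ((((j : ℕ) : ℂ) - ((i : ℕ) : ℂ)) * u) * lax η (u - c) i j a b =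
      exp (-u) * (laxLead η c i j a b * exp (2 * u) + laxTrail η c i j a b) := by
  have h1 : exp (-u) * exp (2 * u) = exp u := by rw [← Complex.exp_add]; ring_nf
  have h2 : ∀ x y : ℂ, sinh (x - y) = (exp (-y) * exp x - exp y * exp (-x)) / 2 := fun x y => by
    rw [Complex.sinh, ← Complex.exp_add, ← Complex.exp_add]; ring_nf
  have h3 : ∀ x y z : ℂ, sinh (x - y + z) =
      (exp (-y) * exp z * exp x - exp y * exp (-z) * exp (-x)) / 2 := fun x y z => by
    rw [Complex.sinh, ← Complex.exp_add, ← Complex.exp_add, ← Complex.exp_add, ← Complex.exp_add]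
    ring_nf
  fin_cases i <;> fin_cases j <;> fin_cases a <;> fin_cases b <;>
    simp [lax_zero_zero, lax_zero_one, lax_one_zero, lax_one_one, laxLead, laxTrail, h2, h3] <;>
    first
    | ring1
    | linear_combination (-exp (-c) * exp η / 2) * h1
    | linear_combination (-exp (-c) / 2) * h1
    | linear_combination -sinh η * h1

lemma gaugedTrig_siteLax (η c : ℂ) (n : Fin N) :
    GaugedTrig 1 (fun u => siteLax η (u - c) n) ((laxLead η c).map (siteHom n))
      ((laxTrail η c).map (siteHom n)) := by
  refine ⟨fun i j s s' => Polynomial.C (siteOp n (laxLead η c i j) s s') * Polynomial.X +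
    Polynomial.C (siteOp n (laxTrail η c i j) s s'), fun i j s s' => natDegree_linear_le,
    fun u i j s s' => ?_, fun i j s s' => ?_, fun i j s s' => ?_⟩
  · have h := exp_mul_lax η c u i j (s n) (s' n)
    simp only [trig, siteLax, Matrix.map_apply, siteHom_apply, siteOp, eval_add, eval_mul, eval_C,
      eval_X, Nat.cast_one, one_mul]
    split_ifs
    · exact h
    · simp
  · simp [siteHom_apply]
  · simp [siteHom_apply]

lemma siteOp_diagonal (n : Fin N) (a b : ℂ) :
    siteOp n !![a, 0; 0, b] = Matrix.diagonal fun s => if s n = 0 then a else b := by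
  ext s s'
  rw [siteOp, Matrix.diagonal_apply]
  by_cases h : s = s'
  · subst h
    rw [if_pos fun _ _ => rfl, if_pos rfl]
    generalize s n = k
    fin_cases k <;> simp
  · rw [if_neg h]
    split_ifs with h1
    · have : s n ≠ s' n := fun h2 => h (funext fun m => by
        rcases eq_or_ne m n with rfl | hm
        exacts [h2, h1 m hm])
      revert this
      generalize s n = k
      generalize s' n = k'
      fin_cases k <;> fin_cases k' <;> simp
    · rfl

lemma gaugedTrig_monoList (η : ℂ) (ξ : Fin N → ℂ) (l : List (Fin N)) :
    ∃ X Y, GaugedTrig l.length (monoList η ξ l) X Y ∧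
      X 1 0 = 0 ∧
      X 0 0 = Matrix.diagonal (fun s =>
        (l.map fun n => exp (-ξ n) / 2 * if s n = 0 then exp η else 1).prod) ∧
      X 1 1 = Matrix.diagonal (fun s =>
        (l.map fun n => exp (-ξ n) / 2 * if s n = 0 then 1 else exp η).prod) ∧
      Y 0 1 = 0 ∧
      Y 0 0 = Matrix.diagonal (fun s =>
        (l.map fun n => -(exp (ξ n) / 2) * if s n = 0 then exp (-η) else 1).prod) ∧
      Y 1 1 = Matrix.diagonal (fun s =>
        (l.map fun n => -(exp (ξ n) / 2) * if s n = 0 then 1 else exp (-η)).prod) := by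
  induction l with
  | nil =>
    refine ⟨1, 1, ⟨fun i j s s' => Polynomial.C ((1 : Matrix (Fin 2) (Fin 2) (Op N)) i j s s'),
      fun i j s s' => by simp, fun u i j s s' => ?_, fun i j s s' => by simp,
      fun i j s s' => by simp⟩, by simp, by simp, by simp, by simp, by simp, by simp⟩
    simp only [monoList, List.map_nil, List.prod_nil, List.length_nil, trig, Nat.cast_zero,
      zero_mul, neg_zero, Complex.exp_zero, one_mul, eval_C]
    rcases eq_or_ne i j with rfl | hij
    · simp
    · simp [Matrix.one_apply_ne hij]
  | cons n l ih =>
    obtain ⟨X, Y, h, h1, h2, h3, h4, h5, h6⟩ := ih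
    have hm := (gaugedTrig_siteLax η (ξ n) n).mul h
    refine ⟨(laxLead η (ξ n)).map (siteHom n) * X, (laxTrail η (ξ n)).map (siteHom n) * Y,
      ?_, ?_, ?_, ?_, ?_, ?_, ?_⟩
    · rw [List.length_cons, add_comm, show monoList η ξ (n :: l) =
        fun u => siteLax η (u - ξ n) n * monoList η ξ l u from funext fun u => monoList_cons ..]
      exact hm
    all_goals
      simp only [Matrix.mul_apply, Fin.sum_univ_two, h1, h2, h3, h4, h5, h6, Matrix.map_apply,
        siteHom_apply, laxLead, laxTrail, Matrix.of_apply, Matrix.cons_val', Matrix.cons_val_zero,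
        Matrix.cons_val_one, Matrix.cons_val_fin_one, siteOp_diagonal, mul_zero, add_zero, zero_add,
        Matrix.diagonal_mul_diagonal, List.map_cons, List.prod_cons, mul_ite, mul_one]
    all_goals
      rw [show siteOp n (0 : Matrix (Fin 2) (Fin 2) ℂ) = 0 from map_zero (siteHom n)]
      simp

lemma prod_ite_downs (s : Conf N) (c : ℂ) :
    ∏ n, (if s n = 0 then 1 else c) = c ^ downs s := by
  rw [downs, ← Finset.prod_pow_eq_pow_sum]
  refine Finset.prod_congr rfl fun n _ => ?_
  generalize s n = k
  fin_cases k <;> simp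

lemma prod_ite_ups (s : Conf N) {c : ℂ} (hc : c ≠ 0) :
    ∏ n, (if s n = 0 then c else 1) = c ^ N * (c ^ downs s)⁻¹ := by
  rw [← prod_ite_downs, eq_mul_inv_iff_mul_eq₀, ← Finset.prod_mul_distrib]
  · rw [Finset.prod_congr rfl (g := fun _ => c) fun n _ => by split_ifs <;> simp]
    simp
  · exact Finset.prod_ne_zero_iff.2 fun n _ => by split_ifs <;> simp [hc]

lemma prod_sites' (f : Fin N → ℂ) : (((List.finRange N).reverse).map f).prod = ∏ n, f n := by
  rw [List.map_reverse, List.prod_reverse, ← List.ofFn_eq_map, List.prod_ofFn]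

/-- The transfer matrix has trigonometric polynomials of degree `N` as entries; its extreme
coefficients are diagonal. -/
lemma exists_trig_transfer (η α : ℂ) (ξ : Fin N → ℂ) : ∃ p : Conf N → Conf N → ℂ[X],
    (∀ s s', (p s s').natDegree ≤ N) ∧ (∀ u s s', transfer η α ξ u s s' = trig N (p s s') u) ∧
    (∀ s s', (p s s').coeff N = if s = s' then dLead ξ *
      (exp (α + (N - downs s) * η) + exp (-α + downs s * η)) else 0) ∧
    ∀ s s', (p s s').coeff 0 = if s = s' then dTrail ξ *
      (exp (α - (N - downs s) * η) + exp (-α - downs s * η)) else 0 := by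
  obtain ⟨X, Y, ⟨p, hpd, hp, hpX, hpY⟩, -, h2, h3, -, h5, h6⟩ :=
    gaugedTrig_monoList η ξ (List.finRange N).reverse
  rw [List.length_reverse, List.length_finRange] at hpd hp hpX
  refine ⟨fun s s' => Polynomial.C (exp α) * p 0 0 s s' + Polynomial.C (exp (-α)) * p 1 1 s s',
    fun s s' => ?_, fun u s s' => ?_, fun s s' => ?_, fun s s' => ?_⟩
  · exact natDegree_add_le_of_degree_le ((natDegree_C_mul_le _ _).trans (hpd _ _ _ _))
      ((natDegree_C_mul_le _ _).trans (hpd _ _ _ _))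
  · rw [trig_add, trig_C_mul, trig_C_mul, ← hp, ← hp, transfer_eq]
    simp [mono]
  · rw [coeff_add, coeff_C_mul, coeff_C_mul, hpX, hpX, h2, h3, Matrix.diagonal_apply,
      Matrix.diagonal_apply]
    split_ifs with hs
    · simp only [prod_sites', Finset.prod_mul_distrib, prod_ite_downs,
        prod_ite_ups _ (Complex.exp_ne_zero _), ← Complex.exp_nat_mul, ← Complex.exp_neg]
      rw [sub_mul, add_sub_assoc', Complex.exp_sub, Complex.exp_add, Complex.exp_add,
        Complex.exp_neg (_ * η), dLead]
      ring
    · simp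
  · rw [coeff_add, coeff_C_mul, coeff_C_mul, hpY, hpY, h5, h6, Matrix.diagonal_apply,
      Matrix.diagonal_apply]
    split_ifs with hs
    · simp only [prod_sites', Finset.prod_mul_distrib, prod_ite_downs,
        prod_ite_ups _ (Complex.exp_ne_zero _), ← Complex.exp_nat_mul, ← Complex.exp_neg]
      have h1 : exp (α - (N - downs s) * η) =
          exp α * (exp (N * -η) * exp (-(downs s * -η))) := by
        rw [← Complex.exp_add, ← Complex.exp_add]; ring_nf
      have h2 : exp (-α - downs s * η) = exp (-α) * exp (downs s * -η) := by
        rw [← Complex.exp_add]; ring_nf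
      rw [h1, h2, dTrail]
      ring
    · simp

/-- The entries of the `B`-operator are trigonometric polynomials of degree `N - 1`. -/
lemma exists_trig_mono_B (hN : 1 ≤ N) (η : ℂ) (ξ : Fin N → ℂ) : ∃ p : Conf N → Conf N → ℂ[X],
    (∀ s s', (p s s').natDegree ≤ N - 1) ∧
    ∀ u s s', mono η ξ u 0 1 s s' = trig (N - 1) (p s s') u := by
  obtain ⟨X, Y, ⟨p, hpd, hp, -, hpY⟩, -, -, -, h4, -, -⟩ :=
    gaugedTrig_monoList η ξ (List.finRange N).reverse
  rw [List.length_reverse, List.length_finRange] at hpd hp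
  refine ⟨fun s s' => (p 0 1 s s').divX, fun s s' => ?_, fun u s s' => ?_⟩
  · rw [natDegree_divX_eq_natDegree_tsub_one]
    exact Nat.sub_le_sub_right (hpd _ _ _ _) 1
  · have h1 := hp u 0 1 s s'
    have h2 : p 0 1 s s' = (p 0 1 s s').divX * Polynomial.X := by
      conv_lhs => rw [← divX_mul_X_add (p 0 1 s s'), hpY, h4]
      simp
    rw [h2, trig, eval_mul, eval_X] at h1
    have h3 : exp (-(N * u)) * exp (2 * u) = exp u * exp (-((N - 1 : ℕ) * u)) := by
      rw [← Complex.exp_add, ← Complex.exp_add, Nat.cast_sub hN]; push_cast; ring_nf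
    rw [mul_comm (eval _ _), ← mul_assoc, h3, mul_assoc] at h1
    refine mul_left_cancel₀ (Complex.exp_ne_zero u) ?_
    rw [trig, ← h1]
    simp [mono]

/-- The eigenvalues of the transfer matrix in a sector of fixed spin solve the equations that
characterize spectral polynomials. -/
lemma IsEigen.exists_isSpectral {η α : ℂ} {ξ : Fin N → ℂ} {t : ℂ → ℂ} {v : Conf N → ℂ}
    (h : IsEigen η α ξ t v) (hv : v ≠ 0) {M : ℕ} (hM : ∀ s, v s ≠ 0 → downs s = M) :
    ∃ P, IsSpectral η α ξ M P ∧ ∀ u, t u = trig N P u := by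
  obtain ⟨s, hs⟩ := Function.ne_iff.1 hv
  obtain ⟨p, hpd, hp, hp1, hp0⟩ := exists_trig_transfer η α ξ
  have ht : ∀ u, t u = trig N (∑ r, Polynomial.C (v r / v s) * p s r) u := fun u => by
    have h1 := congrFun (h u) s
    simp only [Matrix.mulVec, dotProduct, Pi.smul_apply, smul_eq_mul, hp] at h1
    rw [eq_comm, ← eq_div_iff hs] at h1
    rw [h1, trig_sum, Finset.sum_div]
    exact Finset.sum_congr rfl fun r _ => by rw [trig_C_mul]; ring
  have hf : ∀ n, t (ξ n) * t (ξ n - η) = aFun η ξ (ξ n) * dFun ξ (ξ n - η) := fun n => by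
    have h1 := congrFun (congrArg (· *ᵥ v) (transfer_mul_transfer η ξ α n)) s
    rw [← Matrix.mulVec_mulVec, h, Matrix.mulVec_smul, h, Matrix.smul_mulVec,
      Matrix.one_mulVec, smul_smul] at h1
    have h2 := mul_right_cancel₀ hs h1
    rw [← h2, mul_comm]
  refine ⟨_, ⟨?_, ?_, ?_, fun n => ?_⟩, ht⟩
  · exact natDegree_sum_le_of_forall_le _ _ fun r _ => (natDegree_C_mul_le _ _).trans (hpd _ _)
  · rw [finsetSum_coeff]
    simp only [coeff_C_mul, hp1, mul_ite, mul_zero, Finset.sum_ite_eq, Finset.mem_univ, if_true,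
      div_self hs, one_mul, hM s hs]
  · rw [finsetSum_coeff]
    simp only [coeff_C_mul, hp0, mul_ite, mul_zero, Finset.sum_ite_eq, Finset.mem_univ, if_true,
      div_self hs, one_mul, hM s hs]
  · rw [← ht, ← ht, hf]

end

/-! ### Interpolation -/

section

variable {N : ℕ}

/-- Lagrange interpolation for trigonometric polynomials. -/
lemma trig_eq_sum_interpolation {d : ℕ} {p : ℂ[X]} (hp : p.natDegree ≤ d) {ι : Type*}
    [DecidableEq ι] (s : Finset ι) (x : ι → ℂ) (hx : Set.InjOn (fun i => exp (2 * x i)) s)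
    (hs : s.card = d + 1) (u : ℂ) :
    trig d p u = ∑ i ∈ s, trig d p (x i) * ∏ j ∈ s.erase i, sinh (u - x j) / sinh (x i - x j) := by
  let r : ℂ[X] := ∑ i ∈ s, C (trig d p (x i) * (∏ j ∈ s.erase i, sinh (x i - x j))⁻¹) *
    ∏ j ∈ s.erase i, sinhPoly (x j)
  have hr : ∀ v, trig d r v =
      ∑ i ∈ s, trig d p (x i) * ∏ j ∈ s.erase i, sinh (v - x j) / sinh (x i - x j) := by
    intro v
    rw [trig_sum]
    refine Finset.sum_congr rfl fun i hi => ?_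
    have hc : (s.erase i).card = d := by rw [Finset.card_erase_of_mem hi, hs, Nat.add_sub_cancel]
    have := trig_prod (s.erase i) (fun j => sinhPoly (x j)) v
    rw [hc] at this
    simp only [trig_C_mul, this, trig_sinhPoly, Finset.prod_div_distrib]
    ring
  have hrd : r.natDegree ≤ d := by
    refine natDegree_sum_le_of_forall_le _ _ fun i hi => (natDegree_C_mul_le _ _).trans ?_
    have hc : (s.erase i).card = d := by rw [Finset.card_erase_of_mem hi, hs, Nat.add_sub_cancel]
    refine (natDegree_prod_le _ _).trans ((Finset.sum_le_card_nsmul _ _ 1 fun j _ => ?_).trans ?_)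
    · exact (natDegree_sinhPoly _).le
    · simp [hc]
  have h0 : p - r = 0 := by
    refine eq_zero_of_trig_roots (e := d) (d := d) ((natDegree_sub_le _ _).trans
      (max_le hp hrd)) s x hx (fun k hk => ?_) (by omega)
    rw [trig_sub, hr, Finset.sum_eq_single k]
    · rw [Finset.prod_eq_one, mul_one, sub_self]
      intro j hj
      refine div_self fun h => ?_
      rw [Finset.mem_erase] at hj
      exact hj.1 (hx hj.2 hk ((sinh_sub_eq_zero_iff _ _).1 h).symm)
    · intro i _ hik
      rw [Finset.prod_eq_zero (Finset.mem_erase.2 ⟨hik.symm, hk⟩), mul_zero]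
      simp
    · exact fun h => absurd hk h
  rw [← hr, ← sub_eq_zero, ← trig_sub, h0, trig_zero]

/-! ### Bethe vectors -/

lemma continuous_mono_apply (η : ℂ) (ξ : Fin N → ℂ) (i j : Fin 2) (s s' : Conf N) :
    Continuous fun u => mono η ξ u i j s s' := by
  obtain ⟨X, Y, ⟨p, -, hp, -⟩, -⟩ := gaugedTrig_monoList η ξ (List.finRange N).reverse
  have : (fun u => mono η ξ u i j s s') = fun u =>
      exp (-((((j : ℕ) : ℂ) - ((i : ℕ) : ℂ)) * u)) *
        trig (List.finRange N).reverse.length (p i j s s') u := by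
    funext u
    rw [← hp, ← mul_assoc, ← Complex.exp_add, neg_add_cancel, Complex.exp_zero, one_mul]
    rfl
  rw [this]
  exact (by fun_prop : Continuous fun u : ℂ =>
    exp (-((((j : ℕ) : ℂ) - ((i : ℕ) : ℂ)) * u))).mul (continuous_trig _ _)

/-- Two continuous vector-valued functions agree if they agree off the zeros of a nonzero
trigonometric polynomial. -/
lemma eq_of_forall_trig_ne_zero {ι : Type*} {d : ℕ} {p : ℂ[X]} (hp : p ≠ 0) {f g : ℂ → ι → ℂ}
    (hf : ∀ i, Continuous fun u => f u i) (hg : ∀ i, Continuous fun u => g u i)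
    (h : ∀ u, trig d p u ≠ 0 → f u = g u) (u : ℂ) : f u = g u :=
  funext fun i => congrFun (eq_of_mul_trig_eq hp (hf i) (hg i) fun v hv => congrFun (h v hv) i) u

lemma continuous_mono_mulVec (η : ℂ) (ξ : Fin N → ℂ) (i j : Fin 2) (v : Conf N → ℂ)
    (s : Conf N) : Continuous fun u => (mono η ξ u i j *ᵥ v) s :=
  continuous_finsetSum _ fun r _ => (continuous_mono_apply η ξ i j s r).mul continuous_const

/-- Where `sinh (u - v + η) = 0` the exchange relation does not give the commutation; that case
follows by continuity. -/
lemma commute_mono_B (η : ℂ) (ξ : Fin N → ℂ) (u v : ℂ) :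
    Commute (mono η ξ u 0 1) (mono η ξ v 0 1) := by
  have key : ∀ w, (mono η ξ u 0 1 * mono η ξ v 0 1) *ᵥ w =
      (mono η ξ v 0 1 * mono η ξ u 0 1) *ᵥ w := by
    intro w
    refine eq_of_forall_trig_ne_zero (d := 1) (sinhPoly_ne_zero (v - η))
      (f := fun u => (mono η ξ u 0 1 * mono η ξ v 0 1) *ᵥ w)
      (g := fun u => (mono η ξ v 0 1 * mono η ξ u 0 1) *ᵥ w) ?_ ?_ ?_ u
    · intro s
      simp only [← Matrix.mulVec_mulVec]
      exact continuous_mono_mulVec ..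
    · intro s
      simp only [← Matrix.mulVec_mulVec]
      exact continuous_finsetSum _ fun r _ => continuous_const.mul (continuous_mono_mulVec ..)
    · intro u hu
      rw [trig_sinhPoly, ← sub_add] at hu
      simp only [mono_B_mul_B η ξ u v hu]
  exact Matrix.toLin'.injective (LinearMap.ext key)

/-- The Bethe vector `∏ B(ξₙ)`, `n ∈ K`, applied to the reference state. -/
noncomputable def bethe (η : ℂ) (ξ : Fin N → ℂ) (K : Finset (Fin N)) : Conf N → ℂ :=
  K.noncommProd (fun n => mono η ξ (ξ n) 0 1) (fun _ _ _ _ _ => commute_mono_B ..) *ᵥ vac N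

section Bethe

variable {η : ℂ} {ξ : Fin N → ℂ}

@[simp] lemma bethe_empty : bethe η ξ ∅ = vac N := Matrix.one_mulVec _

lemma bethe_insert {K : Finset (Fin N)} {m : Fin N} (hm : m ∉ K) :
    bethe η ξ (insert m K) = mono η ξ (ξ m) 0 1 *ᵥ bethe η ξ K := by
  have h := Finset.noncommProd_insert_of_notMem (β := Op N) K m (fun n => mono η ξ (ξ n) 0 1)
    (fun _ _ _ _ _ => commute_mono_B ..) hm
  exact (congrArg (· *ᵥ vac N) h).trans (Matrix.mulVec_mulVec ..).symm

lemma mono_A_mulVec_mono_B (v : Conf N → ℂ) {u w : ℂ} (h : sinh (u - w) ≠ 0) :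
    mono η ξ u 0 0 *ᵥ mono η ξ w 0 1 *ᵥ v =
      (sinh (u - w - η) / sinh (u - w)) • mono η ξ w 0 1 *ᵥ mono η ξ u 0 0 *ᵥ v +
        (sinh η / sinh (u - w)) • mono η ξ u 0 1 *ᵥ mono η ξ w 0 0 *ᵥ v := by
  have h1 := congrArg (· *ᵥ v) (mono_A_mul_B η ξ u w)
  simp only [Matrix.add_mulVec, Matrix.smul_mulVec, ← Matrix.mulVec_mulVec] at h1
  rw [← smul_right_injective _ h |>.eq_iff]
  simp only [smul_add, smul_smul, mul_div_cancel₀ _ h]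
  exact h1

lemma mono_D_mulVec_mono_B (v : Conf N → ℂ) {u w : ℂ} (h : sinh (u - w) ≠ 0) :
    mono η ξ u 1 1 *ᵥ mono η ξ w 0 1 *ᵥ v =
      (sinh (u - w + η) / sinh (u - w)) • mono η ξ w 0 1 *ᵥ mono η ξ u 1 1 *ᵥ v -
        (sinh η / sinh (u - w)) • mono η ξ u 0 1 *ᵥ mono η ξ w 1 1 *ᵥ v := by
  have h1 := congrArg (· *ᵥ v) (mono_D_mul_B η ξ u w)
  simp only [Matrix.sub_mulVec, Matrix.smul_mulVec, ← Matrix.mulVec_mulVec] at h1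
  rw [← smul_right_injective _ h |>.eq_iff]
  simp only [smul_sub, smul_smul, mul_div_cancel₀ _ h]
  exact h1

/-- `D(u)` acts diagonally on the Bethe vectors because `d` vanishes at the inhomogeneities. -/
lemma mono_D_mulVec_bethe_of_ne (hξ : Inhomogeneous η ξ) (K : Finset (Fin N)) {u : ℂ}
    (hu : ∀ b ∈ K, sinh (u - ξ b) ≠ 0) :
    mono η ξ u 1 1 *ᵥ bethe η ξ K =
      (dFun ξ u * ∏ b ∈ K, sinh (u - ξ b + η) / sinh (u - ξ b)) • bethe η ξ K := by
  induction K using Finset.induction_on generalizing u with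
  | empty => simp [mono_D_mulVec_vac]
  | insert m K hm ih =>
    rw [bethe_insert hm, mono_D_mulVec_mono_B _ (hu m (Finset.mem_insert_self _ _)),
      ih fun b hb => hu b (Finset.mem_insert_of_mem hb),
      ih fun b hb => hξ.sinh_sub_ne_zero (ne_of_mem_of_not_mem hb hm).symm, dFun_self, zero_mul,
      zero_smul, Matrix.mulVec_zero, smul_zero, sub_zero, Matrix.mulVec_smul, smul_smul,
      Finset.prod_insert hm]
    congr 1
    ring

/-- The action of `A(u)`, with the unwanted terms left in the form `B(u) Φ_J`, where `J` is `K`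
without one label. In the induction the two contributions to each of them combine by
`sinh_add_mul_sinh_add`. -/
lemma mono_A_mulVec_bethe (hξ : Inhomogeneous η ξ) (K : Finset (Fin N)) {u : ℂ}
    (hu : ∀ b ∈ K, sinh (u - ξ b) ≠ 0) :
    mono η ξ u 0 0 *ᵥ bethe η ξ K =
      (aFun η ξ u * ∏ b ∈ K, sinh (u - ξ b - η) / sinh (u - ξ b)) • bethe η ξ K +
        ∑ k ∈ K, (sinh η / sinh (u - ξ k) * aFun η ξ (ξ k) *
          ∏ b ∈ K.erase k, sinh (ξ k - ξ b - η) / sinh (ξ k - ξ b)) •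
            mono η ξ u 0 1 *ᵥ bethe η ξ (K.erase k) := by
  induction K using Finset.induction_on generalizing u with
  | empty => simp [mono_A_mulVec_vac]
  | insert m K hm ih =>
    have hum := hu m (Finset.mem_insert_self _ _)
    have huK : ∀ b ∈ K, sinh (u - ξ b) ≠ 0 := fun b hb => hu b (Finset.mem_insert_of_mem hb)
    have hmK : ∀ b ∈ K, m ≠ b := fun b hb => (ne_of_mem_of_not_mem hb hm).symm
    have hsum : ∑ k ∈ K, (sinh η / sinh (u - ξ k) * aFun η ξ (ξ k) *
          ∏ b ∈ (insert m K).erase k, sinh (ξ k - ξ b - η) / sinh (ξ k - ξ b)) •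
            mono η ξ u 0 1 *ᵥ bethe η ξ ((insert m K).erase k) =
        (sinh (u - ξ m - η) / sinh (u - ξ m)) • mono η ξ (ξ m) 0 1 *ᵥ
          ∑ k ∈ K, (sinh η / sinh (u - ξ k) * aFun η ξ (ξ k) *
            ∏ b ∈ K.erase k, sinh (ξ k - ξ b - η) / sinh (ξ k - ξ b)) •
              mono η ξ u 0 1 *ᵥ bethe η ξ (K.erase k) +
        (sinh η / sinh (u - ξ m)) • mono η ξ u 0 1 *ᵥ
          ∑ k ∈ K, (sinh η / sinh (ξ m - ξ k) * aFun η ξ (ξ k) *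
            ∏ b ∈ K.erase k, sinh (ξ k - ξ b - η) / sinh (ξ k - ξ b)) •
              mono η ξ (ξ m) 0 1 *ᵥ bethe η ξ (K.erase k) := by
      rw [Matrix.mulVec_sum, Matrix.mulVec_sum, Finset.smul_sum, Finset.smul_sum,
        ← Finset.sum_add_distrib]
      refine Finset.sum_congr rfl fun k hk => ?_
      have hmk : m ∉ K.erase k := fun h => hm (Finset.mem_of_mem_erase h)
      have h1 := huK k hk
      have h2 := hξ.sinh_sub_ne_zero (hmK k hk)
      have h3 : sinh (ξ k - ξ m) = -sinh (ξ m - ξ k) := by rw [← Complex.sinh_neg, neg_sub]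
      rw [Finset.erase_insert_of_ne (hmK k hk), Finset.prod_insert hmk, bethe_insert hmk,
        Matrix.mulVec_smul, Matrix.mulVec_smul, Matrix.mulVec_mulVec, Matrix.mulVec_mulVec,
        (commute_mono_B η ξ (ξ m) u).eq, smul_smul, smul_smul, ← add_smul]
      congr 1
      have h4 : -sinh (ξ k - ξ m - η) * sinh (u - ξ m) =
          sinh (u - ξ k) * sinh η + sinh (ξ m - ξ k) * sinh (u - ξ m - η) := by
        have := sinh_add_mul_sinh_add (ξ m - ξ k) (u - ξ m - η) η
        rwa [sub_add_cancel, show ξ m - ξ k + (u - ξ m - η) + η = u - ξ k by ring,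
          show ξ m - ξ k + η = -(ξ k - ξ m - η) by ring, Complex.sinh_neg] at this
      rw [h3]
      field_simp
      linear_combination (sinh η * aFun η ξ (ξ k) *
        ∏ b ∈ K.erase k, sinh (ξ k - ξ b - η) / sinh (ξ k - ξ b)) * h4
    rw [bethe_insert hm, mono_A_mulVec_mono_B _ hum, ih huK,
      ih fun b hb => hξ.sinh_sub_ne_zero (hmK b hb), Finset.sum_insert hm, hsum,
      Finset.prod_insert hm, Finset.erase_insert hm, Matrix.mulVec_add, Matrix.mulVec_add,
      smul_add, smul_add, Matrix.mulVec_smul, Matrix.mulVec_smul, smul_smul, smul_smul]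
    rw [show aFun η ξ u * (sinh (u - ξ m - η) / sinh (u - ξ m) *
      ∏ b ∈ K, sinh (u - ξ b - η) / sinh (u - ξ b)) = sinh (u - ξ m - η) / sinh (u - ξ m) *
        (aFun η ξ u * ∏ b ∈ K, sinh (u - ξ b - η) / sinh (u - ξ b)) by ring,
      ← mul_assoc (sinh η / sinh (u - ξ m)) (aFun η ξ (ξ m))]
    abel

/-- `D(u)` acts diagonally on the Bethe vectors, with eigenvalues free of denominators. -/
lemma mono_D_mulVec_bethe (hξ : Inhomogeneous η ξ) (K : Finset (Fin N)) (u : ℂ) :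
    mono η ξ u 1 1 *ᵥ bethe η ξ K =
      ((∏ m ∈ Kᶜ, sinh (u - ξ m)) * ∏ b ∈ K, sinh (u - ξ b + η)) • bethe η ξ K := by
  refine eq_of_forall_trig_ne_zero (d := N) (dPoly_ne_zero ξ)
    (f := fun u => mono η ξ u 1 1 *ᵥ bethe η ξ K)
    (g := fun u => ((∏ m ∈ Kᶜ, sinh (u - ξ m)) * ∏ b ∈ K, sinh (u - ξ b + η)) • bethe η ξ K)
    (fun s => continuous_mono_mulVec ..) (fun s => ?_) (fun u hu => ?_) u
  · simp only [Pi.smul_apply, smul_eq_mul]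
    fun_prop
  · rw [trig_dPoly] at hu
    have hu' : ∀ b, sinh (u - ξ b) ≠ 0 := fun b =>
      Finset.prod_ne_zero_iff.1 hu b (Finset.mem_univ b)
    simp only [mono_D_mulVec_bethe_of_ne hξ K fun b _ => hu' b]
    congr 1
    rw [dFun, ← Finset.prod_compl_mul_prod K, Finset.prod_div_distrib, mul_assoc,
      mul_div_cancel₀ _ (Finset.prod_ne_zero_iff.2 fun b _ => hu' b)]

lemma downs_of_bethe_ne_zero (K : Finset (Fin N)) (s : Conf N) (h : bethe η ξ K s ≠ 0) :
    downs s = K.card := by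
  induction K using Finset.induction_on generalizing s with
  | empty =>
    rw [bethe_empty, vac, Pi.single_apply] at h
    split_ifs at h with hs
    · simp [hs, downs]
    · exact absurd rfl h
  | insert m K hm ih =>
    rw [bethe_insert hm, Matrix.mulVec, dotProduct] at h
    obtain ⟨r, -, hr⟩ := Finset.exists_ne_zero_of_sum_ne_zero h
    have h1 := downs_of_monoList_ne_zero (left_ne_zero_of_mul hr)
    rw [ih r (right_ne_zero_of_mul hr)] at h1
    rw [Finset.card_insert_of_notMem hm]
    simpa [add_comm] using h1

/-- Bethe vectors at distinct inhomogeneities do not vanish: by the quantum determinant identity,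
`C(ξₘ - η)` undoes the action of `B(ξₘ)`. -/
lemma bethe_ne_zero (hξ : Inhomogeneous η ξ) (hs : sinh η ≠ 0) (K : Finset (Fin N)) :
    bethe η ξ K ≠ 0 := by
  induction K using Finset.induction_on with
  | empty => exact fun h => one_ne_zero (α := ℂ) (by simpa [vac] using congrFun h 0)
  | insert m K hm ih =>
    intro h
    have hq := congrArg (· *ᵥ bethe η ξ K) (mono_A_mul_D_sub_C_mul_B η ξ (ξ m))
    have hD : mono η ξ (ξ m) 1 1 *ᵥ bethe η ξ K = 0 := by
      rw [mono_D_mulVec_bethe hξ, Finset.prod_eq_zero (Finset.mem_compl.2 hm) (by simp), zero_mul,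
        zero_smul]
    simp only [Matrix.sub_mulVec, ← Matrix.mulVec_mulVec, hD, ← bethe_insert hm, h,
      Matrix.mulVec_zero, sub_zero, Matrix.smul_mulVec, Matrix.one_mulVec] at hq
    exact (smul_ne_zero (mul_ne_zero (aFun_self_ne_zero hξ hs m) (dFun_self_sub_ne_zero hξ hs m))
      ih) hq.symm

lemma mono_B_mulVec_bethe_self_sub {K : Finset (Fin N)} {b : Fin N} (hb : b ∈ K) :
    mono η ξ (ξ b - η) 0 1 *ᵥ bethe η ξ K = 0 := by
  rw [← Finset.insert_erase hb, bethe_insert (Finset.notMem_erase b K), Matrix.mulVec_mulVec,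
    (commute_mono_B ..).eq, mono_B_mul_B_self, Matrix.zero_mulVec]

/-- Expansion of `B(u) Φ_K` in Bethe vectors, by interpolation in `u` at the points `ξₙ`, `n ∉ K`,
and at the points `ξ_b - η`, `b ∈ K`, where it vanishes. -/
lemma mono_B_mulVec_bethe (hN : 1 ≤ N) (hξ : Inhomogeneous η ξ) (hs : sinh η ≠ 0)
    (K : Finset (Fin N)) {u : ℂ} :
    mono η ξ u 0 1 *ᵥ bethe η ξ K = ∑ n ∈ Kᶜ,
      ((∏ m ∈ Kᶜ.erase n, sinh (u - ξ m) / sinh (ξ n - ξ m)) *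
        ∏ b ∈ K, sinh (u - ξ b + η) / sinh (ξ n - ξ b + η)) • bethe η ξ (insert n K) := by
  classical
  obtain ⟨p, hpd, hp⟩ := exists_trig_mono_B hN η ξ
  ext s
  have hB : ∀ v, (mono η ξ v 0 1 *ᵥ bethe η ξ K) s =
      trig (N - 1) (∑ r, C (bethe η ξ K r) * p s r) v := fun v => by
    rw [trig_sum]
    exact Finset.sum_congr rfl fun r _ => by
      rw [trig_C_mul, ← hp, mul_comm]
  have hcard : (Kᶜ.disjSum K).card = N - 1 + 1 := by
    rw [Finset.card_disjSum, add_comm, Finset.card_add_card_compl, Fintype.card_fin]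
    omega
  rw [hB, trig_eq_sum_interpolation (natDegree_sum_le_of_forall_le _ _ fun r _ =>
    (natDegree_C_mul_le _ _).trans (hpd _ _)) (Kᶜ.disjSum K) (node η ξ)
    (node_injective hξ hs).injOn hcard, Finset.sum_disjSum, Finset.sum_apply]
  rw [Finset.sum_eq_zero (s := K), add_zero]
  · refine Finset.sum_congr rfl fun n hn => ?_
    have he : (Kᶜ.disjSum K).erase (Sum.inl n) = (Kᶜ.erase n).disjSum K := by
      ext (x | x) <;> simp
    rw [he, Finset.prod_disjSum, ← hB, Pi.smul_apply, bethe_insert (Finset.mem_compl.1 hn),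
      smul_eq_mul, mul_comm]
    simp only [node, Sum.elim_inl, Sum.elim_inr, sub_sub_eq_add_sub, sub_add_eq_add_sub]
  · intro b hb
    rw [← hB, show node η ξ (Sum.inr b) = ξ b - η from rfl, mono_B_mulVec_bethe_self_sub hb,
      Pi.zero_apply, zero_mul]

end Bethe

end

/-! ### Minors of the linear system for the Baxter equation -/

section

variable {N : ℕ}

/-- A matrix whose columns are independent has a nonzero maximal minor. -/
lemma exists_det_submatrix_ne_zero {M : ℕ} (E : Matrix (Fin N) (Fin M) ℂ)
    (h : ∀ c, E *ᵥ c = 0 → c = 0) : ∃ j : Fin M → Fin N, (E.submatrix j id).det ≠ 0 := by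
  have hr : Module.finrank ℂ (Submodule.span ℂ (Set.range E.row)) = M := by
    rw [← Matrix.rank_eq_finrank_span_row, Matrix.rank, LinearMap.finrank_range_of_inj]
    · simp
    · rw [← LinearMap.ker_eq_bot, LinearMap.ker_eq_bot']
      exact h
  obtain ⟨f, hf, -, hli⟩ := Submodule.exists_fun_fin_finrank_span_eq ℂ (Set.range E.row)
  choose g hg using hf
  refine ⟨g ∘ Fin.cast hr.symm, ?_⟩
  have hli' : LinearIndependent ℂ (E.submatrix (g ∘ Fin.cast hr.symm) id).row := by
    have : (E.submatrix (g ∘ Fin.cast hr.symm) id).row = f ∘ Fin.cast hr.symm := by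
      funext i
      exact hg (Fin.cast hr.symm i)
    rw [this]
    exact hli.comp _ (Fin.cast_injective _)
  exact ((Matrix.isUnit_iff_isUnit_det _).1
    (Matrix.linearIndependent_rows_iff_isUnit.1 hli')).ne_zero

/-- The product of `θ (j a) (j b)` over the pairs `a < b`. -/
def pairProd {M : ℕ} (θ : Fin N → Fin N → ℂ) (j : Fin M → Fin N) : ℂ :=
  ∏ a, ∏ b ∈ Finset.Ioi a, θ (j a) (j b)

/-- The dependence of an antisymmetric pair product on one label, up to a factor that does not
involve that label. -/
lemma exists_pairProd_update {M : ℕ} {θ : Fin N → Fin N → ℂ} (hθ : ∀ x y, θ x y = -θ y x)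
    (j : Fin M → Fin N) (a : Fin M) :
    ∃ c, ∀ k, pairProd θ (Function.update j a k) = c * ∏ b ∈ Finset.univ.erase a, θ k (j b) := by
  refine ⟨(∏ b ∈ Finset.univ.erase a, if a < b then 1 else if b < a then -1 else 1) *
    ∏ b ∈ Finset.univ.erase a, ∏ c ∈ Finset.univ.erase a, if b < c then θ (j b) (j c) else 1,
    fun k => ?_⟩
  have h1 : ∀ j : Fin M → Fin N, pairProd θ j = ∏ b, ∏ c, if b < c then θ (j b) (j c) else 1 :=
    fun j => Finset.prod_congr rfl fun b _ => by
      rw [Finset.prod_ite, Finset.prod_const_one, mul_one]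
      exact Finset.prod_congr (by ext; simp) fun _ _ => rfl
  have h2 : ∀ b ∈ Finset.univ.erase a, Function.update j a k b = j b := fun b hb =>
    Function.update_of_ne (Finset.ne_of_mem_erase hb) _ _
  rw [h1, ← Finset.mul_prod_erase _ _ (Finset.mem_univ a),
    ← Finset.mul_prod_erase _ _ (Finset.mem_univ a)]
  have h3 : ∏ b ∈ Finset.univ.erase a, ∏ c, (if b < c then
      θ (Function.update j a k b) (Function.update j a k c) else 1) =
      (∏ b ∈ Finset.univ.erase a, if b < a then θ (j b) k else 1) *
        ∏ b ∈ Finset.univ.erase a, ∏ c ∈ Finset.univ.erase a,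
          if b < c then θ (j b) (j c) else 1 := by
    rw [← Finset.prod_mul_distrib]
    refine Finset.prod_congr rfl fun b hb => ?_
    rw [← Finset.mul_prod_erase _ _ (Finset.mem_univ a), h2 b hb, Function.update_self]
    congr 1
    exact Finset.prod_congr rfl fun c hc => by rw [h2 c hc]
  rw [h3, if_neg (lt_irrefl a), one_mul, ← mul_assoc, mul_right_comm _ (∏ b ∈ _, ∏ c ∈ _, _)]
  congr 1
  rw [← Finset.prod_mul_distrib, ← Finset.prod_mul_distrib]
  refine Finset.prod_congr rfl fun b hb => ?_
  rw [h2 b hb, Function.update_self]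
  rcases lt_trichotomy a b with h | h | h
  · simp [h, h.not_gt]
  · exact absurd h.symm (Finset.ne_of_mem_erase hb)
  · simp [h, h.not_gt, hθ (j b) k]

section

variable (η α : ℂ) (ξ : Fin N → ℂ) (M : ℕ) (P : ℂ[X])

/-- The matrix of the linear map that sends a polynomial of degree less than `M` to the values of
its image under the Baxter operator at the inhomogeneities. -/
noncomputable def baxterMatrix : Matrix (Fin N) (Fin M) ℂ := Matrix.of fun n i =>
  trig (N + M) (baxter η α ξ M P (X ^ (i : ℕ))) (ξ n)

lemma trig_baxter_sum (c : Fin M → ℂ) (n : Fin N) :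
    trig (N + M) (baxter η α ξ M P (∑ i, C (c i) * X ^ (i : ℕ))) (ξ n) =
      (baxterMatrix η α ξ M P *ᵥ c) n := by
  rw [map_sum, trig_sum]
  refine Finset.sum_congr rfl fun i _ => ?_
  rw [← smul_eq_C_mul, map_smul, smul_eq_C_mul, trig_C_mul, mul_comm]
  rfl

/-- The polynomial whose image under the Baxter operator vanishes at `ξ (j b)`, `b ≠ a`, and takes
as value at `ξ (j a)` the minor with rows `j`. -/
noncomputable def cofactorPoly (j : Fin M → Fin N) (a : Fin M) : ℂ[X] :=
  ∑ i, C (((baxterMatrix η α ξ M P).submatrix j id)ᵀ.adjugate a i) * X ^ (i : ℕ)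

/-- The minor of `baxterMatrix` with rows `j`. -/
noncomputable def minor (j : Fin M → Fin N) : ℂ :=
  ((baxterMatrix η α ξ M P).submatrix j id).det

variable {M}

lemma minor_eq_zero {j : Fin M → Fin N} {a b : Fin M} (hab : a ≠ b) (h : j a = j b) :
    minor η α ξ M P j = 0 :=
  Matrix.det_zero_of_row_eq hab (by ext i; simp [h])

lemma natDegree_cofactorPoly_le (j : Fin M → Fin N) (a : Fin M) :
    (cofactorPoly η α ξ M P j a).natDegree ≤ M :=
  natDegree_sum_le_of_forall_le _ _ fun i _ => (natDegree_C_mul_X_pow_le _ _).trans i.2.le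

/-- Expansion of the minor along the row `a`. -/
lemma trig_baxter_cofactorPoly (j : Fin M → Fin N) (a : Fin M) (n : Fin N) :
    trig (N + M) (baxter η α ξ M P (cofactorPoly η α ξ M P j a)) (ξ n) =
      minor η α ξ M P (Function.update j a n) := by
  rw [cofactorPoly, trig_baxter_sum, minor]
  have h1 : (baxterMatrix η α ξ M P).submatrix (Function.update j a n) id =
      ((baxterMatrix η α ξ M P).submatrix j id).updateRow a (baxterMatrix η α ξ M P n) := by
    ext b i
    rcases eq_or_ne b a with rfl | hb
    · simp
    · simp [hb]
  rw [h1, ← Matrix.cramer_transpose_apply, Matrix.cramer_eq_adjugate_mulVec]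
  exact dotProduct_comm _ _

/-- Cramer's rule: modulo a monic solution `q` of the Baxter equation, every polynomial of degree at
most `M` is a combination of the polynomials `cofactorPoly`. -/
lemma sum_C_mul_cofactorPoly {q σ : ℂ[X]} (hq : q.Monic) (hqM : q.natDegree = M)
    (hb : baxter η α ξ M P q = 0) (hσ : σ.natDegree ≤ M) (j : Fin M → Fin N) :
    ∑ a, C (trig (N + M) (baxter η α ξ M P σ) (ξ (j a))) * cofactorPoly η α ξ M P j a =
      C (minor η α ξ M P j) * (σ - C (σ.coeff M) * q) := by
  set τ := σ - C (σ.coeff M) * q with hτ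
  have hτM : τ.natDegree ≤ M :=
    (natDegree_sub_le _ _).trans (max_le hσ ((natDegree_C_mul_le _ _).trans hqM.le))
  have hτ0 : τ.coeff M = 0 := by
    have : q.coeff M = 1 := by rw [← hqM]; exact hq
    rw [hτ, coeff_sub, coeff_C_mul, this, mul_one, sub_self]
  have hτs : τ = ∑ i : Fin M, C (τ.coeff i) * X ^ (i : ℕ) := by
    conv_lhs => rw [as_sum_range_C_mul_X_pow' τ (Nat.lt_succ_of_le hτM)]
    rw [Finset.sum_range_succ, hτ0, C_0, zero_mul, add_zero,
      Finset.sum_range fun i => C (τ.coeff i) * X ^ i]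
  have hE : ∀ n, trig (N + M) (baxter η α ξ M P σ) (ξ n) =
      (baxterMatrix η α ξ M P *ᵥ fun i => τ.coeff i) n := by
    intro n
    rw [← trig_baxter_sum, ← hτs, hτ, map_sub, ← smul_eq_C_mul, map_smul, hb, smul_zero, sub_zero]
  set A := (baxterMatrix η α ξ M P).submatrix j id with hA
  have hv : A.adjugate *ᵥ (A *ᵥ fun i => τ.coeff i) = A.det • fun i : Fin M => τ.coeff i := by
    rw [Matrix.mulVec_mulVec, Matrix.adjugate_mul, Matrix.smul_mulVec, Matrix.one_mulVec]
  have h1 : ∑ a, C (trig (N + M) (baxter η α ξ M P σ) (ξ (j a))) * cofactorPoly η α ξ M P j a =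
      ∑ i : Fin M, C ((A.adjugate *ᵥ (A *ᵥ fun i => τ.coeff i)) i) * X ^ (i : ℕ) := by
    simp only [cofactorPoly, Finset.mul_sum, ← mul_assoc, ← C_mul, ← hA]
    rw [Finset.sum_comm]
    refine Finset.sum_congr rfl fun i _ => ?_
    rw [← Finset.sum_mul, ← map_sum]
    congr 2
    refine Finset.sum_congr rfl fun a _ => ?_
    rw [hE, ← Matrix.adjugate_transpose, Matrix.transpose_apply, mul_comm]
    rfl
  rw [h1, hv]
  conv_rhs => rw [hτs]
  rw [Finset.mul_sum, minor, ← hA]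
  exact Finset.sum_congr rfl fun i _ => by rw [Pi.smul_apply, smul_eq_mul, C_mul, mul_assoc]

end

/-- The Lagrange basis function of the node `ξₙ`. -/
noncomputable def lag (ξ : Fin N → ℂ) (n : Fin N) (u : ℂ) : ℂ :=
  ∏ m ∈ Finset.univ.erase n, sinh (u - ξ m) / sinh (ξ n - ξ m)

section

variable {η α : ℂ} {ξ : Fin N → ℂ} {M : ℕ} {P : ℂ[X]}

/-- The image of `cofactorPoly` under the Baxter operator, interpolated at the inhomogeneities and
at the points `ξ (j b) - η`, `b ≠ a`, where it vanishes by the fusion relation. -/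
lemma IsSpectral.trig_baxter_cofactorPoly_eq_sum (h : IsSpectral η α ξ M P)
    (hξ : Inhomogeneous η ξ) (hs : sinh η ≠ 0) {j : Fin M → Fin N} (hj : Function.Injective j)
    (a : Fin M) (u : ℂ) :
    trig (N + M) (baxter η α ξ M P (cofactorPoly η α ξ M P j a)) u =
      ∑ k, minor η α ξ M P (Function.update j a k) * (lag ξ k u *
        ∏ b ∈ Finset.univ.erase a, sinh (u - ξ (j b) + η) / sinh (ξ k - ξ (j b) + η)) := by
  classical
  have hN : 1 ≤ N := (Nat.zero_le _).trans_lt (j a).2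
  have hM : 1 ≤ M := (Nat.zero_le _).trans_lt a.2
  set f := cofactorPoly η α ξ M P j a
  have hf := natDegree_cofactorPoly_le η α ξ P j a
  obtain ⟨g, hg⟩ := X_dvd_iff.2 (h.baxter_coeff_zero f)
  have hgd : g.natDegree ≤ N + M - 2 := by
    by_contra hlt
    have hg0 : g ≠ 0 := fun h0 => hlt (by simp [h0])
    have h1 := natDegree_baxter_le η α ξ M h.natDegree_le hf
    have h2 := h.baxter_coeff_top hf
    rw [hg, natDegree_X_mul hg0] at h1
    have h3 : N + M = g.natDegree + 1 := by omega
    rw [hg, h3, coeff_X_mul] at h2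
    exact hg0 (leadingCoeff_eq_zero.1 h2)
  have htr : ∀ v, trig (N + M) (baxter η α ξ M P f) v = trig (N + M - 2) g v := fun v => by
    have := trig_add_two (N + M - 2) g v
    rwa [show N + M - 2 + 2 = N + M by omega, ← hg] at this
  set J := (Finset.univ.erase a).image j with hJ
  have hcard : ((Finset.univ : Finset (Fin N)).disjSum J).card = N + M - 2 + 1 := by
    rw [Finset.card_disjSum, hJ, Finset.card_image_of_injective _ hj,
      Finset.card_erase_of_mem (Finset.mem_univ a)]
    simp only [Finset.card_univ, Fintype.card_fin]
    omega
  rw [htr, trig_eq_sum_interpolation hgd _ (node η ξ) (node_injective hξ hs).injOn hcard,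
    Finset.sum_disjSum]
  have hval : ∀ k, trig (N + M) (baxter η α ξ M P f) (ξ k) =
    minor η α ξ M P (Function.update j a k) := trig_baxter_cofactorPoly η α ξ P j a
  rw [Finset.sum_eq_zero (s := J), add_zero]
  · refine Finset.sum_congr rfl fun k _ => ?_
    have he : ((Finset.univ : Finset (Fin N)).disjSum J).erase (Sum.inl k) =
        (Finset.univ.erase k).disjSum J := by
      ext (x | x) <;> simp
    rw [← htr, show node η ξ (Sum.inl k) = ξ k from rfl, hval, he, Finset.prod_disjSum, hJ,
      Finset.prod_image hj.injOn]
    simp only [node, Sum.elim_inl, Sum.elim_inr, sub_sub_eq_add_sub, sub_add_eq_add_sub, lag]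
  · intro k hk
    obtain ⟨b, hb, rfl⟩ := Finset.mem_image.1 hk
    rw [← htr, show node η ξ (Sum.inr (j b)) = ξ (j b) - η from rfl,
      h.trig_baxter_self_sub hξ hs, zero_mul]
    rw [hval]
    have hba := Finset.ne_of_mem_erase hb
    exact minor_eq_zero η α ξ P hba (by simp [hba])

end

end

/-! ### The transfer matrix on Bethe vectors, and the amplitudes -/

section

variable {N : ℕ}

section

variable (η α : ℂ) (ξ : Fin N → ℂ) {M : ℕ}

/-- The coefficient with which the transfer matrix at `u` moves the Bethe vector with labels `x`
and `j b`, `b ≠ a`, to the one with labels `n` and `j b`, `b ≠ a`. -/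
noncomputable def hop (u : ℂ) (j : Fin M → Fin N) (a : Fin M) (x n : Fin N) : ℂ :=
  exp α * (sinh η / sinh (u - ξ x) * aFun η ξ (ξ x)) * lag ξ n u *
    ∏ b ∈ Finset.univ.erase a, sinh (ξ x - ξ (j b) - η) / sinh (ξ x - ξ (j b)) *
      (sinh (ξ n - ξ (j b)) / sinh (u - ξ (j b)) *
        (sinh (u - ξ (j b) + η) / sinh (ξ n - ξ (j b) + η)))

/-- The coefficient of a Bethe vector in its image under the transfer matrix at `u`. -/
noncomputable def diagCoeff (u : ℂ) (j : Fin M → Fin N) : ℂ :=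
  exp α * (aFun η ξ u * ∏ b, sinh (u - ξ (j b) - η) / sinh (u - ξ (j b))) +
    exp (-α) * (dFun ξ u * ∏ b, sinh (u - ξ (j b) + η) / sinh (u - ξ (j b)))

lemma hop_update (u : ℂ) (j : Fin M → Fin N) (a : Fin M) (k x n : Fin N) :
    hop η α ξ u (Function.update j a k) a x n = hop η α ξ u j a x n := by
  unfold hop
  congr 1
  exact Finset.prod_congr rfl fun b hb => by
    rw [Function.update_of_ne (Finset.ne_of_mem_erase hb)]

variable {η ξ}

/-- The unwanted terms of `A(u)`, expanded in Bethe vectors by `mono_B_mulVec_bethe`; `D(u)` acts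
diagonally. -/
lemma transfer_mulVec_bethe (hξ : Inhomogeneous η ξ) (hs : sinh η ≠ 0) {u : ℂ}
    (hu : ∀ n, sinh (u - ξ n) ≠ 0) {j : Fin M → Fin N} (hj : Function.Injective j) :
    transfer η α ξ u *ᵥ bethe η ξ (Finset.univ.image j) =
      diagCoeff η α ξ u j • bethe η ξ (Finset.univ.image j) +
        ∑ a, ∑ n, if n ∈ (Finset.univ.erase a).image j then 0 else
          hop η α ξ u j a (j a) n • bethe η ξ (Finset.univ.image (Function.update j a n)) := by
  have hK : ∀ a, (Finset.univ.image j).erase (j a) = (Finset.univ.erase a).image j := fun a =>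
    (Finset.image_erase hj _ _).symm
  have hI : ∀ a n, Finset.univ.image (Function.update j a n) =
      insert n ((Finset.univ.erase a).image j) := by
    intro a n
    rw [← Finset.insert_erase (Finset.mem_univ a), Finset.image_insert, Function.update_self,
      Finset.insert_erase (Finset.mem_univ a)]
    congr 1
    exact Finset.image_congr fun b hb => Function.update_of_ne
      (Finset.ne_of_mem_erase (Finset.mem_coe.1 hb)) _ _
  rw [transfer_eq, Matrix.add_mulVec, Matrix.smul_mulVec, Matrix.smul_mulVec,
    mono_A_mulVec_bethe hξ _ fun b _ => hu b, mono_D_mulVec_bethe_of_ne hξ _ fun b _ => hu b,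
    Finset.prod_image hj.injOn, Finset.prod_image hj.injOn, Finset.sum_image hj.injOn, smul_add,
    smul_smul, smul_smul, add_right_comm, ← add_smul, ← diagCoeff]
  congr 1
  rw [Finset.smul_sum]
  refine Finset.sum_congr rfl fun a _ => ?_
  have hN : 1 ≤ N := (Nat.zero_le _).trans_lt (j a).2
  rw [hK, mono_B_mulVec_bethe hN hξ hs, smul_smul, Finset.smul_sum, Finset.prod_image hj.injOn]
  set K := (Finset.univ.erase a).image j with hKdef
  rw [← Finset.sum_subset (Finset.subset_univ Kᶜ) fun n _ hn => if_pos (by simpa using hn)]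
  refine Finset.sum_congr rfl fun n hn => ?_
  rw [if_neg (Finset.mem_compl.1 hn), hI, smul_smul]
  congr 1
  have hnK : ∀ b ∈ Finset.univ.erase a, sinh (ξ n - ξ (j b)) ≠ 0 := fun b hb =>
    hξ.sinh_sub_ne_zero fun h => Finset.mem_compl.1 hn (h ▸ Finset.mem_image_of_mem j hb)
  have hlag : lag ξ n u = (∏ m ∈ Kᶜ.erase n, sinh (u - ξ m) / sinh (ξ n - ξ m)) *
      ∏ b ∈ Finset.univ.erase a, sinh (u - ξ (j b)) / sinh (ξ n - ξ (j b)) := by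
    rw [lag, ← Finset.prod_image (g := j) (f := fun m => sinh (u - ξ m) / sinh (ξ n - ξ m))
      hj.injOn, ← hKdef, ← Finset.prod_union]
    · refine Finset.prod_congr ?_ fun _ _ => rfl
      ext m
      have : m ∈ K → m ≠ n := fun hm h => Finset.mem_compl.1 hn (h ▸ hm)
      simp only [Finset.mem_erase, Finset.mem_univ, Finset.mem_union, Finset.mem_compl]
      tauto
    · exact Finset.disjoint_left.2 fun m hm => Finset.mem_compl.1 (Finset.mem_of_mem_erase hm)
  have hinv : (∏ b ∈ Finset.univ.erase a, sinh (u - ξ (j b)) / sinh (ξ n - ξ (j b))) *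
      ∏ b ∈ Finset.univ.erase a, sinh (ξ n - ξ (j b)) / sinh (u - ξ (j b)) = 1 := by
    rw [← Finset.prod_mul_distrib]
    refine Finset.prod_eq_one fun b hb => ?_
    have h1 := hnK b hb
    have h2 := hu (j b)
    field_simp
  have hKp : ∏ b ∈ K, sinh (u - ξ b + η) / sinh (ξ n - ξ b + η) =
      ∏ b ∈ Finset.univ.erase a, sinh (u - ξ (j b) + η) / sinh (ξ n - ξ (j b) + η) :=
    Finset.prod_image hj.injOn
  rw [hop, hlag, hKp, Finset.prod_mul_distrib, Finset.prod_mul_distrib]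
  linear_combination (-exp α * (sinh η / sinh (u - ξ (j a)) * aFun η ξ (ξ (j a)) *
    ∏ b ∈ Finset.univ.erase a, sinh (ξ (j a) - ξ (j b) - η) / sinh (ξ (j a) - ξ (j b))) *
      ((∏ m ∈ Kᶜ.erase n, sinh (u - ξ m) / sinh (ξ n - ξ m)) *
        ∏ b ∈ Finset.univ.erase a, sinh (u - ξ (j b) + η) / sinh (ξ n - ξ (j b) + η))) * hinv

end

section

variable {η α : ℂ} {ξ : Fin N → ℂ} {M : ℕ} {P : ℂ[X]}

/-- The antisymmetric weight of a pair of sites. -/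
noncomputable def pairWeight (η : ℂ) (ξ : Fin N → ℂ) (x y : Fin N) : ℂ :=
  sinh (ξ x - ξ y) / (sinh (ξ x - ξ y + η) * sinh (ξ x - ξ y - η))

lemma pairWeight_antisymm (x y : Fin N) : pairWeight η ξ x y = -pairWeight η ξ y x := by
  unfold pairWeight
  rw [show ξ y - ξ x = -(ξ x - ξ y) by ring, show -(ξ x - ξ y) + η = -(ξ x - ξ y - η) by ring,
    show -(ξ x - ξ y) - η = -(ξ x - ξ y + η) by ring, Complex.sinh_neg, Complex.sinh_neg,
    Complex.sinh_neg, neg_mul_neg, neg_div, neg_neg, mul_comm (sinh (ξ x - ξ y + η))]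

/-- The weight of a site. -/
noncomputable def siteWeight (η : ℂ) (ξ : Fin N → ℂ) (n : Fin N) : ℂ :=
  (aFun η ξ (ξ n) * ∏ m ∈ Finset.univ.erase n, sinh (ξ n - ξ m))⁻¹

/-- The coefficient of the Bethe vector with labels `j` in the eigenvector. -/
noncomputable def amplitude (η α : ℂ) (ξ : Fin N → ℂ) (M : ℕ) (P : ℂ[X]) (j : Fin M → Fin N) : ℂ :=
  minor η α ξ M P j * pairProd (pairWeight η ξ) j * ∏ a, siteWeight η ξ (j a)

lemma amplitude_eq_zero {j : Fin M → Fin N} (hj : ¬Function.Injective j) :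
    amplitude η α ξ M P j = 0 := by
  simp only [Function.Injective, not_forall] at hj
  obtain ⟨a, b, hab, hne⟩ := hj
  rw [amplitude, minor_eq_zero η α ξ P hne hab, zero_mul, zero_mul]

lemma lag_mul (hξ : Inhomogeneous η ξ) (n : Fin N) (u : ℂ) :
    lag ξ n u * (sinh (u - ξ n) * ∏ m ∈ Finset.univ.erase n, sinh (ξ n - ξ m)) = dFun ξ u := by
  have : ∏ m ∈ Finset.univ.erase n, sinh (ξ n - ξ m) ≠ 0 := Finset.prod_ne_zero_iff.2
    fun m hm => hξ.sinh_sub_ne_zero (Finset.ne_of_mem_erase hm).symm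
  rw [lag, Finset.prod_div_distrib, dFun, ← Finset.mul_prod_erase _ _ (Finset.mem_univ n)]
  field_simp

/-- The eigenvalue equation for the coefficient of one Bethe vector. -/
lemma IsSpectral.amplitude_mul (h : IsSpectral η α ξ M P) (hξ : Inhomogeneous η ξ)
    (hs : sinh η ≠ 0) {q : ℂ[X]} (hq : q.Monic) (hqM : q.natDegree = M)
    (hb : baxter η α ξ M P q = 0) {u : ℂ} (hu : ∀ n, sinh (u - ξ n) ≠ 0) {j : Fin M → Fin N}
    (hj : Function.Injective j) :
    amplitude η α ξ M P j * (trig N P u - diagCoeff η α ξ u j) =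
      ∑ a, ∑ k, amplitude η α ξ M P (Function.update j a k) * hop η α ξ u j a k (j a) := by
  -- for `σ` with the roots `ξ (j a)`, the quotient of `L σ` by `σ` is `t - diagCoeff`
  set σ : ℂ[X] := ∏ a, sinhPoly (ξ (j a)) with hσ
  have hσv : ∀ v, trig M σ v = ∏ a, sinh (v - ξ (j a)) := fun v => by
    have := trig_prod (Finset.univ : Finset (Fin M)) (fun a => sinhPoly (ξ (j a))) v
    rw [Finset.card_univ, Fintype.card_fin] at this
    rw [hσ, this]
    exact Finset.prod_congr rfl fun a _ => trig_sinhPoly _ _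
  have hσM : σ.natDegree ≤ M := by
    refine (natDegree_prod_le _ _).trans ((Finset.sum_le_card_nsmul _ _ 1 fun a _ => ?_).trans ?_)
    · exact (natDegree_sinhPoly _).le
    · simp
  have hS : ∏ a, sinh (u - ξ (j a)) ≠ 0 := Finset.prod_ne_zero_iff.2 fun a _ => hu _
  have hL : (trig N P u - diagCoeff η α ξ u j) * ∏ a, sinh (u - ξ (j a)) =
      trig (N + M) (baxter η α ξ M P σ) u := by
    rw [trig_baxter, hσv, hσv, hσv, diagCoeff, Finset.prod_div_distrib, Finset.prod_div_distrib]
    simp only [sub_right_comm _ η, add_sub_right_comm]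
    field_simp
    ring
  have hE : ∀ a, trig (N + M) (baxter η α ξ M P σ) (ξ (j a)) = exp α * aFun η ξ (ξ (j a)) *
      (sinh η * ∏ b ∈ Finset.univ.erase a, sinh (ξ (j a) - ξ (j b) - η)) := by
    intro a
    rw [trig_baxter_self, hσv, hσv, Finset.prod_eq_zero (Finset.mem_univ a) (by simp),
      ← Finset.mul_prod_erase _ _ (Finset.mem_univ a), sub_right_comm, sub_self, zero_sub,
      Complex.sinh_neg]
    simp only [sub_right_comm _ η]
    ring
  have hC : minor η α ξ M P j * trig (N + M) (baxter η α ξ M P σ) u =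
      ∑ a, trig (N + M) (baxter η α ξ M P σ) (ξ (j a)) *
        trig (N + M) (baxter η α ξ M P (cofactorPoly η α ξ M P j a)) u := by
    have h1 := congrArg (fun f => trig (N + M) (baxter η α ξ M P f) u)
      (sum_C_mul_cofactorPoly η α ξ P hq hqM hb hσM j)
    simp only [map_sum, trig_sum, ← smul_eq_C_mul, map_smul, map_sub, hb, smul_zero, sub_zero] at h1
    simp only [smul_eq_C_mul, trig_C_mul] at h1
    exact h1.symm
  refine mul_right_cancel₀ hS ?_
  rw [mul_assoc, hL, amplitude, show minor η α ξ M P j * pairProd (pairWeight η ξ) j *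
    (∏ a, siteWeight η ξ (j a)) * trig (N + M) (baxter η α ξ M P σ) u =
    pairProd (pairWeight η ξ) j * (∏ a, siteWeight η ξ (j a)) *
      (minor η α ξ M P j * trig (N + M) (baxter η α ξ M P σ) u) by ring, hC, Finset.mul_sum,
    Finset.sum_mul]
  refine Finset.sum_congr rfl fun a _ => ?_
  rw [h.trig_baxter_cofactorPoly_eq_sum hξ hs hj, Finset.mul_sum, Finset.mul_sum, Finset.sum_mul]
  refine Finset.sum_congr rfl fun k _ => ?_
  rw [amplitude]
  by_cases hk : ∃ b, b ≠ a ∧ k = j b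
  · obtain ⟨b, hba, rfl⟩ := hk
    rw [minor_eq_zero η α ξ P hba (by simp [hba])]
    ring
  push Not at hk
  have h0 : ∀ x y, x ≠ y → sinh (ξ x - ξ y) ≠ 0 ∧ sinh (ξ x - ξ y + η) ≠ 0 ∧
      sinh (ξ x - ξ y - η) ≠ 0 := fun x y hxy =>
    ⟨hξ.sinh_sub_ne_zero hxy, hξ.sinh_sub_add_ne_zero hxy, hξ.sinh_sub_sub_ne_zero hxy⟩
  obtain ⟨c, hc⟩ := exists_pairProd_update (θ := pairWeight η ξ) pairWeight_antisymm j a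
  have hcj := hc (j a)
  rw [Function.update_eq_self] at hcj
  have hw : ∏ b, siteWeight η ξ (Function.update j a k b) =
      siteWeight η ξ k * ∏ b ∈ Finset.univ.erase a, siteWeight η ξ (j b) := by
    rw [← Finset.mul_prod_erase _ _ (Finset.mem_univ a), Function.update_self]
    congr 1
    exact Finset.prod_congr rfl fun b hb => by
      rw [Function.update_of_ne (Finset.ne_of_mem_erase hb)]
  have hprod : (∏ b ∈ Finset.univ.erase a, pairWeight η ξ k (j b)) *
      (∏ b ∈ Finset.univ.erase a, sinh (ξ k - ξ (j b) - η) / sinh (ξ k - ξ (j b)) *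
        (sinh (ξ (j a) - ξ (j b)) / sinh (u - ξ (j b)) *
          (sinh (u - ξ (j b) + η) / sinh (ξ (j a) - ξ (j b) + η)))) *
      (∏ b ∈ Finset.univ.erase a, sinh (u - ξ (j b))) =
      (∏ b ∈ Finset.univ.erase a, pairWeight η ξ (j a) (j b)) *
      (∏ b ∈ Finset.univ.erase a, sinh (ξ (j a) - ξ (j b) - η)) *
      ∏ b ∈ Finset.univ.erase a, sinh (u - ξ (j b) + η) / sinh (ξ k - ξ (j b) + η) := by
    simp only [← Finset.prod_mul_distrib]
    refine Finset.prod_congr rfl fun b hb => ?_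
    have hba := Finset.ne_of_mem_erase hb
    obtain ⟨h1, h2, h3⟩ := h0 k (j b) (hk b hba)
    obtain ⟨h4, h5, h6⟩ := h0 (j a) (j b) (hj.ne hba.symm)
    have h7 := hu (j b)
    unfold pairWeight
    field_simp
  have hsite : siteWeight η ξ k * (sinh η / sinh (u - ξ k) * aFun η ξ (ξ k)) * lag ξ (j a) u *
      sinh (u - ξ (j a)) = siteWeight η ξ (j a) * aFun η ξ (ξ (j a)) * sinh η * lag ξ k u := by
    have hd : ∀ x, ∏ m ∈ Finset.univ.erase x, sinh (ξ x - ξ m) ≠ 0 := fun x =>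
      Finset.prod_ne_zero_iff.2 fun m hm => hξ.sinh_sub_ne_zero (Finset.ne_of_mem_erase hm).symm
    have h1 := (lag_mul hξ k u).trans (lag_mul hξ (j a) u).symm
    have h2 := aFun_self_ne_zero hξ hs k
    have h3 := aFun_self_ne_zero hξ hs (j a)
    have h4 := hd k
    have h5 := hd (j a)
    have h6 := hu k
    unfold siteWeight
    field_simp
    linear_combination -h1
  rw [hE, hc, hcj, hw, ← Finset.mul_prod_erase _ _ (Finset.mem_univ a),
    ← Finset.mul_prod_erase Finset.univ (fun b => sinh (u - ξ (j b))) (Finset.mem_univ a), hop]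
  have := congrArg₂ (· * ·) hsite hprod
  linear_combination (-(minor η α ξ M P (Function.update j a k) * c *
    (∏ b ∈ Finset.univ.erase a, siteWeight η ξ (j b)) * exp α)) * this

end

end

/-! ### The eigenvector of a spectral polynomial -/

section

variable {N : ℕ} {η α : ℂ} {ξ : Fin N → ℂ} {M : ℕ} {P : ℂ[X]}

/-- The eigenvector of a spectral polynomial, as a combination of Bethe vectors. -/
noncomputable def eigenvector (η α : ℂ) (ξ : Fin N → ℂ) (M : ℕ) (P : ℂ[X]) : Conf N → ℂ :=
  ∑ j : Fin M → Fin N, amplitude η α ξ M P j • bethe η ξ (Finset.univ.image j)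

/-- Moving the label `j a` to `n`, as an involution on the pairs `(j, n)`. -/
def moveEquiv (a : Fin M) : ((Fin M → Fin N) × Fin N) ≃ ((Fin M → Fin N) × Fin N) :=
  Function.Involutive.toPerm (fun p => (Function.update p.1 a p.2, p.1 a)) fun p => by simp

lemma sum_moveEquiv (a : Fin M) {E : Type*} [AddCommMonoid E] (f : (Fin M → Fin N) → Fin N → E) :
    ∑ j, ∑ n, f j n = ∑ j, ∑ n, f (Function.update j a n) (j a) := by
  rw [← Fintype.sum_prod_type', ← Fintype.sum_prod_type', ← (moveEquiv a).sum_comp]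
  rfl

/-- Collecting the coefficient of each Bethe vector by means of `moveEquiv` reduces the eigenvalue
equation to `IsSpectral.amplitude_mul`. -/
lemma IsSpectral.transfer_mulVec_eigenvector_of_ne (h : IsSpectral η α ξ M P)
    (hξ : Inhomogeneous η ξ)
    (hs : sinh η ≠ 0) {q : ℂ[X]} (hq : q.Monic) (hqM : q.natDegree = M)
    (hb : baxter η α ξ M P q = 0) {u : ℂ} (hu : ∀ n, sinh (u - ξ n) ≠ 0) :
    transfer η α ξ u *ᵥ eigenvector η α ξ M P = trig N P u • eigenvector η α ξ M P := by
  have h1 : ∀ j : Fin M → Fin N, amplitude η α ξ M P j • transfer η α ξ u *ᵥ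
      bethe η ξ (Finset.univ.image j) =
      (amplitude η α ξ M P j * diagCoeff η α ξ u j) • bethe η ξ (Finset.univ.image j) +
        ∑ a, ∑ n, if n ∈ (Finset.univ.erase a).image j then 0 else
          (amplitude η α ξ M P j * hop η α ξ u j a (j a) n) •
            bethe η ξ (Finset.univ.image (Function.update j a n)) := by
    intro j
    by_cases hj : Function.Injective j
    · rw [transfer_mulVec_bethe α hξ hs hu hj, smul_add, smul_smul, Finset.smul_sum]
      simp only [Finset.smul_sum, smul_ite, smul_zero, smul_smul]
    · simp [amplitude_eq_zero hj]
  have h2 : ∀ j : Fin M → Fin N, ∑ a, ∑ k, (if j a ∈ (Finset.univ.erase a).image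
      (Function.update j a k) then 0 else (amplitude η α ξ M P (Function.update j a k) *
        hop η α ξ u (Function.update j a k) a (Function.update j a k a) (j a)) •
          bethe η ξ (Finset.univ.image (Function.update (Function.update j a k) a (j a)))) =
      (amplitude η α ξ M P j * (trig N P u - diagCoeff η α ξ u j)) •
        bethe η ξ (Finset.univ.image j) := by
    intro j
    have hI : ∀ a k, (Finset.univ.erase a).image (Function.update j a k) =
        (Finset.univ.erase a).image j := fun a k =>
      Finset.image_congr fun b hb => Function.update_of_ne
        (Finset.ne_of_mem_erase (Finset.mem_coe.1 hb)) _ _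
    simp only [Function.update_idem, Function.update_eq_self, Function.update_self, hop_update, hI]
    by_cases hj : Function.Injective j
    · rw [h.amplitude_mul hξ hs hq hqM hb hu hj, Finset.sum_smul]
      refine Finset.sum_congr rfl fun a _ => ?_
      rw [Finset.sum_smul]
      refine Finset.sum_congr rfl fun k _ => if_neg fun hmem => ?_
      obtain ⟨b, hb, hba⟩ := Finset.mem_image.1 hmem
      exact Finset.ne_of_mem_erase hb (hj hba)
    · rw [amplitude_eq_zero hj, zero_mul, zero_smul]
      refine Finset.sum_eq_zero fun a _ => Finset.sum_eq_zero fun k _ => ?_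
      split_ifs with hmem
      · rfl
      · rw [amplitude_eq_zero, zero_mul, zero_smul]
        -- two equal labels different from `j a` survive the move of the label `j a`
        simp only [Function.Injective, not_forall] at hj
        obtain ⟨b, c, hbc, hne⟩ := hj
        have hnot : ∀ d, d ≠ a → j d ≠ j a := fun d hd hda =>
          hmem (Finset.mem_image.2 ⟨d, by simp [hd], hda⟩)
        have hba : b ≠ a := fun e => hnot c (fun e' => hne (e.trans e'.symm)) (by rw [← hbc, e])
        have hca : c ≠ a := fun e => hnot b (fun e' => hne (e'.trans e.symm)) (by rw [hbc, e])
        exact fun hinj => hne (hinj (by simp [hba, hca, hbc]))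
  rw [eigenvector, Matrix.mulVec_sum]
  simp only [Matrix.mulVec_smul, h1, Finset.sum_add_distrib]
  rw [Finset.sum_comm (s := Finset.univ (α := Fin M → Fin N))]
  have h3 : ∀ a, _ = _ := fun a => sum_moveEquiv a fun j n =>
    if n ∈ (Finset.univ.erase a).image j then (0 : Conf N → ℂ) else
          (amplitude η α ξ M P j * hop η α ξ u j a (j a) n) •
            bethe η ξ (Finset.univ.image (Function.update j a n))
  simp only [h3]
  rw [Finset.sum_comm, Finset.sum_congr rfl fun j _ => h2 j, ← Finset.sum_add_distrib,
    Finset.smul_sum]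
  refine Finset.sum_congr rfl fun j _ => ?_
  rw [← add_smul, smul_smul]
  congr 1
  ring

lemma continuous_transfer_mulVec (η α : ℂ) (ξ : Fin N → ℂ) (v : Conf N → ℂ) (s : Conf N) :
    Continuous fun u => (transfer η α ξ u *ᵥ v) s := by
  obtain ⟨p, -, hp, -⟩ := exists_trig_transfer η α ξ
  simp only [Matrix.mulVec, dotProduct, hp]
  exact continuous_finsetSum _ fun r _ => (continuous_trig _ _).mul continuous_const

/-- The points excluded in `IsSpectral.transfer_mulVec_eigenvector_of_ne` follow by continuity. -/
lemma IsSpectral.isEigen_eigenvector (h : IsSpectral η α ξ M P) (hξ : Inhomogeneous η ξ)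
    (hs : sinh η ≠ 0) {q : ℂ[X]} (hq : q.Monic) (hqM : q.natDegree = M)
    (hb : baxter η α ξ M P q = 0) :
    IsEigen η α ξ (trig N P) (eigenvector η α ξ M P) := by
  refine eq_of_forall_trig_ne_zero (d := N) (dPoly_ne_zero ξ)
    (f := fun u => transfer η α ξ u *ᵥ eigenvector η α ξ M P)
    (g := fun u => trig N P u • eigenvector η α ξ M P) (fun s => continuous_transfer_mulVec ..)
    (fun s => (continuous_trig N P).mul continuous_const) fun u hu => ?_
  rw [trig_dPoly] at hu
  exact h.transfer_mulVec_eigenvector_of_ne hξ hs hq hqM hb fun n =>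
    Finset.prod_ne_zero_iff.1 hu n (Finset.mem_univ n)

lemma downs_of_eigenvector_ne_zero (s : Conf N) (h : eigenvector η α ξ M P s ≠ 0) :
    downs s = M := by
  rw [eigenvector, Finset.sum_apply] at h
  obtain ⟨j, -, hj⟩ := Finset.exists_ne_zero_of_sum_ne_zero h
  have hinj : Function.Injective j := by
    by_contra hn
    simp [amplitude_eq_zero hn] at hj
  rw [Pi.smul_apply, smul_eq_mul] at hj
  rw [downs_of_bethe_ne_zero _ s (right_ne_zero_of_mul hj),
    Finset.card_image_of_injective _ hinj, Finset.card_univ, Fintype.card_fin]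

lemma minor_comp_perm (j : Fin M → Fin N) (τ : Equiv.Perm (Fin M)) :
    minor η α ξ M P (j ∘ τ) = (τ.sign : ℤ) * minor η α ξ M P j := by
  rw [minor, minor, ← Matrix.det_permute]
  rfl

/-- The signs of the minor and of the pair product cancel. -/
lemma amplitude_comp_perm (j : Fin M → Fin N) (τ : Equiv.Perm (Fin M)) :
    amplitude η α ξ M P (j ∘ τ) = amplitude η α ξ M P j := by
  have h1 : pairProd (pairWeight η ξ) (j ∘ τ) = (τ.sign : ℤ) * pairProd (pairWeight η ξ) j := by
    have := τ.prod_Ioi_comp_eq_sign_mul_prod (R := ℂ)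
      (f := fun a b => pairWeight η ξ (j a) (j b)) fun a b => pairWeight_antisymm _ _
    simpa [pairProd] using this
  have h2 : ∏ a, siteWeight η ξ ((j ∘ τ) a) = ∏ a, siteWeight η ξ (j a) :=
    Equiv.prod_comp τ fun a => siteWeight η ξ (j a)
  have h3 : ((τ.sign : ℤ) : ℂ) * ((τ.sign : ℤ) : ℂ) = 1 := by
    rw [← Int.cast_mul, Int.units_coe_mul_self, Int.cast_one]
  rw [amplitude, amplitude, minor_comp_perm, h1, h2]
  linear_combination (minor η α ξ M P j * pairProd (pairWeight η ξ) j *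
    ∏ a, siteWeight η ξ (j a)) * h3

/-- If all maximal minors vanished, there would be a solution of the Baxter equation of degree less
than `M`. -/
lemma IsSpectral.exists_amplitude_ne_zero (h : IsSpectral η α ξ M P) (hξ : Inhomogeneous η ξ)
    (hN : 1 ≤ N) (hs : sinh η ≠ 0)
    (hη : ∀ j : ℕ, 1 ≤ j → j ≤ N → exp (2 * j * η) ≠ 1)
    (hα : ∀ j : ℕ, j ≤ N → exp (2 * α) ≠ exp (((N : ℂ) - 2 * j) * η)) (hM : M ≤ N) {q : ℂ[X]}
    (hq : q.Monic) (hqM : q.natDegree = M) (hb : baxter η α ξ M P q = 0) :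
    ∃ j : Fin M → Fin N, amplitude η α ξ M P j ≠ 0 := by
  obtain ⟨j, hj⟩ := exists_det_submatrix_ne_zero (baxterMatrix η α ξ M P) fun c hc => by
    have hdeg : (∑ i : Fin M, C (c i) * X ^ (i : ℕ)).natDegree ≤ M :=
      natDegree_sum_le_of_forall_le _ _ fun i _ => (natDegree_C_mul_X_pow_le _ _).trans i.2.le
    have hcoeff : ∀ k, (∑ i : Fin M, C (c i) * X ^ (i : ℕ)).coeff k =
        if hk : k < M then c ⟨k, hk⟩ else 0 := by
      intro k
      simp only [finsetSum_coeff, coeff_C_mul_X_pow]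
      split_ifs with hk
      · rw [Finset.sum_eq_single ⟨k, hk⟩]
        · simp
        · exact fun i _ hi => if_neg fun e => hi (Fin.ext e.symm)
        · simp
      · exact Finset.sum_eq_zero fun i _ => if_neg fun (e : k = i) => hk (e ▸ i.2)
    have h0 := h.baxter_eq_zero hξ hs hN (hdeg.trans hM) fun n => by
      rw [trig_baxter_sum, hc, Pi.zero_apply]
    -- uniqueness makes the polynomial with coefficients `c` a multiple of `q`, of degree `M`
    have h1 := h.C_mul_eq_C_mul hη hα hM hdeg hqM.le h0 hb
    have h2 : q.coeff M = 1 := by rw [← hqM]; exact hq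
    rw [h2, C_1, one_mul, hcoeff M, dif_neg (lt_irrefl M), C_0, zero_mul] at h1
    funext i
    have h3 := hcoeff i
    rw [h1, Polynomial.coeff_zero, dif_pos i.2] at h3
    exact h3.symm
  have hinj : Function.Injective j := fun a b hab => by
    by_contra hne
    exact hj (minor_eq_zero η α ξ P hne hab)
  have h0 : ∀ x y, x ≠ y → pairWeight η ξ x y ≠ 0 := fun x y hxy =>
    div_ne_zero (hξ.sinh_sub_ne_zero hxy)
      (mul_ne_zero (hξ.sinh_sub_add_ne_zero hxy) (hξ.sinh_sub_sub_ne_zero hxy))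
  refine ⟨j, mul_ne_zero (mul_ne_zero hj ?_) ?_⟩
  · exact Finset.prod_ne_zero_iff.2 fun a _ => Finset.prod_ne_zero_iff.2 fun b hb =>
      h0 _ _ (hinj.ne (Finset.mem_Ioi.1 hb).ne)
  · exact Finset.prod_ne_zero_iff.2 fun a _ => inv_ne_zero (mul_ne_zero
      (aFun_self_ne_zero hξ hs _) (Finset.prod_ne_zero_iff.2 fun m hm =>
        hξ.sinh_sub_ne_zero (Finset.ne_of_mem_erase hm).symm))

/-- Bethe vectors at inhomogeneities are linearly independent, being joint eigenvectors of the
operators `D(ξₙ)` with different eigenvalues. -/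
lemma bethe_coeff_eq_zero (hξ : Inhomogeneous η ξ) (hs : sinh η ≠ 0)
    (c : Finset (Fin N) → ℂ) (hc : ∀ K, c K ≠ 0 → K.card = M)
    (h0 : ∑ K, c K • bethe η ξ K = 0) (J : Finset (Fin N)) : c J = 0 := by
  by_contra hJ
  -- `D(ξₙ)`, `n ∈ J`, applied one after the other kill all other Bethe vectors
  have key : ∀ I : Finset (Fin N), I ⊆ J →
      ∑ K with I ⊆ K, (c K * ∏ n ∈ I, ((∏ m ∈ Kᶜ, sinh (ξ n - ξ m)) *
        ∏ b ∈ K, sinh (ξ n - ξ b + η))) • bethe η ξ K = 0 := by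
    intro I
    induction I using Finset.induction_on with
    | empty => intro _; simpa using h0
    | insert n I hn ih =>
      intro hI
      have h1 := congrArg (mono η ξ (ξ n) 1 1 *ᵥ ·) (ih ((Finset.subset_insert n I).trans hI))
      simp only [Matrix.mulVec_sum, Matrix.mulVec_smul, Matrix.mulVec_zero,
        mono_D_mulVec_bethe hξ, smul_smul] at h1
      rw [← h1]
      refine Finset.sum_subset_zero_on_sdiff (fun K hK => ?_) (fun K hK => ?_) fun K hK => ?_
      · simp only [Finset.mem_filter, Finset.mem_univ, true_and] at hK ⊢
        exact (Finset.subset_insert n I).trans hK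
      · simp only [Finset.mem_sdiff, Finset.mem_filter, Finset.mem_univ, true_and,
          Finset.insert_subset_iff, not_and] at hK
        have hnK : n ∈ Kᶜ := Finset.mem_compl.2 fun h => hK.2 h hK.1
        rw [Finset.prod_eq_zero hnK (by simp), zero_mul, mul_zero, zero_smul]
      · rw [Finset.prod_insert hn]
        congr 1
        ring
  have h1 := key J subset_rfl
  rw [Finset.sum_eq_single J] at h1
  · rw [smul_eq_zero, or_iff_left (bethe_ne_zero hξ hs J), mul_eq_zero, or_iff_right hJ,
      Finset.prod_eq_zero_iff] at h1
    obtain ⟨n, hn, h1⟩ := h1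
    rw [mul_eq_zero, Finset.prod_eq_zero_iff, Finset.prod_eq_zero_iff] at h1
    rcases h1 with ⟨m, hm, h1⟩ | ⟨b, hb, h1⟩
    · exact hξ.sinh_sub_ne_zero (ne_of_mem_of_not_mem hn (Finset.mem_compl.1 hm)) h1
    · rcases eq_or_ne n b with rfl | hnb
      · exact hs (by simpa using h1)
      · exact hξ.sinh_sub_add_ne_zero hnb h1
  · intro K hK hKJ
    rw [Finset.mem_filter] at hK
    have : c K = 0 := by
      by_contra hne
      exact hKJ (Finset.eq_of_subset_of_card_le hK.2 (by rw [hc K hne, hc J hJ])).symm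
    rw [this, zero_mul, zero_smul]
  · intro h
    simp at h

lemma eigenvector_ne_zero (hξ : Inhomogeneous η ξ) (hs : sinh η ≠ 0)
    (h : ∃ j : Fin M → Fin N, amplitude η α ξ M P j ≠ 0) : eigenvector η α ξ M P ≠ 0 := by
  obtain ⟨j, hj⟩ := h
  have hinj : ∀ j : Fin M → Fin N, amplitude η α ξ M P j ≠ 0 → Function.Injective j :=
    fun j hj => by
      by_contra hn
      exact hj (amplitude_eq_zero hn)
  intro h0
  have hsum : ∑ K, (∑ i : Fin M → Fin N with Finset.univ.image i = K, amplitude η α ξ M P i) •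
      bethe η ξ K = 0 := by
    rw [← h0, eigenvector, ← Finset.sum_fiberwise (Finset.univ (α := Fin M → Fin N))
      (fun i => Finset.univ.image i)]
    refine Finset.sum_congr rfl fun K _ => ?_
    rw [Finset.sum_smul]
    exact Finset.sum_congr rfl fun i hi => by rw [(Finset.mem_filter.1 hi).2]
  have h1 := bethe_coeff_eq_zero (M := M) hξ hs _ (fun K hK => ?_) hsum (Finset.univ.image j)
  · -- all labellings of the same set of sites contribute the same amplitude
    have h2 : ∀ i ∈ Finset.univ.filter fun i : Fin M → Fin N =>
        Finset.univ.image i = Finset.univ.image j,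
        amplitude η α ξ M P i = amplitude η α ξ M P j := by
      intro i hi
      have hi' := (Finset.mem_filter.1 hi).2
      have hex : ∀ a, ∃ b, j b = i a := fun a => by
        have : i a ∈ Finset.univ.image j := hi' ▸ Finset.mem_image_of_mem i (Finset.mem_univ a)
        obtain ⟨b, -, hb⟩ := Finset.mem_image.1 this
        exact ⟨b, hb⟩
      choose τ hτ using hex
      have hicard : Function.Injective i := by
        have := Finset.card_image_iff.1 (show (Finset.univ.image i).card = Finset.univ.card by
          rw [hi', Finset.card_image_of_injective _ (hinj j hj)])
        rwa [Finset.coe_univ, Set.injOn_univ] at this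
      have hτi : Function.Injective τ := fun a b hab => hicard (by rw [← hτ, ← hτ, hab])
      rw [← amplitude_comp_perm j (Equiv.ofBijective τ (Finite.injective_iff_bijective.1 hτi))]
      congr 1
      funext a
      exact (hτ a).symm
    rw [Finset.sum_congr rfl h2, Finset.sum_const, nsmul_eq_mul, mul_eq_zero, or_iff_left hj,
      Nat.cast_eq_zero, Finset.card_eq_zero] at h1
    exact Finset.notMem_empty j (h1 ▸ Finset.mem_filter.2 ⟨Finset.mem_univ j, rfl⟩)
  · obtain ⟨i, hi, hne⟩ := Finset.exists_ne_zero_of_sum_ne_zero hK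
    rw [← (Finset.mem_filter.1 hi).2, Finset.card_image_of_injective _ (hinj i hne),
      Finset.card_univ, Fintype.card_fin]

end

/-! ### Eigenvectors in a separated basis -/

section

variable {N : ℕ} {η α : ℂ} {ξ : Fin N → ℂ} {M : ℕ} {P : ℂ[X]}

/-- Every spectral polynomial is an eigenvalue of the transfer matrix in its sector. -/
lemma IsSpectral.exists_isEigen (h : IsSpectral η α ξ M P) (hξ : Inhomogeneous η ξ)
    (hN : 1 ≤ N) (hs : sinh η ≠ 0)
    (hη : ∀ j : ℕ, 1 ≤ j → j ≤ N → exp (2 * j * η) ≠ 1)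
    (hα : ∀ j : ℕ, j ≤ N → exp (2 * α) ≠ exp (((N : ℂ) - 2 * j) * η)) (hM : M ≤ N) :
    ∃ v : Conf N → ℂ, v ≠ 0 ∧ IsEigen η α ξ (trig N P) v ∧ Sz N *ᵥ v = ((N : ℂ) - 2 * M) • v := by
  obtain ⟨q, hq, hqM, -, hb⟩ := h.exists_baxter_eq_zero hξ hN hs hη hα hM
  exact ⟨eigenvector η α ξ M P,
    eigenvector_ne_zero hξ hs (h.exists_amplitude_ne_zero hξ hN hs hη hα hM hq hqM hb),
    h.isEigen_eigenvector hξ hs hq hqM hb,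
    (Sz_mulVec_eq_iff M _).2 fun s => downs_of_eigenvector_ne_zero s⟩

lemma list_prod_mulVec {w : Conf N → ℂ} (f : Fin N → Op N) (c : Fin N → ℂ)
    (h : ∀ n, f n *ᵥ w = c n • w) (l : List (Fin N)) :
    (l.map f).prod *ᵥ w = (l.map c).prod • w := by
  induction l with
  | nil => simp
  | cons n l ih =>
    rw [List.map_cons, List.prod_cons, ← Matrix.mulVec_mulVec, ih, Matrix.mulVec_smul, h,
      smul_smul, List.map_cons, List.prod_cons, mul_comm]

/-- In a separated basis the components of an eigenvector factorize. -/
lemma IsEigen.sovCovector_dotProduct {t : ℂ → ℂ} {w : Conf N → ℂ} (hw : IsEigen η α ξ t w)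
    (S : Conf N → ℂ) (h : Conf N) : sovCovector η α ξ S h ⬝ᵥ w =
      (∏ n, ((exp α * aFun η ξ (ξ n))⁻¹ * t (ξ n)) ^ (h n : ℕ)) * (S ⬝ᵥ w) := by
  have h1 : ∀ n (k : ℕ), (((exp α * aFun η ξ (ξ n))⁻¹ • transfer η α ξ (ξ n)) ^ k) *ᵥ w =
      (((exp α * aFun η ξ (ξ n))⁻¹ * t (ξ n)) ^ k) • w := by
    intro n k
    induction k with
    | zero => simp
    | succ k ih =>
      rw [pow_succ', ← Matrix.mulVec_mulVec, ih, Matrix.mulVec_smul, Matrix.smul_mulVec, hw,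
        smul_smul, smul_smul, mul_assoc, ← pow_succ]
  rw [sovCovector, ← Matrix.dotProduct_mulVec, List.ofFn_eq_map,
    list_prod_mulVec _ _ (fun n => h1 n (h n)), ← List.ofFn_eq_map, List.prod_ofFn,
    dotProduct_smul, smul_eq_mul]

lemma IsSoVBasis.eq_zero {S : Conf N → ℂ} (hS : IsSoVBasis η α ξ S) {w : Conf N → ℂ}
    (h : ∀ k, sovCovector η α ξ S k ⬝ᵥ w = 0) : w = 0 := by
  have h1 : IsUnit (Matrix.of (sovCovector η α ξ S)) :=
    Matrix.linearIndependent_rows_iff_isUnit.1 hS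
  refine Matrix.mulVec_injective_of_isUnit h1 ?_
  rw [Matrix.mulVec_zero]
  exact funext h

/-- An eigenvector is determined, up to a factor, by its eigenvalue. -/
lemma IsSoVBasis.exists_eq_smul {S : Conf N → ℂ} (hS : IsSoVBasis η α ξ S) {t : ℂ → ℂ}
    {v w : Conf N → ℂ} (hv : IsEigen η α ξ t v) (hSv : S ⬝ᵥ v ≠ 0) (hw : IsEigen η α ξ t w) :
    ∃ c : ℂ, w = c • v := by
  refine ⟨(S ⬝ᵥ w) / (S ⬝ᵥ v), sub_eq_zero.1 (hS.eq_zero fun k => ?_)⟩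
  rw [dotProduct_sub, dotProduct_smul, hv.sovCovector_dotProduct, hw.sovCovector_dotProduct,
    smul_eq_mul]
  field_simp
  ring

lemma IsSoVBasis.dotProduct_ne_zero {S : Conf N → ℂ} (hS : IsSoVBasis η α ξ S) {t : ℂ → ℂ}
    {v : Conf N → ℂ} (hv : IsEigen η α ξ t v) (hv0 : v ≠ 0) : S ⬝ᵥ v ≠ 0 := fun h =>
  hv0 (hS.eq_zero fun k => by rw [hv.sovCovector_dotProduct, h, mul_zero])

lemma IsEigen.smul {t : ℂ → ℂ} {v : Conf N → ℂ} (hv : IsEigen η α ξ t v) (c : ℂ) :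
    IsEigen η α ξ t (c • v) := fun u => by
  rw [Matrix.mulVec_smul, hv, smul_comm]

/-- The eigenvector attached to a solution of the spectral curve equation, in a separated basis. -/
lemma IsQSolution.exists_isEigen {t Q : ℂ → ℂ} (hQ : IsQSolution η α ξ t M Q) (ht : Continuous t)
    (hξ : Inhomogeneous η ξ) (hN : 1 ≤ N) (hs : sinh η ≠ 0)
    (hη : ∀ j : ℕ, 1 ≤ j → j ≤ N → exp (2 * j * η) ≠ 1)
    (hα : ∀ j : ℕ, j ≤ N → exp (2 * α) ≠ exp (((N : ℂ) - 2 * j) * η)) (hM : M ≤ N)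
    {S : Conf N → ℂ} (hS : IsSoVBasis η α ξ S) :
    ∃ v : Conf N → ℂ, v ≠ 0 ∧ IsEigen η α ξ t v ∧ Sz N *ᵥ v = ((N : ℂ) - 2 * M) • v ∧
      (∀ h : Conf N, sovCovector η α ξ S h ⬝ᵥ v = ∏ n, Q (ξ n - ((h n : ℕ) : ℂ) * η)) ∧
      ∀ w : Conf N → ℂ, IsEigen η α ξ t w → ∃ c : ℂ, w = c • v := by
  obtain ⟨r, P, hr, htP, hQξ, hb, hP⟩ := hQ.exists_isSpectral hξ hs ht
  obtain ⟨v, hv0, hv, hz⟩ := hP.exists_isEigen hξ hN hs hη hα hM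
  rw [show trig N P = t from funext fun u => (htP u).symm] at hv
  have hSv := hS.dotProduct_ne_zero hv hv0
  have hprod : ∏ n, Q (ξ n) ≠ 0 := Finset.prod_ne_zero_iff.2 fun n _ => hQξ n
  set c := (∏ n, Q (ξ n)) / (S ⬝ᵥ v) with hc
  have hc0 : c ≠ 0 := div_ne_zero hprod hSv
  have hSc : S ⬝ᵥ (c • v) = ∏ n, Q (ξ n) := by
    rw [dotProduct_smul, smul_eq_mul, hc, div_mul_cancel₀ _ hSv]
  refine ⟨c • v, smul_ne_zero hc0 hv0, hv.smul c, ?_, fun h => ?_, fun w hw =>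
    hS.exists_eq_smul (hv.smul c) (hSc ▸ hprod) hw⟩
  · rw [Matrix.mulVec_smul, hz, smul_comm]
  · rw [(hv.smul c).sovCovector_dotProduct, hSc, ← Finset.prod_mul_distrib]
    refine Finset.prod_congr rfl fun n _ => ?_
    have ha := aFun_self_ne_zero hξ hs n
    have he := Complex.exp_ne_zero α
    have h1 := trig_baxter_self (η := η) (α := α) (ξ := ξ) (M := M) (P := P) (dPoly r) n
    rw [hb, trig_zero, ← htP, ← hr, ← hr, eq_comm, sub_eq_zero] at h1
    generalize h n = k
    fin_cases k
    · simp
    · simp only [pow_one, Nat.cast_one, one_mul]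
      field_simp
      linear_combination h1

lemma cosh_ne_zero_of_exp_ne_one {x : ℂ} (h : exp (4 * x) ≠ 1) : cosh x ≠ 0 := fun h0 => by
  refine h ?_
  have h1 : sinh (2 * x) = 0 := by rw [Complex.sinh_two_mul, h0, mul_zero]
  rw [← (sinh_eq_zero_iff_exp _).1 h1]
  ring_nf

lemma exp_two_mul_ne_one_of_twist_ne_smul
    (hK : ∀ x : ℂ, twist α ≠ x • (1 : Matrix (Fin 2) (Fin 2) ℂ)) : exp (2 * α) ≠ 1 := fun h => by
  refine hK (exp α) ?_
  have : exp (-α) = exp α := by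
    rw [← mul_one (exp (-α)), ← h, ← Complex.exp_add]
    ring_nf
  ext i j
  fin_cases i <;> fin_cases j <;> simp [twist, this]

end

end XXZ

theorem mainTheorem10 (N : ℕ) (hN : 1 ≤ N) (η α : ℂ)
    (hK : ∀ x : ℂ, XXZ.twist α ≠ x • (1 : Matrix (Fin 2) (Fin 2) ℂ))
    (hη : ∀ j : ℕ, 1 ≤ j → j ≤ N → Complex.exp (2 * j * η) ≠ 1)
    (hα : ∀ j : ℕ, j ≤ N → Complex.exp (2 * α) ≠ Complex.exp (((N : ℂ) - 2 * j) * η)) :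
    ∃ P : MvPolynomial (Fin N) ℂ, P ≠ 0 ∧
      ∀ ξ : Fin N → ℂ, XXZ.Inhomogeneous η ξ →
        ∀ t : ℂ → ℂ, Differentiable ℂ t → ∀ M : ℕ, M ≤ N →
          -- generic inhomogeneities: both directions, and `Σ^{(N-2M)}` is the spectrum on `S_z = N-2M`
          (MvPolynomial.eval (fun n => Complex.exp (ξ n)) P ≠ 0 →
            (t ∈ XXZ.SigmaSet η α ξ ((N : ℤ) - 2 * M) ↔
              ∃ Q : ℂ → ℂ, XXZ.IsQSolution η α ξ t M Q ∧
                ∀ M' : ℕ, M' ≤ N → ∀ Q' : ℂ → ℂ, XXZ.IsQSolution η α ξ t M' Q' →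
                  Q' = Q ∨ Q' = -Q) ∧
            (t ∈ XXZ.SigmaSet η α ξ ((N : ℤ) - 2 * M) ↔
              ∃ v : XXZ.Conf N → ℂ, v ≠ 0 ∧ XXZ.IsEigen η α ξ t v ∧
                (XXZ.Sz N).mulVec v = ((N : ℂ) - 2 * M) • v)) ∧
          -- all inhomogeneities
          (∀ Q : ℂ → ℂ, XXZ.IsQSolution η α ξ t M Q →
            t ∈ XXZ.SigmaSet η α ξ ((N : ℤ) - 2 * M) ∧
            (∀ M' : ℕ, M' ≤ N → ∀ Q' : ℂ → ℂ, XXZ.IsQSolution η α ξ t M' Q' →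
              Q' = Q ∨ Q' = -Q) ∧
            ∀ S : XXZ.Conf N → ℂ, XXZ.IsSoVBasis η α ξ S →
              ∃ v : XXZ.Conf N → ℂ, v ≠ 0 ∧ XXZ.IsEigen η α ξ t v ∧
                (XXZ.Sz N).mulVec v = ((N : ℂ) - 2 * M) • v ∧
                (∀ h : XXZ.Conf N, XXZ.sovCovector η α ξ S h ⬝ᵥ v =
                  ∏ n, Q (ξ n - ((h n : ℕ) : ℂ) * η)) ∧
                ∀ w : XXZ.Conf N → ℂ, XXZ.IsEigen η α ξ t w → ∃ c : ℂ, w = c • v) := by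
  have hs : Complex.sinh η ≠ 0 := fun h => hη 1 le_rfl hN (by
    rw [Nat.cast_one, mul_one]; exact (XXZ.sinh_eq_zero_iff_exp η).1 h)
  have hc : Complex.cosh (η * N / 2) ≠ 0 := XXZ.cosh_ne_zero_of_exp_ne_one (by
    have := hη N hN le_rfl
    rwa [show 4 * (η * N / 2) = 2 * N * η by ring])
  have hK' := XXZ.exp_two_mul_ne_one_of_twist_ne_smul hK
  obtain ⟨R, hR0, hR⟩ := XXZ.exists_generic_polynomial hN hs hη hα
  refine ⟨R, hR0, fun ξ hξ t ht M hM => ?_⟩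
  have htc := ht.continuous
  have hSigma := XXZ.mem_SigmaSet_iff (α := α) hξ hc M t
  have huniq : ∀ Q, XXZ.IsQSolution η α ξ t M Q → ∀ M' : ℕ, M' ≤ N → ∀ Q' : ℂ → ℂ,
      XXZ.IsQSolution η α ξ t M' Q' → Q' = Q ∨ Q' = -Q := fun Q hQ M' hM' Q' hQ' =>
    hQ.eq_or_eq_neg hξ hs hK' hη hα htc hM hM' hQ'
  have hback : ∀ Q, XXZ.IsQSolution η α ξ t M Q → t ∈ XXZ.SigmaSet η α ξ ((N : ℤ) - 2 * M) :=
    fun Q hQ => by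
      obtain ⟨-, P, -, htP, -, -, hP⟩ := hQ.exists_isSpectral hξ hs htc
      exact hSigma.2 ⟨P, hP, htP⟩
  refine ⟨fun hgen => ⟨⟨fun h => ?_, fun ⟨Q, hQ, _⟩ => hback Q hQ⟩, ⟨fun h => ?_, ?_⟩⟩,
    fun Q hQ => ⟨hback Q hQ, huniq Q hQ, fun S hS =>
      hQ.exists_isEigen htc hξ hN hs hη hα hM hS⟩⟩
  · obtain ⟨P, hP, htP⟩ := hSigma.1 h
    obtain ⟨q, hq, hqM, hq0, hb⟩ := hP.exists_baxter_eq_zero hξ hN hs hη hα hM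
    obtain ⟨Q, hQ⟩ := XXZ.exists_isQSolution_of_baxter htP hq hqM hq0
      (hR ξ hξ hgen M hM P q hP hq hqM hb) hb
    exact ⟨Q, hQ, huniq Q hQ⟩
  · obtain ⟨P, hP, htP⟩ := hSigma.1 h
    rw [show t = XXZ.trig N P from funext htP]
    exact hP.exists_isEigen hξ hN hs hη hα hM
  · rintro ⟨v, hv0, hv, hz⟩
    exact hSigma.2 (hv.exists_isSpectral hv0 ((XXZ.Sz_mulVec_eq_iff M v).1 hz))
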